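/- Let $e\ge 1$ be an integer with $3\mid 2e+1$, let $q=2^{2e+1}$, and let $\theta$ be the automorphism $t\mapsto t^{2^{e+1}}$ of $\mathbb F_q$. Let $\mathcal O\subset \mathrm{PG}(3,q)$ be the Suzuki–Tits ovoid: the point $(0:1:0:0)$ together with all points $(1:z:x:y)$ with $z=xy+x^{\theta+2}+y^{\theta}$. Let $G=\mathrm{Sz}(q)$ be the group of projectivities of $\mathrm{PG}(3,q)$ preserving $\mathcal O$. Let $\rho_0\in G$ be an involution and $\tau$ a triality of $G$, i.e. an outer automorphism of $G$ of order $3$. Put $\rho_1=\tau(\rho_0)$, $\rho_2=\tau^2(\rho_0)$, and let $m$ be the order of $\rho_0\rho_1$. For $\{i,j,k\}=\{0,1,2\}$ let $H_i=\langle\rho_j,\rho_k\rangle$ and let $\mathcal O_i$ be the set of points of $\mathcal O$ fixed by some involution of $H_i$. Assume that the triangle $T=(\mathcal O_0,\mathcal O_1,\mathcal O_2)$ is non-degenerate ($\mathcal O_0,\mathcal O_1,\mathcal O_2$ are pairwise distinct) and proper ($\mathcal O_0\cap\mathcal O_1\cap\mathcal O_2=\emptyset$). Let $C=\{(\gamma(\mathcal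 O_0),\gamma(\mathcal O_1),\gamma(\mathcal O_2)) : \gamma\in G\}$ and $UC=\{\{\gamma(\mathcal O_0),\gamma(\mathcal O_1),\gamma(\mathcal O_2)\} : \gamma\in G\}$. Then: 1. $|C|=|G|$ and $|UC|=|G|$. 2. For every $d=(d_0,d_1,d_2)\in C$ and every $i\in\{0,1,2\}$, the setwise stabilizer of $d_i$ in $G$ contains exactly one dihedral subgroup $H_i(d)$ of order $2m$, and whenever $\{i,j,k\}=\{0,1,2\}$ the group $H_j(d)\cap H_k(d)$ contains exactly one involution $\rho_i(d)$. 3. For $i\in\{0,1,2\}$ and $c_1,c_2\in C$ write $c_1\sim_i c_2$ if $c_1=\rho_i(c_1)(c_2)$ or $c_1=c_2$. Each $\sim_i$ is an equivalence relation on $C$, so that $(C,(\sim_i)_{i\in\{0,1,2\}})$ is a chamber system. The natural action of $G$ on $C$ is by automorphisms of this chamber system (bijections of $C$ which, together with their inverses, preserve every $\sim_i$), and $G$ is chamber-transitive, indeed regular: for all $c,d\in C$ there is exactly one $\gamma\in G$ with $\gamma(c)=d$. -/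

import Mathlib

open scoped Pointwise LinearAlgebra.Projectivization

/-! ### Chamber systems -/

/-- A chamber system over `I` with set of chambers `C`: one equivalence relation for each
`i : I`. -/
structure ChamberSystem (I C : Type*) where
  adj : I → Setoid C

namespace ChamberSystem

/-- Homomorphisms from a chamber system to itself: maps preserving each `i`-adjacency. -/
def IsHom {I C : Type*} (S : ChamberSystem I C) (f : C → C) : Prop :=
  ∀ (i : I) (c d : C), S.adj i c d → S.adj i (f c) (f d)

/-- The automorphism group of a chamber system: the bijective homomorphisms whose inverse is
also a homomorphism. -/
def autGroup {I C : Type*} (S : ChamberSystem I C) : Subgroup (Equiv.Perm C) where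
  carrier := {f | S.IsHom f ∧ S.IsHom f.symm}
  mul_mem' := fun {_ _} hf hg =>
    ⟨fun i c d h => hf.1 i _ _ (hg.1 i c d h), fun i c d h => hg.2 i _ _ (hf.2 i c d h)⟩
  one_mem' := ⟨fun _ _ _ h => h, fun _ _ _ h => h⟩
  inv_mem' := fun {_} hf => ⟨hf.2, hf.1⟩

end ChamberSystem

/-! ### The Suzuki-Tits ovoid and the Suzuki group -/

namespace Suzuki

/-- The point `U = (0 : 1 : 0 : 0)` of `PG(3, F)`. -/
def pointU (F : Type*) [Field F] : ℙ F (Fin 4 → F) :=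
  Projectivization.mk F ![0, 1, 0, 0] (fun h => one_ne_zero (congrFun h 1))

/-- The point `(1 : z : x : y)` of `PG(3, F)`, that is the point off the plane `X₀ = 0` with
affine coordinates `x = X₂ / X₀`, `y = X₃ / X₀`, `z = X₁ / X₀`. -/
def affinePoint {F : Type*} [Field F] (x y z : F) : ℙ F (Fin 4 → F) :=
  Projectivization.mk F ![1, z, x, y] (fun h => one_ne_zero (congrFun h 0))

/-- The Suzuki-Tits ovoid of `PG(3, F)`, where `F` has order `2 ^ (2 * e + 1)`: the point `U`
together with the affine points with `z = x y + x ^ (θ + 2) + y ^ θ`, where `θ` is the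
automorphism `t ↦ t ^ (2 ^ (e + 1))` of `F`. -/
def ovoid (F : Type*) [Field F] (e : ℕ) : Set (ℙ F (Fin 4 → F)) :=
  insert (pointU F)
    {p | ∃ x y z : F, z = x * y + x ^ 2 ^ (e + 1) * x ^ 2 + y ^ 2 ^ (e + 1) ∧
      p = affinePoint x y z}

/-- The group of projectivities of `PG(3, F)`, that is `PGL(4, F)` as a group of permutations of
the points: the permutations induced by invertible linear maps. -/
def projectivities (F : Type*) [Field F] : Subgroup (Equiv.Perm (ℙ F (Fin 4 → F))) :=
  (MulAction.toPermHom ((Fin 4 → F) ≃ₗ[F] (Fin 4 → F)) (ℙ F (Fin 4 → F))).range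

/-- The Suzuki group `Sz(q)`, `q = |F| = 2 ^ (2 * e + 1)`: the group of projectivities of
`PG(3, F)` preserving the Suzuki-Tits ovoid. It acts on the points of `PG(3, F)`, hence on sets of
points and on triples of sets of points. -/
def Sz (F : Type*) [Field F] (e : ℕ) : Subgroup (Equiv.Perm (ℙ F (Fin 4 → F))) :=
  projectivities F ⊓ MulAction.stabilizer (Equiv.Perm (ℙ F (Fin 4 → F))) (ovoid F e)

/-- Ordered triples `(O₀, O₁, O₂)` of sets of points. -/
abbrev Triple (F : Type*) [Field F] : Type _ := Fin 3 → Set (ℙ F (Fin 4 → F))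

/-- A triality of a group: an outer automorphism of order `3`. -/
def IsTriality {G : Type*} [Group G] (τ : MulAut G) : Prop :=
  orderOf τ = 3 ∧ τ ∉ (MulAut.conj : G →* MulAut G).range

section
variable {F : Type*} [Field F] {e : ℕ}

/-- `ρ_i = τ ^ i (ρ₀)` for `i = 0, 1, 2`. -/
def rho (ρ₀ : Sz F e) (τ : MulAut (Sz F e)) (i : Fin 3) : Sz F e :=
  (τ ^ (i : ℕ)) ρ₀

/-- The subgroup `H_i = ⟨ρ_j, ρ_k⟩`, where `{i, j, k} = {0, 1, 2}`. -/
def sideGroup (ρ₀ : Sz F e) (τ : MulAut (Sz F e)) (i : Fin 3) : Subgroup (Sz F e) :=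
  Subgroup.closure {rho ρ₀ τ (i + 1), rho ρ₀ τ (i + 2)}

/-- The set of points of the ovoid that are fixed by some involution of `H`. -/
def fixedPoints (H : Subgroup (Sz F e)) : Set (ℙ F (Fin 4 → F)) :=
  {p | p ∈ ovoid F e ∧ ∃ h ∈ H, orderOf h = 2 ∧ h • p = p}

/-- The triangle `T_{ρ₀, τ} = (O₀, O₁, O₂)` associated to `(ρ₀, τ)`. -/
def triangle (ρ₀ : Sz F e) (τ : MulAut (Sz F e)) : Triple F :=
  fun i => fixedPoints (sideGroup ρ₀ τ i)

/-- A triple is non-degenerate if its three members are all distinct. -/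
def NonDegenerate (d : Triple F) : Prop := ∀ i j, i ≠ j → d i ≠ d j

/-- A triple is proper if its three members have no common point. -/
def Proper (d : Triple F) : Prop := d 0 ∩ d 1 ∩ d 2 = ∅

/-- The orbit `C` of a triple under `Sz(q)`. -/
abbrev chambers (e : ℕ) (T : Triple F) : Set (Triple F) := MulAction.orbit (Sz F e) T

/-- The set of unordered triples underlying the members of the orbit of `T`. -/
def unorderedChambers (e : ℕ) (T : Triple F) : Set (Set (Set (ℙ F (Fin 4 → F)))) :=
  Set.range fun γ : Sz F e => {(γ • T) 0, (γ • T) 1, (γ • T) 2}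

/-- `H` is a dihedral subgroup of order `2 m` of the stabilizer of the set of points `X`. -/
def IsDihedralInStabilizer (m : ℕ) (X : Set (ℙ F (Fin 4 → F))) (H : Subgroup (Sz F e)) : Prop :=
  H ≤ MulAction.stabilizer (Sz F e) X ∧ Nonempty (H ≃* DihedralGroup m)

/-- `H_i(d)`: the dihedral subgroup of order `2 m` of the stabilizer of the `i`-th member of `d`
(meaningful when there is exactly one). -/
noncomputable def chamberGroup (e m : ℕ) (d : Triple F) (i : Fin 3) : Subgroup (Sz F e) :=
  Classical.epsilon fun H => IsDihedralInStabilizer m (d i) H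

/-- `r` is an involution in `H_j(d) ∩ H_k(d)`, where `{i, j, k} = {0, 1, 2}`. -/
def IsChamberInvolution (m : ℕ) (d : Triple F) (i : Fin 3) (r : Sz F e) : Prop :=
  orderOf r = 2 ∧ r ∈ chamberGroup e m d (i + 1) ⊓ chamberGroup e m d (i + 2)

/-- `ρ_i(d)`: the involution in `H_j(d) ∩ H_k(d)`, where `{i, j, k} = {0, 1, 2}` (meaningful when
there is exactly one). -/
noncomputable def chamberInvolution (e m : ℕ) (d : Triple F) (i : Fin 3) : Sz F e :=
  Classical.epsilon fun r => IsChamberInvolution m d i r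

/-- The relation `c₁ ∼_i c₂`: either `c₁ = ρ_i(c₁)(c₂)` or `c₁ = c₂`. -/
def Adj (e m : ℕ) (i : Fin 3) (c₁ c₂ : Triple F) : Prop :=
  c₁ = chamberInvolution e m c₁ i • c₂ ∨ c₁ = c₂

end

end Suzuki

/-! The heart of the matter is that a side determines its dihedral group: if `a`, `b` are distinct
involutions with product of odd order `m`, `H = ⟨a, b⟩` and `D = fixedPoints H`, then every
involution of the setwise stabilizer `S` of `D` lies in `H`. The rotations of `H` act regularly on
`D`, so `|D| = m` is odd and every involution of `S` fixes a point of `D`. It remains to see that a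
point `p` of `D` is fixed by only one involution of `S` (`IsDihedralOrbit.eq_of_orderOf_eq_two`).
This is proved by counting, without the list of subgroups of `Sz(q)`. Only a few properties of the
action enter, collected in `IsSuzukiAction`: an element fixing three points is trivial, an
involution fixes one point, centralizers of involutions have exponent 4 and restricted squares, and
no element has order 3. If the involutions at `p` together with 1 form a group of order `n + 1 > 2`,
the count of fixed points forces `|S| = n (n + 1) (n + 2)`, as in `SL₂(n + 1)`. That number is
divisible by 3, which is impossible.

Two sides of a non-degenerate triangle have only one involution in common: two common involutions
would give a common nontrivial rotation, and a power of it of prime order has a cyclic centralizer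
(`isCyclic_centralizer`) containing both rotation groups. These have the same order, so they
coincide, and so do the sides (`closure_eq_closure`). Non-degeneracy also forces `m` to be odd and
the three involutions to be distinct, for otherwise they would all fix the same point.

Hence an element of `G` that fixes the ordered triple `T` commutes with all `ρ_i`, fixes their three
distinct points on the ovoid and is trivial. If it only permutes the members of `T`, its cube or its
square is trivial. Order 3 does not occur. An involution `δ` interchanging two members fixes the
third, `O_i`, and the point of `ρ_i`; that point is then the fixed point of `δ` on the odd set
`O_i`, so it lies in all three members, against properness (`eq_one_of_permutes`).

So `γ ↦ γ • T` identifies `G` with `C`. The involution `ρ_i(γ • T)` is `γ ρ_i γ⁻¹`, and the classes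
of `∼_i` become the left cosets of `⟨ρ_i⟩`, which left multiplication preserves. -/

namespace Suzuki

/-! ### The field automorphism -/

section Field
variable (F : Type*) [Field F] [CharP F 2] (e : ℕ)

/-- The endomorphism `t ↦ t ^ 2 ^ (e + 1)` of a field of characteristic two. -/
noncomputable def theta : F →+* F := iterateFrobenius F 2 (e + 1)

variable {F e}

theorem theta_apply (x : F) : theta F e x = x ^ 2 ^ (e + 1) := iterateFrobenius_def 2 (e + 1) x

theorem two_eq_zero : (2 : F) = 0 := CharTwo.two_eq_zero

omit [CharP F 2] in
theorem pow_natCard_eq [Finite F] (x : F) : x ^ Nat.card F = x := by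
  have := Fintype.ofFinite F
  rw [Nat.card_eq_fintype_card, FiniteField.pow_card]

/-- Since `2 (e + 1) = (2 e + 1) + 1` and `x ^ q = x`, `θ` is a square root of the Frobenius map. -/
theorem theta_theta [Finite F] (hF : Nat.card F = 2 ^ (2 * e + 1)) (x : F) :
    theta F e (theta F e x) = x ^ 2 := by
  rw [theta_apply, theta_apply, ← pow_mul, ← pow_add,
    show e + 1 + (e + 1) = (2 * e + 1) + 1 by ring, pow_succ, ← hF, pow_mul, pow_natCard_eq]

theorem theta_ne_zero {x : F} (hx : x ≠ 0) : theta F e x ≠ 0 := (map_ne_zero _).2 hx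

/-- Applying `θ` to `k ^ (θ + 1) = 1` gives `k ^ 2 * θ k = 1`, and comparison with the given
equation leaves `k = 1`. -/
theorem eq_one_of_theta_mul_self [Finite F] (hF : Nat.card F = 2 ^ (2 * e + 1)) {k : F}
    (h : theta F e k * k = 1) : k = 1 := by
  have hk : k ≠ 0 := by rintro rfl; simp at h
  have h2 : k ^ 2 * theta F e k = 1 := by
    rw [← theta_theta hF, ← map_mul, h, map_one]
  have : k * (theta F e k * k) = 1 := by linear_combination h2
  rwa [h, mul_one] at this

theorem theta_mul_self_injective [Finite F] (hF : Nat.card F = 2 ^ (2 * e + 1)) {a b : F}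
    (h : theta F e a * a = theta F e b * b) : a = b := by
  by_cases hb : b = 0
  · subst hb; simpa using h
  have hb' := theta_ne_zero (e := e) hb
  have : a / b = 1 := eq_one_of_theta_mul_self hF (by
    rw [map_div₀]; field_simp; exact h)
  rwa [div_eq_one_iff_eq hb] at this

theorem eq_one_of_sq_eq_one {k : F} (h : k ^ 2 = 1) : k = 1 := by
  have : (k - 1) ^ 2 = 0 := by linear_combination h + (1 - k) * two_eq_zero (F := F)
  exact sub_eq_zero.1 (pow_eq_zero_iff two_ne_zero |>.1 this)

/-- From `q ≡ 2` modulo 3 it follows that 3 divides neither `q - 1` nor `q ^ 2 + 1`, the reason why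
`Sz(q)` has no element of order 3. -/
theorem exists_two_pow_eq (e : ℕ) : ∃ n, 2 ^ (2 * e + 1) = 3 * n + 2 := by
  induction e with
  | zero => exact ⟨0, rfl⟩
  | succ e ih =>
    obtain ⟨n, hn⟩ := ih
    exact ⟨4 * n + 2, by rw [show 2 * (e + 1) + 1 = (2 * e + 1) + 2 by ring, pow_add, hn]; ring⟩

theorem eq_one_of_pow_three_eq_one [Finite F] (hF : Nat.card F = 2 ^ (2 * e + 1)) {k : F}
    (h : k ^ 3 = 1) : k = 1 := by
  obtain ⟨n, hn⟩ := exists_two_pow_eq e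
  have h1 := pow_natCard_eq k
  rw [hF, hn, pow_add, pow_mul, h, one_pow, one_mul] at h1
  have : k * k ^ 2 = 1 := by rw [← h]; ring
  rw [h1] at this
  exact eq_one_of_sq_eq_one (by rw [pow_two]; exact this)

end Field

/-! ### Points of the ovoid -/

section Ovoid
variable {F : Type*} [Field F]

theorem affinePoint_inj {x y z x' y' z' : F} :
    affinePoint x y z = affinePoint x' y' z' ↔ x = x' ∧ y = y' ∧ z = z' := by
  constructor
  · intro h
    obtain ⟨c, hc⟩ := (Projectivization.mk_eq_mk_iff' _ _ _ _ _).1 h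
    have h0 : c = 1 := by simpa using congrFun hc 0
    subst h0
    have h1 := congrFun hc 1
    have h2 := congrFun hc 2
    have h3 := congrFun hc 3
    simp at h1 h2 h3
    exact ⟨h2.symm, h3.symm, h1.symm⟩
  · rintro ⟨rfl, rfl, rfl⟩; rfl

theorem affinePoint_ne_pointU {x y z : F} : affinePoint x y z ≠ pointU F := by
  intro h
  obtain ⟨c, hc⟩ := (Projectivization.mk_eq_mk_iff' _ _ _ _ _).1 h
  simpa using congrFun hc 0

variable [CharP F 2]

/-- The point of the ovoid with affine coordinates `x`, `y`. -/
noncomputable def ovoidPoint (e : ℕ) (x y : F) : ℙ F (Fin 4 → F) :=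
  affinePoint x y (x * y + theta F e x * x ^ 2 + theta F e y)

variable {e : ℕ}

theorem ovoidPoint_inj {x y x' y' : F} :
    ovoidPoint e x y = ovoidPoint e x' y' ↔ x = x' ∧ y = y' := by
  constructor
  · intro h
    obtain ⟨h1, h2, -⟩ := affinePoint_inj.1 h
    exact ⟨h1, h2⟩
  · rintro ⟨rfl, rfl⟩; rfl

theorem ovoidPoint_ne_pointU {x y : F} : ovoidPoint e x y ≠ pointU F := affinePoint_ne_pointU

theorem mem_ovoid {p : ℙ F (Fin 4 → F)} :
    p ∈ ovoid F e ↔ p = pointU F ∨ ∃ x y, p = ovoidPoint e x y := by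
  simp only [ovoid, Set.mem_insert_iff, Set.mem_ofPred_eq, ovoidPoint, theta_apply]
  constructor
  · rintro (h | ⟨x, y, z, rfl, h⟩)
    · exact Or.inl h
    · exact Or.inr ⟨x, y, h⟩
  · rintro (h | ⟨x, y, h⟩)
    · exact Or.inl h
    · exact Or.inr ⟨x, y, _, rfl, h⟩

theorem pointU_mem : pointU F ∈ ovoid F e := mem_ovoid.2 (Or.inl rfl)

theorem ovoidPoint_mem (x y : F) : ovoidPoint e x y ∈ ovoid F e :=
  mem_ovoid.2 (Or.inr ⟨x, y, rfl⟩)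

theorem ncard_ovoid [Finite F] : (ovoid F e).ncard = Nat.card F ^ 2 + 1 := by
  have h : ovoid F e = insert (pointU F) (Set.range fun p : F × F => ovoidPoint e p.1 p.2) := by
    ext p
    rw [mem_ovoid, Set.mem_insert_iff, Set.mem_range]
    constructor
    · rintro (h | ⟨x, y, h⟩)
      · exact Or.inl h
      · exact Or.inr ⟨(x, y), h.symm⟩
    · rintro (h | ⟨⟨x, y⟩, h⟩)
      · exact Or.inl h
      · exact Or.inr ⟨x, y, h.symm⟩
  rw [h, Set.ncard_insert_of_notMem _ (Set.finite_range _)]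
  · rw [← Set.image_univ, Set.ncard_image_of_injective _ _, Set.ncard_univ, Nat.card_prod, sq]
    intro p q hpq
    exact Prod.ext_iff.2 (ovoidPoint_inj.1 hpq)
  · rintro ⟨p, hp⟩
    exact ovoidPoint_ne_pointU hp

theorem finite_ovoid [Finite F] : (ovoid F e).Finite :=
  Set.finite_of_ncard_ne_zero (by rw [ncard_ovoid]; omega)

end Ovoid

/-! ### Elements of the Suzuki group from linear maps -/

section Group
variable {F : Type*} [Field F]

theorem smul_mk_eq_iff (L : (Fin 4 → F) ≃ₗ[F] (Fin 4 → F)) {v w : Fin 4 → F} (hv : v ≠ 0)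
    (hw : w ≠ 0) :
    L • Projectivization.mk F v hv = Projectivization.mk F w hw ↔ ∃ c : F, c • w = L v := by
  rw [Projectivization.smul_mk, Projectivization.mk_eq_mk_iff']
  rfl

variable {e : ℕ}

/-- The element of the Suzuki group given by a linear map preserving the ovoid. -/
def ofLinear [CharP F 2] [Finite F] (L : (Fin 4 → F) ≃ₗ[F] (Fin 4 → F))
    (h : ∀ p ∈ ovoid F e, L • p ∈ ovoid F e) : Sz F e :=
  ⟨MulAction.toPermHom _ _ L, ⟨L, rfl⟩, (MulAction.mem_stabilizer_set' finite_ovoid).2 h⟩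

theorem exists_linear (g : Sz F e) :
    ∃ L : (Fin 4 → F) ≃ₗ[F] (Fin 4 → F), ∀ p : ℙ F (Fin 4 → F), g • p = L • p := by
  obtain ⟨L, hL⟩ := g.2.1
  exact ⟨L, fun p => by rw [Subgroup.smul_def, ← hL]; rfl⟩

theorem smul_mem_ovoid (g : Sz F e) {p : ℙ F (Fin 4 → F)} (hp : p ∈ ovoid F e) :
    g • p ∈ ovoid F e := by
  have h : (g : Equiv.Perm (ℙ F (Fin 4 → F))) • ovoid F e = ovoid F e := g.2.2
  rw [← h]
  exact Set.smul_mem_smul_set hp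

theorem Sz.ext {g h : Sz F e} (H : ∀ p : ℙ F (Fin 4 → F), g • p = h • p) : g = h :=
  Subtype.ext (Equiv.ext H)

instance : FaithfulSMul (Sz F e) (ℙ F (Fin 4 → F)) := ⟨Sz.ext⟩

instance [Finite F] : Finite (Sz F e) := by
  have : Finite (ℙ F (Fin 4 → F)) := inferInstance
  infer_instance

variable [CharP F 2]

/-- The linear map underlying `borel k a b`. -/
noncomputable def borelLinear (e : ℕ) (k a b : F) : (Fin 4 → F) →ₗ[F] (Fin 4 → F) where
  toFun v := ![v 0,
    theta F e k * k ^ 2 * v 1 + (b + theta F e a * a) * k * v 2 + a * (theta F e k * k) * v 3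
      + (a * b + theta F e a * a ^ 2 + theta F e b) * v 0,
    k * v 2 + a * v 0,
    theta F e k * k * v 3 + theta F e a * k * v 2 + b * v 0]
  map_add' v w := by
    ext i
    fin_cases i <;> simp <;> ring
  map_smul' c v := by
    ext i
    fin_cases i <;> simp <;> ring

theorem borelLinear_injective {k : F} (hk : k ≠ 0) (a b : F) :
    Function.Injective (borelLinear e k a b) := by
  rw [← LinearMap.ker_eq_bot, LinearMap.ker_eq_bot']
  intro v hv
  have hk' := theta_ne_zero (e := e) hk
  have h0 : v 0 = 0 := congrFun hv 0
  have h2 : v 2 = 0 := by simpa [borelLinear, h0, hk] using congrFun hv 2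
  have h3 : v 3 = 0 := by simpa [borelLinear, h0, h2, hk, hk'] using congrFun hv 3
  have h1 : v 1 = 0 := by simpa [borelLinear, h0, h2, h3, hk, hk'] using congrFun hv 1
  ext i
  fin_cases i <;> assumption

/-- The linear automorphism underlying `borel k a b`. -/
noncomputable def borelEquiv (e : ℕ) (k : Fˣ) (a b : F) : (Fin 4 → F) ≃ₗ[F] (Fin 4 → F) :=
  LinearEquiv.ofInjectiveEndo (borelLinear e k a b) (borelLinear_injective k.ne_zero a b)

theorem borelEquiv_apply (k : Fˣ) (a b : F) (v : Fin 4 → F) :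
    borelEquiv e k a b v = borelLinear e (k : F) a b v := rfl

theorem borelEquiv_smul_pointU (k : Fˣ) (a b : F) :
    borelEquiv e k a b • pointU F = pointU F := by
  refine (smul_mk_eq_iff _ _ _).2 ⟨theta F e k * k ^ 2, ?_⟩
  rw [borelEquiv_apply]
  ext i
  fin_cases i <;> simp [borelLinear]

theorem borelEquiv_smul_ovoidPoint [Finite F] (hF : Nat.card F = 2 ^ (2 * e + 1)) (k : Fˣ)
    (a b x y : F) : borelEquiv e k a b • ovoidPoint e x y =
      ovoidPoint e (k * x + a) (theta F e k * k * y + theta F e a * k * x + b) := by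
  refine (smul_mk_eq_iff _ _ _).2 ⟨1, ?_⟩
  rw [borelEquiv_apply, one_smul]
  ext i
  fin_cases i
  · simp [borelLinear]
  · simp only [borelLinear, map_add, map_mul, theta_theta hF]
    simp
    linear_combination (theta F e a * k ^ 2 * x ^ 2 + theta F e k * theta F e x * k * x * a
      + theta F e a * k * x * a + a ^ 2 * theta F e k * theta F e x) * two_eq_zero (F := F)
  · simp [borelLinear]
  · simp [borelLinear]

/-- The element `(x, y) ↦ (k x + a, k ^ (θ + 1) y + a ^ θ k x + b)` of the stabilizer of
`pointU`. -/
noncomputable def borel [Finite F] (hF : Nat.card F = 2 ^ (2 * e + 1)) (k : Fˣ) (a b : F) :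
    Sz F e :=
  ofLinear (borelEquiv e k a b) (by
    intro p hp
    obtain rfl | ⟨x, y, rfl⟩ := mem_ovoid.1 hp
    · rw [borelEquiv_smul_pointU]; exact pointU_mem
    · rw [borelEquiv_smul_ovoidPoint hF]; exact ovoidPoint_mem _ _)

section
variable [Finite F] (hF : Nat.card F = 2 ^ (2 * e + 1))

theorem borel_smul_pointU (k : Fˣ) (a b : F) : borel hF k a b • pointU F = pointU F :=
  borelEquiv_smul_pointU k a b

theorem borel_smul_ovoidPoint (k : Fˣ) (a b x y : F) : borel hF k a b • ovoidPoint e x y =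
      ovoidPoint e (k * x + a) (theta F e k * k * y + theta F e a * k * x + b) :=
  borelEquiv_smul_ovoidPoint hF k a b x y

theorem borel_mul (k l : Fˣ) (a b c d : F) :
    borel hF k a b * borel hF l c d =
      borel hF (k * l) (k * c + a) (theta F e k * k * d + theta F e a * k * c + b) := by
  have h : borelEquiv e k a b * borelEquiv e l c d = borelEquiv e (k * l) (k * c + a)
      (theta F e k * k * d + theta F e a * k * c + b) := by
    ext1 v
    change borelLinear e (k : F) a b (borelLinear e (l : F) c d v) = borelLinear e _ _ _ v
    ext i
    fin_cases i
    · simp [borelLinear]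
    · simp [borelLinear, map_add, map_mul, theta_theta hF]
      grind
    · simp [borelLinear]; ring
    · simp [borelLinear]; ring
  exact Subtype.ext ((map_mul (MulAction.toPermHom _ _) _ _).symm.trans
    (congrArg (MulAction.toPermHom _ _) h))

theorem borel_inj {k l : Fˣ} {a b c d : F} (h : borel hF k a b = borel hF l c d) :
    k = l ∧ a = c ∧ b = d := by
  have h0 := congrArg (fun g => g • ovoidPoint e (0 : F) 0) h
  have h1 := congrArg (fun g => g • ovoidPoint e (1 : F) 0) h
  simp only [borel_smul_ovoidPoint, ovoidPoint_inj] at h0 h1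
  simp at h0
  obtain ⟨rfl, rfl⟩ := h0
  have := h1.1
  simp at this
  exact ⟨Units.ext this, rfl, rfl⟩

theorem borel_one : borel hF 1 0 0 = 1 := by
  have h := borel_mul hF 1 1 0 0 0 0
  simpa using h

/-- The linear map `(v₀, v₁, v₂, v₃) ↦ (v₁, v₀, v₃, v₂)`. -/
noncomputable def swapEquiv (F : Type*) [Field F] : (Fin 4 → F) ≃ₗ[F] (Fin 4 → F) :=
  LinearEquiv.funCongrLeft F F (Equiv.swap (0 : Fin 4) 1 * Equiv.swap 2 3)

omit [CharP F 2] [Finite F] in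
theorem swapEquiv_apply (v : Fin 4 → F) : swapEquiv F v = ![v 1, v 0, v 3, v 2] := by
  ext i
  fin_cases i <;> simp [swapEquiv, LinearMap.funLeft] <;> rfl

omit [Finite F] in
theorem swapEquiv_smul_pointU : swapEquiv F • pointU F = ovoidPoint e (0 : F) 0 := by
  refine (smul_mk_eq_iff _ _ _).2 ⟨1, ?_⟩
  rw [swapEquiv_apply]
  ext i
  fin_cases i <;> simp

include hF in
theorem swapEquiv_smul_mem {p : ℙ F (Fin 4 → F)} (hp : p ∈ ovoid F e) :
    swapEquiv F • p ∈ ovoid F e := by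
  obtain rfl | ⟨x, y, rfl⟩ := mem_ovoid.1 hp
  · rw [swapEquiv_smul_pointU (e := e)]; exact ovoidPoint_mem _ _
  obtain ⟨z, hz⟩ : ∃ z, z = x * y + theta F e x * x ^ 2 + theta F e y := ⟨_, rfl⟩
  have hz' : theta F e z = theta F e x * theta F e y + x ^ 2 * theta F e x ^ 2 + y ^ 2 := by
    rw [hz]; simp only [map_add, map_mul, map_pow, theta_theta hF]
  -- This is the ovoid equation for the image point `(1 : 1/z : y/z : x/z)`, multiplied by `θ z * z
  -- ^ 2`. It also shows that `z = 0` only at the origin, whose image is `pointU`.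
  have key : theta F e z * (z + x * y) = theta F e y * y ^ 2 + theta F e x * z ^ 2 := by
    rw [hz', hz]; grind
  by_cases h0 : z = 0
  · have hy : y = 0 := by
      rw [h0] at key
      by_contra hy
      rw [map_zero, zero_mul, zero_pow two_ne_zero, mul_zero, add_zero] at key
      exact mul_ne_zero (theta_ne_zero hy) (pow_ne_zero 2 hy) key.symm
    have hx : x = 0 := by
      rw [h0, hy] at hz
      by_contra hx
      rw [map_zero, mul_zero, zero_add, add_zero] at hz
      exact mul_ne_zero (theta_ne_zero hx) (pow_ne_zero 2 hx) hz.symm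
    subst hx hy
    convert pointU_mem (F := F) (e := e)
    refine (smul_mk_eq_iff _ _ _).2 ⟨1, ?_⟩
    rw [swapEquiv_apply]
    ext i
    fin_cases i <;> simp
  · convert ovoidPoint_mem (e := e) (y / z) (x / z)
    refine (smul_mk_eq_iff _ _ _).2 ⟨z, ?_⟩
    rw [swapEquiv_apply, ← hz]
    have hz0 := theta_ne_zero (e := e) h0
    ext i
    fin_cases i
    · simp
    · simp only [map_div₀]
      simp
      field_simp
      linear_combination -key + (theta F e z * x * y) * two_eq_zero (F := F)
    · simp; field_simp
    · simp; field_simp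

/-- The involution of the Suzuki group interchanging `pointU` and `ovoidPoint e 0 0`. -/
noncomputable def swap : Sz F e := ofLinear (swapEquiv F) fun _ => swapEquiv_smul_mem hF

theorem swap_smul_pointU : swap hF • pointU F = ovoidPoint e (0 : F) 0 := swapEquiv_smul_pointU

include hF in
theorem exists_smul_pointU {p : ℙ F (Fin 4 → F)} (hp : p ∈ ovoid F e) :
    ∃ g : Sz F e, g • pointU F = p := by
  obtain rfl | ⟨x, y, rfl⟩ := mem_ovoid.1 hp
  · exact ⟨1, one_smul _ _⟩
  · refine ⟨borel hF 1 x y * swap hF, ?_⟩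
    rw [mul_smul, swap_smul_pointU, borel_smul_ovoidPoint]
    simp

include hF in
-- Double transitivity: the elements `borel 1 x y` fix `pointU` and move the origin to any affine
-- point.
theorem exists_smul_pointU_origin {p q : ℙ F (Fin 4 → F)} (hp : p ∈ ovoid F e)
    (hq : q ∈ ovoid F e) (hpq : p ≠ q) :
    ∃ g : Sz F e, g • pointU F = p ∧ g • ovoidPoint e (0 : F) 0 = q := by
  obtain ⟨g, rfl⟩ := exists_smul_pointU hF hp
  have h1 := smul_mem_ovoid g⁻¹ hq
  obtain h | ⟨x, y, h⟩ := mem_ovoid.1 h1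
  · exact absurd (by rw [← h, smul_inv_smul]) hpq
  · refine ⟨g * borel hF 1 x y, by rw [mul_smul, borel_smul_pointU], ?_⟩
    rw [mul_smul, borel_smul_ovoidPoint]
    simp [← h]

end

end Group
end Suzuki

/-! ### Actions in which involutions behave as in a Suzuki group -/

theorem orderOf_conj_eq {G : Type*} [Group G] (g s : G) : orderOf (g * s * g⁻¹) = orderOf s :=
  (MulAut.conj g).orderOf_eq s

/-- An element of prime order `l` moves the points of an invariant set in orbits of length `l`. -/
theorem ncard_modEq_ncard_fixed {G α : Type*} [Group G] [MulAction G α] {l : ℕ} (hl : l.Prime)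
    {g : G} (hg : g ^ l = 1) {O : Set α} (hO : O.Finite) (h : ∀ p ∈ O, g • p ∈ O) :
    O.ncard ≡ {p | p ∈ O ∧ g • p = p}.ncard [MOD l] := by
  classical
  have := hO.fintype
  have := Fact.mk hl
  let f : Function.End O := fun p => ⟨g • (p : α), h p p.2⟩
  have hfn : ∀ (n : ℕ) (p : O), (((f ^ n : Function.End O) p : O) : α) = g ^ n • (p : α) := by
    intro n
    induction n with
    | zero => intro p; rw [pow_zero, pow_zero, one_smul]; rfl
    | succ n ih =>
      intro p
      rw [pow_succ, pow_succ, mul_smul]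
      exact ih (f p)
  have hf : f ^ l ^ 1 = 1 := by
    funext p
    apply Subtype.ext
    rw [pow_one, hfn, hg, one_smul]
    rfl
  have key := Equiv.Perm.card_fixedPoints_modEq hf
  rw [← Nat.card_coe_set_eq, ← Nat.card_coe_set_eq, Nat.card_eq_fintype_card]
  refine key.trans ?_
  rw [← Nat.card_eq_fintype_card]
  refine congrArg (· % l) (Nat.card_congr ⟨fun p => ⟨p.1, p.1.2, congrArg Subtype.val p.2⟩,
    fun p => ⟨⟨p.1, p.2.1⟩, Subtype.ext p.2.2⟩, fun _ => rfl, fun _ => rfl⟩)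

/-- The properties of the action of a Suzuki group on an invariant set of points of the ovoid that
are inherited by subgroups. -/
structure IsSuzukiAction (S : Type*) {Ω : Type*} [Group S] [MulAction S Ω] (D : Set Ω) : Prop where
  smul_mem : ∀ (g : S), ∀ a ∈ D, g • a ∈ D
  eq_one_of_fix : ∀ (g : S), ∀ a ∈ D, ∀ b ∈ D, ∀ c ∈ D, a ≠ b → a ≠ c → b ≠ c →
    g • a = a → g • b = b → g • c = c → g = 1
  eq_of_fix : ∀ s : S, orderOf s = 2 → ∀ a ∈ D, ∀ b ∈ D, s • a = a → s • b = b → a = b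
  commute : ∀ s t g : S, ∀ a ∈ D, orderOf s = 2 → orderOf t = 2 → s • a = a → t • a = a →
    Commute g s → Commute g t
  pow_four : ∀ s g : S, orderOf s = 2 → Commute g s → g ^ 4 = 1
  sq_inj : ∀ s g h : S, orderOf s = 2 → Commute g s → Commute h s → g ^ 2 = h ^ 2 →
    (g * h⁻¹) ^ 2 = 1
  orderOf_ne_three : ∀ g : S, orderOf g ≠ 3

/-- This inheritance lets the counting take place inside the setwise stabilizer of a side, acting on
that side alone. -/
theorem IsSuzukiAction.subgroup {G Ω : Type*} [Group G] [MulAction G Ω] {O D : Set Ω}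
    (h : IsSuzukiAction G O) (S : Subgroup G) (hD : D ⊆ O) (hS : ∀ g ∈ S, ∀ a ∈ D, g • a ∈ D) :
    IsSuzukiAction S D where
  smul_mem g a ha := hS g g.2 a ha
  eq_one_of_fix g a ha b hb c hc hab hac hbc h1 h2 h3 :=
    Subtype.ext (h.eq_one_of_fix g a (hD ha) b (hD hb) c (hD hc) hab hac hbc h1 h2 h3)
  eq_of_fix s hs a ha b hb h1 h2 :=
    h.eq_of_fix s (by rwa [Subgroup.orderOf_coe]) a (hD ha) b (hD hb) h1 h2
  commute s t g a ha hs ht hsa hta hgs := by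
    have := h.commute s t g a (hD ha) (by rwa [Subgroup.orderOf_coe])
      (by rwa [Subgroup.orderOf_coe]) hsa hta (congrArg Subtype.val hgs)
    exact Subtype.ext this
  pow_four s g hs hgs := Subtype.ext (h.pow_four s g (by rwa [Subgroup.orderOf_coe])
    (congrArg Subtype.val hgs))
  sq_inj s g k hs hgs hks hgk := Subtype.ext (h.sq_inj s g k (by rwa [Subgroup.orderOf_coe])
    (congrArg Subtype.val hgs) (congrArg Subtype.val hks) (congrArg Subtype.val hgk))
  orderOf_ne_three g hg := h.orderOf_ne_three g (by rwa [Subgroup.orderOf_coe])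

/-! ### The stabilizer of a point, involutions and their centralizers in `Sz(q)`. -/

namespace Suzuki

section Stabilizer
variable {F : Type*} [Field F] [CharP F 2] [Finite F] {e : ℕ}
  (hF : Nat.card F = 2 ^ (2 * e + 1))

include hF in
/-- The monomials `y`, `y ^ 2`, `y ^ θ`, `y ^ (θ + 2)` are independent functions. -/
theorem coeff_eq_zero (he : 1 ≤ e) {A B C D : F}
    (h : ∀ y : F, A * y + B * y ^ 2 + C * theta F e y + D * (theta F e y * y ^ 2) = 0) :
    A = 0 ∧ B = 0 ∧ C = 0 ∧ D = 0 := by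
  have := Fintype.ofFinite F
  obtain ⟨n, hn⟩ : ∃ n, 2 ^ (e + 1) = n + 4 :=
    -- For `e ≥ 1` the exponents `1`, `2`, `2 ^ (e + 1) = n + 4` and `n + 6` are distinct and less
    -- than `q`, so a polynomial with these monomials that vanishes on `F` is zero.
    Nat.exists_eq_add_of_le' (Nat.pow_le_pow_right (n := 2) (by norm_num) (by omega : 2 ≤ e + 1))
  have hq : n + 6 < Nat.card F := by
    rw [hF]
    have h2 : 2 ^ (2 * e + 1) = 2 ^ (e + 1) * 2 ^ e := by rw [← pow_add]; congr 1; omega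
    have h3 : 2 ^ 1 ≤ 2 ^ e := Nat.pow_le_pow_right (by norm_num) he
    rw [h2, hn]
    nlinarith
  open Polynomial in
  let p : F[X] := Polynomial.C A * X + Polynomial.C B * X ^ 2 + Polynomial.C C * X ^ (n + 4)
    + Polynomial.C D * X ^ (n + 6)
  have hdeg : p.natDegree ≤ n + 6 := by
    simp only [p]
    compute_degree
  have hp : p = 0 := by
    refine Polynomial.eq_zero_of_natDegree_lt_card_of_eval_eq_zero' p Finset.univ ?_ ?_
    · intro y _
      have := h y
      rw [theta_apply, hn] at this
      simp only [p, Polynomial.eval_add, Polynomial.eval_mul, Polynomial.eval_C,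
        Polynomial.eval_X, Polynomial.eval_pow]
      linear_combination this
    · rw [Finset.card_univ, ← Nat.card_eq_fintype_card]; omega
  have hc : ∀ i, p.coeff i = 0 := fun i => by rw [hp, Polynomial.coeff_zero]
  have h1 := hc 1
  have h2 := hc 2
  have h3 := hc (n + 4)
  have h4 := hc (n + 6)
  simp [p, Polynomial.coeff_X_pow] at h1 h2 h3 h4
  exact ⟨h1, h2, h3, h4⟩

/-- The ovoid equation for the images of all affine points is a polynomial identity in `x` and `y`.
Its coefficients force the matrix to be diagonal and its entries to be those of `borel k 0 0`. -/
theorem exists_borel_of_fix_origin (he : 1 ≤ e) {g : Sz F e} (hU : g • pointU F = pointU F)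
    (h0 : g • ovoidPoint e (0 : F) 0 = ovoidPoint e (0 : F) 0) : ∃ k : Fˣ, g = borel hF k 0 0 := by
  obtain ⟨L, hL⟩ := exists_linear g
  obtain ⟨c₁, hc₁⟩ := (smul_mk_eq_iff _ _ _).1 ((hL _).symm.trans hU)
  obtain ⟨c₀, hc₀⟩ := (smul_mk_eq_iff _ _ _).1 ((hL _).symm.trans h0)
  have hz : (0 : F) * 0 + theta F e 0 * 0 ^ 2 + theta F e 0 = 0 := by simp
  rw [hz] at hc₀
  have hsum : ∀ v : Fin 4 → F, L v = v 0 • L ![1, 0, 0, 0] + v 1 • L ![0, 1, 0, 0]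
      + v 2 • L ![0, 0, 1, 0] + v 3 • L ![0, 0, 0, 1] := by
    intro v
    rw [← map_smul, ← map_smul, ← map_smul, ← map_smul, ← map_add, ← map_add, ← map_add]
    congr 1
    ext i
    fin_cases i <;> simp
  rw [← hc₀, ← hc₁] at hsum
  have hcomp : ∀ (v : Fin 4 → F) (i : Fin 4), L v i = v 0 * (c₀ * ![1, 0, 0, 0] i)
      + v 1 * (c₁ * ![0, 1, 0, 0] i) + v 2 * L ![0, 0, 1, 0] i + v 3 * L ![0, 0, 0, 1] i :=
    fun v i => congrFun (hsum v) i
  clear hsum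
  generalize L ![0, 0, 1, 0] = u at hcomp
  generalize L ![0, 0, 0, 1] = w at hcomp
  have hne : ∀ x y : F, c₀ + x * u 0 + y * w 0 ≠ 0 ∧ ∃ x' y' z' : F,
      z' = x' * y' + theta F e x' * x' ^ 2 + theta F e y' ∧
      (c₀ + x * u 0 + y * w 0) * z' = (x * y + theta F e x * x ^ 2 + theta F e y) * c₁
        + x * u 1 + y * w 1 ∧
      (c₀ + x * u 0 + y * w 0) * x' = x * u 2 + y * w 2 ∧
      (c₀ + x * u 0 + y * w 0) * y' = x * u 3 + y * w 3 := by
    intro x y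
    obtain h | ⟨x', y', h⟩ := mem_ovoid.1 (smul_mem_ovoid g (ovoidPoint_mem (e := e) x y))
    · rw [← hU] at h
      exact absurd (MulAction.injective g h) ovoidPoint_ne_pointU
    · obtain ⟨c, hc⟩ := (smul_mk_eq_iff _ _ _).1 ((hL _).symm.trans h)
      have hcne : c ≠ 0 := by
        rintro rfl
        rw [zero_smul] at hc
        have := congrFun ((map_eq_zero_iff L L.injective).1 hc.symm) 0
        simp at this
      have e0 := (congrFun hc 0).trans (hcomp _ 0)
      have e1 := (congrFun hc 1).trans (hcomp _ 1)
      have e2 := (congrFun hc 2).trans (hcomp _ 2)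
      have e3 := (congrFun hc 3).trans (hcomp _ 3)
      simp at e0 e1 e2 e3
      rw [← e0]
      exact ⟨hcne, x', y', _, rfl, e1, e2, e3⟩
  have hc₀ne : c₀ ≠ 0 := by simpa using (hne 0 0).1
  -- An affine point never goes to `pointU`, so `c₀ + x * u 0 + y * w 0` has no zero and must be
  -- constant.
  have hu0 : u 0 = 0 := by
    by_contra hu
    exact (hne (-c₀ / u 0) 0).1 (by field_simp; ring)
  have hw0 : w 0 = 0 := by
    by_contra hw
    exact (hne 0 (-c₀ / w 0)).1 (by field_simp; ring)
  have key : ∀ x y : F, (x * y + theta F e x * x ^ 2 + theta F e y) * (c₁ / c₀)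
      + x * (u 1 / c₀) + y * (w 1 / c₀) =
      (x * (u 2 / c₀) + y * (w 2 / c₀)) * (x * (u 3 / c₀) + y * (w 3 / c₀))
      + theta F e (x * (u 2 / c₀) + y * (w 2 / c₀)) * (x * (u 2 / c₀) + y * (w 2 / c₀)) ^ 2
      + theta F e (x * (u 3 / c₀) + y * (w 3 / c₀)) := by
    intro x y
    obtain ⟨-, x', y', z', hz', e1, e2, e3⟩ := hne x y
    rw [hu0, hw0, mul_zero, mul_zero, add_zero, add_zero] at e1 e2 e3
    have hx' : x' = x * (u 2 / c₀) + y * (w 2 / c₀) := by field_simp; linear_combination e2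
    have hy' : y' = x * (u 3 / c₀) + y * (w 3 / c₀) := by field_simp; linear_combination e3
    rw [← hx', ← hy', ← hz']
    field_simp
    linear_combination -e1
  obtain ⟨ε, hε⟩ : ∃ ε, ε = c₁ / c₀ := ⟨_, rfl⟩
  obtain ⟨α, hα⟩ : ∃ a, a = u 2 / c₀ := ⟨_, rfl⟩
  obtain ⟨β, hβ⟩ : ∃ a, a = w 2 / c₀ := ⟨_, rfl⟩
  obtain ⟨γ, hγ⟩ : ∃ a, a = u 3 / c₀ := ⟨_, rfl⟩
  obtain ⟨δ, hδ⟩ : ∃ a, a = w 3 / c₀ := ⟨_, rfl⟩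
  obtain ⟨ζ, hζ⟩ : ∃ a, a = u 1 / c₀ := ⟨_, rfl⟩
  obtain ⟨η, hη⟩ : ∃ a, a = w 1 / c₀ := ⟨_, rfl⟩
  rw [← hε, ← hα, ← hβ, ← hγ, ← hδ, ← hζ, ← hη] at key
  have hc₁ne : c₁ ≠ 0 := by
    rintro rfl
    rw [zero_smul] at hc₁
    have := congrFun ((map_eq_zero_iff L L.injective).1 hc₁.symm) 1
    simp at this
  have hεne : ε ≠ 0 := by rw [hε]; exact div_ne_zero hc₁ne hc₀ne
  -- The restrictions to `x = 0` and to `y = 0` give all relations except the one from the mixed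
  -- term `x y`, which the point `(1, 1)` supplies.
  obtain ⟨k1, k2, k3, k4⟩ := coeff_eq_zero hF he (A := η) (B := -(β * δ))
    (C := ε - theta F e δ) (D := -(theta F e β * β ^ 2)) (by
      intro y
      have := key 0 y
      simp only [map_mul, map_zero, zero_mul, zero_add, add_zero] at this
      linear_combination this)
  obtain ⟨l1, l2, l3, l4⟩ := coeff_eq_zero hF he (A := ζ) (B := -(α * γ))
    (C := -theta F e γ) (D := ε - theta F e α * α ^ 2) (by
      intro x
      have := key x 0
      simp only [map_mul, map_zero, zero_mul, mul_zero, zero_add, add_zero] at this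
      linear_combination this)
  have hβ0 : β = 0 := by
    by_contra h
    exact mul_ne_zero (theta_ne_zero (e := e) h) (pow_ne_zero 2 h) (neg_eq_zero.1 k4)
  have hγ0 : γ = 0 := by
    by_contra h
    exact theta_ne_zero (e := e) h (neg_eq_zero.1 l3)
  have h11 := key 1 1
  rw [k1, l1, hβ0, hγ0] at h11
  simp only [map_one, one_mul, mul_one, one_pow, zero_add, add_zero] at h11
  have hαδ : ε = α * δ := by linear_combination h11 - k3 - l4
  have hαne : α ≠ 0 := by rintro rfl; exact hεne (by rw [hαδ, zero_mul])
  have hδα : δ = theta F e α * α := by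
    apply mul_left_cancel₀ hαne
    linear_combination l4 - hαδ
  have hu1 : u 1 = 0 := by rw [hζ] at l1; simpa [hc₀ne] using l1
  have hw1 : w 1 = 0 := by rw [hη] at k1; simpa [hc₀ne] using k1
  have hw2 : w 2 = 0 := by rw [hβ] at hβ0; simpa [hc₀ne] using hβ0
  have hu3 : u 3 = 0 := by rw [hγ] at hγ0; simpa [hc₀ne] using hγ0
  have hu2 : u 2 = c₀ * α := by rw [hα]; field_simp
  have hw3 : w 3 = c₀ * (theta F e α * α) := by rw [← hδα, hδ]; field_simp
  have hc1 : c₁ = c₀ * (theta F e α * α ^ 2) := by rw [← sub_eq_zero.1 l4, hε]; field_simp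
  refine ⟨Units.mk0 α hαne, Sz.ext fun p => ?_⟩
  rw [hL]
  change L • p = borelEquiv e (Units.mk0 α hαne) 0 0 • p
  induction p using Projectivization.ind with
  | h v hv =>
    rw [Projectivization.smul_mk, Projectivization.smul_mk, Projectivization.mk_eq_mk_iff']
    refine ⟨c₀, ?_⟩
    change c₀ • borelLinear e α 0 0 v = L v
    ext i
    rw [hcomp v i]
    fin_cases i
    · simp [borelLinear, hu0, hw0]; ring
    · simp [borelLinear, hu1, hw1, hc1]; ring
    · simp [borelLinear, hw2, hu2]; ring
    · simp [borelLinear, hu3, hw3]; ring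

theorem exists_borel (he : 1 ≤ e) {g : Sz F e} (hU : g • pointU F = pointU F) :
    ∃ (k : Fˣ) (a b : F), g = borel hF k a b := by
  obtain h | ⟨x, y, h⟩ := mem_ovoid.1 (smul_mem_ovoid g (ovoidPoint_mem (e := e) (0 : F) 0))
  · rw [← hU] at h
    exact absurd (MulAction.injective g h) ovoidPoint_ne_pointU
  have h1 : ((borel hF 1 x y)⁻¹ * g) • pointU F = pointU F := by
    rw [mul_smul, hU, inv_smul_eq_iff, borel_smul_pointU]
  have h2 : ((borel hF 1 x y)⁻¹ * g) • ovoidPoint e (0 : F) 0 = ovoidPoint e (0 : F) 0 := by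
    rw [mul_smul, h, inv_smul_eq_iff, borel_smul_ovoidPoint]
    simp
  obtain ⟨k, hk⟩ := exists_borel_of_fix_origin hF he h1 h2
  rw [inv_mul_eq_iff_eq_mul, borel_mul] at hk
  exact ⟨_, _, _, hk⟩

theorem eq_pointU_of_fix {b : F} (hb : b ≠ 0) {p : ℙ F (Fin 4 → F)} (hp : p ∈ ovoid F e)
    (h : borel hF 1 0 b • p = p) : p = pointU F := by
  obtain rfl | ⟨x, y, rfl⟩ := mem_ovoid.1 hp
  · rfl
  · rw [borel_smul_ovoidPoint, ovoidPoint_inj] at h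
    simp [hb] at h

theorem exists_borel_of_sq_eq_one (he : 1 ≤ e) {s : Sz F e} (hs : s ^ 2 = 1)
    (hU : s • pointU F = pointU F) : ∃ b : F, s = borel hF 1 0 b := by
  obtain ⟨k, a, b, rfl⟩ := exists_borel hF he hU
  rw [pow_two, borel_mul, ← borel_one hF] at hs
  obtain ⟨h1, -, h3⟩ := borel_inj hF hs
  have hk : k = 1 := Units.ext (eq_one_of_sq_eq_one (by
    rw [pow_two, ← Units.val_mul, h1, Units.val_one]))
  subst hk
  have ha : a = 0 := theta_mul_self_injective hF (e := e) (by
    simp only [Units.val_one, map_one, one_mul, mul_one] at h3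
    rw [map_zero, zero_mul]
    linear_combination h3 - b * two_eq_zero (F := F))
  subst ha
  exact ⟨b, rfl⟩

theorem exists_borel_of_orderOf_eq_two (he : 1 ≤ e) {s : Sz F e} (hs : orderOf s = 2)
    (hU : s • pointU F = pointU F) : ∃ b : F, b ≠ 0 ∧ s = borel hF 1 0 b := by
  obtain ⟨b, rfl⟩ := exists_borel_of_sq_eq_one hF he (hs ▸ pow_orderOf_eq_one s) hU
  refine ⟨b, ?_, rfl⟩
  rintro rfl
  rw [borel_one, orderOf_one] at hs
  omega

/-- An element commuting with the involution preserves its only fixed point `pointU`. Comparing the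
coefficients of `b` then gives `k ^ (θ + 1) = 1`, so `k = 1`. -/
theorem exists_borel_of_commute (he : 1 ≤ e) {g : Sz F e} {b : F} (hb : b ≠ 0)
    (h : Commute g (borel hF 1 0 b)) : ∃ a c : F, g = borel hF 1 a c := by
  have hU : g • pointU F = pointU F := by
    refine eq_pointU_of_fix hF hb (smul_mem_ovoid g pointU_mem) ?_
    rw [← mul_smul, ← h.eq, mul_smul, borel_smul_pointU]
  obtain ⟨k, a, c, rfl⟩ := exists_borel hF he hU
  have h1 := h.eq
  rw [borel_mul, borel_mul] at h1
  obtain ⟨-, -, h3⟩ := borel_inj hF h1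
  have hk : theta F e k * k = 1 := by
    simp at h3
    apply mul_right_cancel₀ hb
    linear_combination h3
  have hk1 : k = 1 := Units.ext (eq_one_of_theta_mul_self hF hk)
  subst hk1
  exact ⟨a, c, rfl⟩

theorem borel_sq (a c : F) : borel hF 1 a c ^ 2 = borel hF 1 0 (theta F e a * a) := by
  rw [pow_two, borel_mul]
  congr 1
  · simp
  · simp [CharTwo.add_self_eq_zero]
  · simp
    linear_combination c * two_eq_zero (F := F)

theorem borel_zero_sq (b : F) : borel hF 1 0 b ^ 2 = 1 := by
  rw [borel_sq, map_zero, zero_mul, borel_one]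

theorem borel_pow_four (a c : F) : borel hF 1 a c ^ 4 = 1 :=
  (pow_mul _ 2 2).trans (by rw [borel_sq, borel_zero_sq])

include hF in
-- The ovoid has `q ^ 2 + 1` points, an odd number.
theorem exists_fixed_of_orderOf_eq_two {s : Sz F e} (hs : orderOf s = 2) :
    ∃ p ∈ ovoid F e, s • p = p := by
  have h := ncard_modEq_ncard_fixed Nat.prime_two (hs ▸ pow_orderOf_eq_one s)
    (finite_ovoid (F := F) (e := e)) fun p => smul_mem_ovoid s
  by_contra hcon
  push Not at hcon
  rw [show {p | p ∈ ovoid F e ∧ s • p = p} = ∅ from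
    Set.eq_empty_of_forall_notMem fun p hp => hcon p hp.1 hp.2, Set.ncard_empty, ncard_ovoid, hF,
    Nat.modEq_zero_iff_dvd,
    show 2 ^ (2 * e + 1) = 2 * 2 ^ (2 * e) from pow_succ' 2 _, mul_pow] at h
  omega

/-- Every involution is conjugate to an element of the form `borel 1 0 b`. -/
theorem exists_conj_eq_borel (he : 1 ≤ e) {s : Sz F e} (hs : orderOf s = 2) :
    ∃ (y : Sz F e) (b : F), b ≠ 0 ∧ MulAut.conj y s = borel hF 1 0 b := by
  obtain ⟨p, hp, hsp⟩ := exists_fixed_of_orderOf_eq_two hF hs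
  obtain ⟨y, rfl⟩ := exists_smul_pointU hF hp
  exact ⟨y⁻¹, exists_borel_of_orderOf_eq_two hF he (by rw [MulEquiv.orderOf_eq, hs])
    (by rw [MulAut.conj_apply, inv_inv, mul_smul, mul_smul, hsp, inv_smul_smul])⟩

include hF in
-- By transitivity all is checked at `pointU`. The involutions there are the `borel 1 0 b`. Their
-- centralizers consist of elements `borel 1 a c`, which commute with all `borel 1 0 b` and whose
-- square `borel 1 0 (a ^ (θ + 1))` determines `a`. An element of order 3 has a fixed point since `q
-- ^ 2 + 1 ≡ 2` modulo 3; its parameter satisfies `k ^ 3 = 1`, so `k = 1` and its fourth power is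
-- trivial.
theorem isSuzukiAction (he : 1 ≤ e) : IsSuzukiAction (Sz F e) (ovoid F e) where
  smul_mem g a ha := smul_mem_ovoid g ha
  eq_one_of_fix := by
    intro g a ha b hb c hc hab hac hbc h1 h2 h3
    obtain ⟨y, rfl, rfl⟩ := exists_smul_pointU_origin hF ha hb hab
    have hc' := smul_mem_ovoid y⁻¹ hc
    obtain ⟨k, hk⟩ := exists_borel_of_fix_origin hF he (g := y⁻¹ * g * y)
      (by rw [mul_smul, mul_smul, h1, inv_smul_smul]) (by rw [mul_smul, mul_smul, h2, inv_smul_smul])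
    have hk3 : borel hF k 0 0 • (y⁻¹ • c) = y⁻¹ • c := by
      rw [← hk, mul_smul, mul_smul, smul_inv_smul, h3]
    have hk1 : k = 1 := by
      obtain h | ⟨x, z, h⟩ := mem_ovoid.1 hc'
      · exact absurd (by rw [← h, smul_inv_smul]) hac
      rw [h, borel_smul_ovoidPoint, ovoidPoint_inj] at hk3
      obtain ⟨h4, h5⟩ := hk3
      simp only [map_zero, zero_mul, add_zero] at h4 h5
      by_cases hx : x = 0
      · by_cases hz : z = 0
        · rw [hx, hz] at h
          exact absurd (by rw [← h, smul_inv_smul]) hbc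
        · exact Units.ext (eq_one_of_theta_mul_self hF (mul_right_cancel₀ hz (by rw [h5, one_mul])))
      · exact Units.ext (mul_right_cancel₀ hx (by rw [h4, Units.val_one, one_mul]))
    rw [hk1, borel_one, mul_assoc, inv_mul_eq_one] at hk
    exact mul_eq_right.1 hk.symm
  eq_of_fix := by
    intro s hs a ha b hb h1 h2
    obtain ⟨y, rfl⟩ := exists_smul_pointU hF ha
    obtain ⟨c, hc, hsc⟩ := exists_borel_of_orderOf_eq_two hF he (s := y⁻¹ * s * y⁻¹⁻¹)
      (by rwa [orderOf_conj_eq]) (by rw [inv_inv, mul_smul, mul_smul, h1, inv_smul_smul])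
    have := eq_pointU_of_fix hF hc (smul_mem_ovoid y⁻¹ hb) (by
      rw [← hsc, inv_inv, mul_smul, mul_smul, smul_inv_smul, h2])
    rw [← this, smul_inv_smul]
  commute := by
    intro s t g a ha hs ht hsa hta hgs
    obtain ⟨y, rfl⟩ := exists_smul_pointU hF ha
    obtain ⟨b, hb, hsb⟩ := exists_borel_of_orderOf_eq_two hF he (s := y⁻¹ * s * y⁻¹⁻¹)
      (by rwa [orderOf_conj_eq]) (by rw [inv_inv, mul_smul, mul_smul, hsa, inv_smul_smul])
    obtain ⟨c, hc, htc⟩ := exists_borel_of_orderOf_eq_two hF he (s := y⁻¹ * t * y⁻¹⁻¹)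
      (by rwa [orderOf_conj_eq]) (by rw [inv_inv, mul_smul, mul_smul, hta, inv_smul_smul])
    obtain ⟨i, j, hij⟩ := exists_borel_of_commute hF he (g := y⁻¹ * g * y⁻¹⁻¹) hb
      (by rw [← hsb]; exact hgs.map (MulAut.conj y⁻¹).toMonoidHom)
    have : Commute (y⁻¹ * g * y⁻¹⁻¹) (y⁻¹ * t * y⁻¹⁻¹) := by
      rw [hij, htc, Commute, SemiconjBy, borel_mul, borel_mul]
      congr 1
      · simp
      · simp; ring
    exact Commute.of_map (f := MulAut.conj y⁻¹) (MulAut.conj y⁻¹).injective this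
  pow_four := by
    intro s g hs hgs
    obtain ⟨y, b, hb, hy⟩ := exists_conj_eq_borel hF he hs
    obtain ⟨a, c, hg⟩ := exists_borel_of_commute hF he (g := MulAut.conj y g) hb
      (by rw [← hy]; exact hgs.map (MulAut.conj y).toMonoidHom)
    apply (MulAut.conj y).injective
    rw [map_pow, map_one, hg, borel_pow_four]
  sq_inj := by
    intro s g h hs hgs hhs hgh
    obtain ⟨y, b, hb, hy⟩ := exists_conj_eq_borel hF he hs
    obtain ⟨a, c, hg⟩ := exists_borel_of_commute hF he (g := MulAut.conj y g) hb
      (by rw [← hy]; exact hgs.map (MulAut.conj y).toMonoidHom)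
    obtain ⟨a', c', hh⟩ := exists_borel_of_commute hF he (g := MulAut.conj y h) hb
      (by rw [← hy]; exact hhs.map (MulAut.conj y).toMonoidHom)
    have h1 := congrArg (MulAut.conj y) hgh
    rw [map_pow, map_pow, hg, hh, borel_sq, borel_sq] at h1
    have ha := theta_mul_self_injective hF (borel_inj hF h1).2.2
    subst ha
    apply (MulAut.conj y).injective
    have h2 : borel hF 1 a c * (borel hF 1 a c')⁻¹ = borel hF 1 0 (c - c') := by
      rw [mul_inv_eq_iff_eq_mul, borel_mul]
      congr 1 <;> simp
    rw [map_pow, map_one, map_mul, map_inv, hg, hh, h2, borel_zero_sq]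
  orderOf_ne_three := by
    intro g hg
    have h3 : g ^ 3 = 1 := hg ▸ pow_orderOf_eq_one g
    have h := ncard_modEq_ncard_fixed Nat.prime_three h3
      (finite_ovoid (F := F) (e := e)) fun p => smul_mem_ovoid g
    obtain ⟨p, hp, hgp⟩ : ∃ p ∈ ovoid F e, g • p = p := by
      by_contra hcon
      push Not at hcon
      obtain ⟨n, hn⟩ := exists_two_pow_eq e
      rw [show {p | p ∈ ovoid F e ∧ g • p = p} = ∅ from
        Set.eq_empty_of_forall_notMem fun p hp => hcon p hp.1 hp.2, Set.ncard_empty, ncard_ovoid,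
        hF, hn, Nat.modEq_zero_iff_dvd, show (3 * n + 2) ^ 2 + 1 = 3 * (3 * n ^ 2 + 4 * n + 1) + 2 by
        ring] at h
      omega
    obtain ⟨y, rfl⟩ := exists_smul_pointU hF hp
    obtain ⟨k, a, b, hk⟩ := exists_borel hF he (g := MulAut.conj y⁻¹ g)
      (by rw [MulAut.conj_apply, inv_inv, mul_smul, mul_smul, hgp, inv_smul_smul])
    have hk3 := congrArg (MulAut.conj y⁻¹) h3
    rw [map_pow, map_one, hk] at hk3
    have h4 := hk3
    rw [pow_three, borel_mul, borel_mul, ← borel_one hF] at h4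
    have hk1 : k = 1 := Units.ext (eq_one_of_pow_three_eq_one hF (by
      rw [pow_three, ← Units.val_mul, ← Units.val_mul, (borel_inj hF h4).1, Units.val_one]))
    subst hk1
    have h5 := borel_pow_four hF a b
    rw [pow_succ, hk3, one_mul, ← hk, MulEquiv.map_eq_one_iff] at h5
    rw [h5, orderOf_one] at hg
    omega

end Stabilizer
end Suzuki

/-! ### Involutions in a group with a transitive dihedral subgroup -/

theorem ncard_le_mul_ncard {α β : Type*} (f : α → β) {A : Set α} {B : Set β} (hA : A.Finite)
    (hB : B.Finite) (n : ℕ) (hf : ∀ a ∈ A, f a ∈ B)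
    (hn : ∀ a ∈ A, {x | x ∈ A ∧ f x = f a}.ncard ≤ n) : A.ncard ≤ n * B.ncard := by
  classical
  rw [Set.ncard_eq_toFinset_card A hA, Set.ncard_eq_toFinset_card B hB]
  refine Finset.card_le_mul_card_image_of_maps_to (f := f) (by simpa using hf) n fun b _ => ?_
  by_cases hb : ∃ a ∈ A, f a = b
  · obtain ⟨a, ha, rfl⟩ := hb
    refine le_trans (le_of_eq ?_) (hn a ha)
    rw [← Set.ncard_coe_finset]
    congr 1
    ext x
    simp
  · rw [Finset.card_eq_zero.2]
    · exact Nat.zero_le _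
    · refine Finset.filter_eq_empty_iff.2 fun x hx hxb => hb ⟨x, by simpa using hx, hxb⟩

theorem ncard_le_card_mul_ncard {S β : Type*} [Group S] [Finite S] (W : Subgroup S) (f : S → β)
    {A : Set S} {B : Set β} (hB : B.Finite) (hf : ∀ a ∈ A, f a ∈ B)
    (hW : ∀ a ∈ A, ∀ x ∈ A, f x = f a → a⁻¹ * x ∈ W) : A.ncard ≤ Nat.card W * B.ncard := by
  refine ncard_le_mul_ncard f A.toFinite hB _ hf fun a ha => ?_
  rw [show Nat.card W = (W : Set S).ncard from Nat.card_coe_set_eq _]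
  exact Set.ncard_le_ncard_of_injOn (fun x => a⁻¹ * x) (fun x hx => hW a ha x hx.1 hx.2)
    (fun x _ y _ hxy => mul_left_cancel hxy)

/-- `D` is an orbit of odd length of the dihedral group generated by `u` and the involution `r`,
which fixes the point `p` of `D`. -/
structure IsDihedralOrbit {S Ω : Type*} [Group S] [MulAction S Ω] (D : Set Ω) (u r : S) (p : Ω) :
    Prop extends IsSuzukiAction S D where
  orderOf_eq_two : orderOf r = 2
  conj_eq_inv : r * u * r⁻¹ = u⁻¹
  odd : Odd (orderOf u)
  trans : ∀ a ∈ D, ∀ b ∈ D, ∃ z ∈ Subgroup.zpowers u, z • a = b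
  mem : p ∈ D
  smul_eq : r • p = p
  two_lt : 2 < D.ncard

namespace IsDihedralOrbit

variable {S Ω : Type*} [Group S] [MulAction S Ω] {D : Set Ω} {u r : S} {p : Ω}

theorem finite (c : IsDihedralOrbit D u r p) : D.Finite :=
  Set.finite_of_ncard_pos (by have := c.two_lt; omega)

theorem commute_zpowers {x y : S} (hx : x ∈ Subgroup.zpowers u) (hy : y ∈ Subgroup.zpowers u) :
    Commute x y := by
  obtain ⟨i, rfl⟩ := hx
  obtain ⟨j, rfl⟩ := hy
  exact Commute.zpow_zpow_self u i j

theorem eq_one_of_forall (c : IsDihedralOrbit D u r p) {g : S} (hg : ∀ a ∈ D, g • a = a) :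
    g = 1 := by
  obtain ⟨a, ha, b, hb, d, hd, h1, h2, h3⟩ := (Set.two_lt_ncard c.finite).1 c.two_lt
  exact c.eq_one_of_fix g a ha b hb d hd h1 h2 h3 (hg a ha) (hg b hb) (hg d hd)

theorem eq_one_of_commute (c : IsDihedralOrbit D u r p) {y : S} {a : Ω} (ha : a ∈ D)
    (hy : y • a = a) (hyu : ∀ z ∈ Subgroup.zpowers u, Commute y z) : y = 1 := by
  refine c.eq_one_of_forall fun b hb => ?_
  obtain ⟨z, hz, rfl⟩ := c.trans a ha b hb
  rw [← mul_smul, (hyu z hz).eq, mul_smul, hy]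

theorem eq_one_of_mem (c : IsDihedralOrbit D u r p) {z : S} (hz : z ∈ Subgroup.zpowers u) {a : Ω}
    (ha : a ∈ D) (hza : z • a = a) : z = 1 :=
  c.eq_one_of_commute ha hza fun _ hy => commute_zpowers hz hy

theorem odd_orderOf (c : IsDihedralOrbit D u r p) {z : S} (hz : z ∈ Subgroup.zpowers u) :
    Odd (orderOf z) :=
  c.odd.of_dvd_nat (orderOf_dvd_of_mem_zpowers hz)

theorem eq_one_of_sq (c : IsDihedralOrbit D u r p) {z : S} (hz : z ∈ Subgroup.zpowers u)
    (h : z ^ 2 = 1) : z = 1 := by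
  have h1 := orderOf_dvd_of_pow_eq_one h
  obtain h2 | h2 := (Nat.dvd_prime Nat.prime_two).1 h1
  · exact orderOf_eq_one_iff.1 h2
  · have := c.odd_orderOf hz
    rw [h2] at this
    exact absurd this (by decide)

theorem card_zpowers (c : IsDihedralOrbit D u r p) :
    Nat.card (Subgroup.zpowers u) = D.ncard := by
  have h : D = (fun z : S => z • p) '' (Subgroup.zpowers u : Set S) := by
    ext b
    constructor
    · intro hb
      obtain ⟨z, hz, h⟩ := c.trans p c.mem b hb
      exact ⟨z, hz, h⟩
    · rintro ⟨z, -, rfl⟩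
      exact c.smul_mem z p c.mem
  rw [h, Set.InjOn.ncard_image, ← Nat.card_coe_set_eq]
  · rfl
  · intro x hx y hy hxy
    have : y⁻¹ * x = 1 := c.eq_one_of_mem (mul_mem (inv_mem hy) hx) c.mem (by
      rw [mul_smul, inv_smul_eq_iff]; exact hxy)
    exact (inv_mul_eq_one.1 this).symm

/-- Nontrivial rotations have the rotation group as centralizer. -/
theorem mem_of_commute (c : IsDihedralOrbit D u r p) {x y : S} (hx : x ∈ Subgroup.zpowers u)
    (hx1 : x ≠ 1) (hxy : Commute y x) : y ∈ Subgroup.zpowers u := by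
  -- Let `z` be the rotation that agrees with `y` at `p`. Then `z⁻¹ y` commutes with `x` and fixes
  -- `p`, `x p`, `x² p`, which are distinct because `x` has odd order.
  obtain ⟨z, hz, h⟩ := c.trans p c.mem (y • p) (c.smul_mem y p c.mem)
  have hzy : Commute (z⁻¹ * y) x := (commute_zpowers (inv_mem hz) hx).mul_left hxy
  have hfix : ∀ a : Ω, (z⁻¹ * y) • a = a → (z⁻¹ * y) • x • a = x • a := fun a ha => by
    rw [← mul_smul, hzy.eq, mul_smul, ha]
  have h1 : (z⁻¹ * y) • p = p := by rw [mul_smul, ← h, inv_smul_smul]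
  have hxp := c.smul_mem x p c.mem
  have h2 : p ≠ x • p := fun h => hx1 (c.eq_one_of_mem hx c.mem h.symm)
  have h3 : p ≠ x • x • p := fun h => hx1 (c.eq_one_of_sq hx
    (c.eq_one_of_mem (pow_mem hx 2) c.mem (by rw [pow_two, mul_smul, ← h])))
  have h4 : x • p ≠ x • x • p := fun h => h2 (MulAction.injective x h)
  have := c.eq_one_of_fix (z⁻¹ * y) p c.mem _ hxp _ (c.smul_mem x _ hxp) h2 h3 h4 h1
    (hfix _ h1) (hfix _ (hfix _ h1))
  rw [← inv_mul_eq_one.1 this]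
  exact hz

/-- The rotation group is the centralizer of each of its nontrivial elements, so conjugating one of
them back into it conjugates the whole group to itself. -/
theorem mem_normalizer_of_conj_mem (c : IsDihedralOrbit D u r p) {x h : S}
    (hx : x ∈ Subgroup.zpowers u) (hx1 : x ≠ 1) (hh : h⁻¹ * x * h ∈ Subgroup.zpowers u) :
    h ∈ Subgroup.normalizer (Subgroup.zpowers u : Set S) := by
  have hh1 : h⁻¹ * x * h ≠ 1 := fun h1 => hx1 (by
    have := congrArg (fun t => h * t * h⁻¹) h1
    simpa [mul_assoc] using this)
  rw [Subgroup.mem_normalizer_iff]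
  intro z
  constructor
  · intro hz
    refine c.mem_of_commute hx hx1 ?_
    have := (commute_zpowers hz hh).map (MulAut.conj h).toMonoidHom
    simpa [mul_assoc] using this
  · intro hz
    refine c.mem_of_commute hh hh1 ?_
    have := (commute_zpowers hz hx).map (MulAut.conj h⁻¹).toMonoidHom
    simpa [mul_assoc] using this

theorem conj_zpowers (c : IsDihedralOrbit D u r p) {z : S} (hz : z ∈ Subgroup.zpowers u) :
    r * z * r⁻¹ = z⁻¹ := by
  obtain ⟨i, rfl⟩ := hz
  have := map_zpow (MulAut.conj r) u i
  simp only [MulAut.conj_apply] at this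
  simp only [this, c.conj_eq_inv, inv_zpow]

theorem mul_self (c : IsDihedralOrbit D u r p) : r * r = 1 := by
  rw [← pow_two, ← c.orderOf_eq_two, pow_orderOf_eq_one]

/-- The involution `r` is the only one that fixes `p` and normalizes the rotation group. -/
theorem eq_of_mem_normalizer (c : IsDihedralOrbit D u r p) {w : S} (hw : w ^ 2 = 1) (hw1 : w ≠ 1)
    (hp : w • p = p) (hn : w ∈ Subgroup.normalizer (Subgroup.zpowers u : Set S)) : w = r := by
  have hw2 : orderOf w = 2 := orderOf_eq_prime hw hw1
  have hww : w * w = 1 := by rwa [← pow_two]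
  have hwi : w⁻¹ = w := inv_eq_of_mul_eq_one_left hww
  have hinv : ∀ z ∈ Subgroup.zpowers u, w * z * w⁻¹ = z⁻¹ := by
    intro z hz
    have hz' := (Subgroup.mem_normalizer_iff.1 hn z).1 hz
    -- The rotation `z * (w z w⁻¹)` commutes with `w`, so it moves `p` to a fixed point of `w`, that
    -- is to `p`, and is trivial. Thus `w` inverts all rotations, as `r` does, and `w r` centralizes
    -- them and fixes `p`.
    have hc : w * (z * (w * z * w⁻¹)) * w⁻¹ = z * (w * z * w⁻¹) := by
      rw [(commute_zpowers hz hz').eq, hwi]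
      have : w * (w * z * w * z) * w = (w * w) * z * w * z * w := by group
      rw [this, hww]
      have h2 : w * z * w * z = z * (w * z * w) := by
        have := (commute_zpowers hz hz').eq
        rw [hwi] at this
        rw [this]
      rw [h2]
      group
    have hfix : w • (z * (w * z * w⁻¹)) • p = (z * (w * z * w⁻¹)) • p := by
      conv_rhs => rw [← hc]
      rw [mul_smul (w * (z * (w * z * w⁻¹))) w⁻¹ p, inv_smul_eq_iff.2 hp.symm,
        mul_smul w (z * (w * z * w⁻¹)) p]
    have h1 := c.eq_of_fix w hw2 _ (c.smul_mem _ p c.mem) p c.mem hfix hp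
    have h2 := c.eq_one_of_mem (mul_mem hz hz') c.mem h1
    exact eq_inv_of_mul_eq_one_right h2
  have h1 : w * r = 1 := by
    refine c.eq_one_of_commute c.mem (by rw [mul_smul, c.smul_eq, hp]) fun z hz => ?_
    have h2 : w * r * z * (w * r)⁻¹ = z := by
      have : w * r * z * (w * r)⁻¹ = w * (r * z * r⁻¹) * w⁻¹ := by group
      rw [this, c.conj_zpowers hz, hinv _ (inv_mem hz), inv_inv]
    exact mul_inv_eq_iff_eq_mul.1 h2
  rw [eq_inv_of_mul_eq_one_left h1]
  exact inv_eq_of_mul_eq_one_left c.mul_self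

theorem mem_normalizer (c : IsDihedralOrbit D u r p) :
    r ∈ Subgroup.normalizer (Subgroup.zpowers u : Set S) := by
  rw [Subgroup.mem_normalizer_iff]
  intro z
  constructor
  · intro hz
    rw [c.conj_zpowers hz]
    exact inv_mem hz
  · intro hz
    have := c.conj_zpowers hz
    have h2 : r * (r * z * r⁻¹) * r⁻¹ = (r * r) * z * (r * r)⁻¹ := by group
    rw [h2, c.mul_self, one_mul, inv_one, mul_one] at this
    rw [this]
    exact inv_mem hz

theorem commute_of_fix (c : IsDihedralOrbit D u r p) {v g : S} (hv : v ^ 2 = 1) (hp : v • p = p)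
    (hg : Commute g r) : Commute g v := by
  by_cases hv1 : v = 1
  · rw [hv1]; exact Commute.one_right g
  · exact c.commute r v g p c.mem c.orderOf_eq_two (orderOf_eq_prime hv hv1) c.smul_eq hp hg

/-- The elements of order at most two that fix `p`. -/
def involutions (c : IsDihedralOrbit D u r p) : Subgroup S where
  carrier := {v | v ^ 2 = 1 ∧ v • p = p}
  one_mem' := ⟨one_pow 2, one_smul S p⟩
  mul_mem' := by
    rintro v w ⟨hv, hvp⟩ ⟨hw, hwp⟩
    have h : Commute v w :=
      c.commute_of_fix hw hwp (c.commute_of_fix hv hvp (Commute.refl r)).symm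
    exact ⟨by rw [h.mul_pow, hv, hw, one_mul], by rw [mul_smul, hwp, hvp]⟩
  inv_mem' := by
    rintro v ⟨hv, hvp⟩
    exact ⟨by rw [inv_pow, hv, inv_one], inv_smul_eq_iff.2 hvp.symm⟩

theorem smul_eq_of_commute (c : IsDihedralOrbit D u r p) {g : S} (hg : Commute g r) :
    g • p = p := by
  refine c.eq_of_fix r c.orderOf_eq_two _ (c.smul_mem g p c.mem) p c.mem ?_ c.smul_eq
  rw [← mul_smul, ← hg.eq, mul_smul, c.smul_eq]

theorem mem_centralizer {g : S} : g ∈ Subgroup.centralizer {r} ↔ Commute g r :=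
  Subgroup.mem_centralizer_singleton_iff

theorem involutions_le (c : IsDihedralOrbit D u r p) :
    c.involutions ≤ Subgroup.centralizer {r} := fun _ hv =>
  mem_centralizer.2 (c.commute_of_fix hv.1 hv.2 (Commute.refl r)).symm

theorem sq_eq_one (c : IsDihedralOrbit D u r p) : r ^ 2 = 1 := by rw [pow_two, c.mul_self]

theorem ne_one (c : IsDihedralOrbit D u r p) : r ≠ 1 := by
  intro h
  have := c.orderOf_eq_two
  rw [h, orderOf_one] at this
  omega

/-- In this intersection `r` is the only involution and every square is `1` or `r`. If `w² = f² =
r`, then `sq_inj` leaves only `1` and `r` for `w f⁻¹`. -/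
theorem card_centralizer_inf_normalizer (c : IsDihedralOrbit D u r p) :
    Nat.card (Subgroup.centralizer {r} ⊓ Subgroup.normalizer (Subgroup.zpowers u : Set S) :
      Subgroup S) ≤ 2 ∨
    Nat.card (Subgroup.centralizer {r} ⊓ Subgroup.normalizer (Subgroup.zpowers u : Set S) :
      Subgroup S) ≤ 4 ∧ ∃ f, Commute f r ∧ f ^ 2 = r := by
  classical
  set W := Subgroup.centralizer {r} ⊓ Subgroup.normalizer (Subgroup.zpowers u : Set S)
  have hsq : ∀ w ∈ W, w ^ 2 = 1 → w = 1 ∨ w = r := fun w hw h => or_iff_not_imp_left.2 fun h1 =>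
    c.eq_of_mem_normalizer h h1 (c.smul_eq_of_commute (mem_centralizer.1 hw.1)) hw.2
  have hcard : ∀ s : Finset S, (∀ w ∈ W, w ∈ s) → Nat.card W ≤ s.card := by
    intro s hs
    rw [show Nat.card W = (W : Set S).ncard from Nat.card_coe_set_eq _, ← Set.ncard_coe_finset]
    exact Set.ncard_le_ncard hs s.finite_toSet
  by_cases hf : ∀ w ∈ W, w ^ 2 = 1
  · left
    refine (hcard {1, r} fun w hw => ?_).trans Finset.card_le_two
    simpa using hsq w hw (hf w hw)
  · right
    push Not at hf
    obtain ⟨f, hfW, hf1⟩ := hf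
    have hsq2 : ∀ w ∈ W, w ^ 2 = 1 ∨ w ^ 2 = r := fun w hw => hsq _ (pow_mem hw 2) (by
      rw [← pow_mul]; exact c.pow_four r w c.orderOf_eq_two (mem_centralizer.1 hw.1))
    have hfr : f ^ 2 = r := (hsq2 f hfW).resolve_left hf1
    refine ⟨(hcard {1, r, f, r * f} fun w hw => ?_).trans Finset.card_le_four, f,
      mem_centralizer.1 hfW.1, hfr⟩
    obtain h | h := hsq2 w hw
    · obtain h | h := hsq w hw h <;> simp [h]
    · have := c.sq_inj r w f c.orderOf_eq_two (mem_centralizer.1 hw.1) (mem_centralizer.1 hfW.1)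
        (by rw [h, hfr])
      obtain h | h := hsq _ (mul_mem hw (inv_mem hfW)) this
      · simp [mul_inv_eq_one.1 h]
      · simp [mul_inv_eq_iff_eq_mul.1 h]

/-- The conjugates of `r` that fix `p`. -/
def conjugates (r : S) (p : Ω) : Set S := (fun y => y * r * y⁻¹) '' {y | y • p = p}

theorem conjugates_subset (c : IsDihedralOrbit D u r p) :
    conjugates r p ⊆ (c.involutions : Set S) \ {1} := by
  rintro _ ⟨y, hy, rfl⟩
  have hy : y • p = p := hy
  refine ⟨⟨?_, ?_⟩, ?_⟩
  · rw [conj_pow, c.sq_eq_one, mul_one, mul_inv_cancel]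
  · rw [mul_smul, mul_smul, inv_smul_eq_iff.2 hy.symm, c.smul_eq, hy]
  · intro h
    exact c.ne_one (conj_eq_one_iff.1 h)

variable [Finite S]

theorem ncard_conjugates_lt (c : IsDihedralOrbit D u r p) :
    (conjugates r p).ncard < Nat.card c.involutions := by
  refine (Set.ncard_le_ncard c.conjugates_subset (Set.toFinite _)).trans_lt ?_
  rw [show Nat.card c.involutions = (c.involutions : Set S).ncard from Nat.card_coe_set_eq _]
  exact Set.ncard_sdiff_singleton_lt_of_mem c.involutions.one_mem

theorem card_stabilizer_le :
    Nat.card (MulAction.stabilizer S p) ≤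
      Nat.card (Subgroup.centralizer {r}) * (conjugates r p).ncard := by
  rw [show Nat.card (MulAction.stabilizer S p) = (MulAction.stabilizer S p : Set S).ncard from
    Nat.card_coe_set_eq _]
  refine ncard_le_card_mul_ncard _ (fun y => y * r * y⁻¹) (Set.toFinite _) (fun y hy => ⟨y, hy, rfl⟩)
    fun a _ x _ h => mem_centralizer.2 ?_
  have h : x * r * x⁻¹ = a * r * a⁻¹ := h
  have h1 : x * r = a * r * a⁻¹ * x := mul_inv_eq_iff_eq_mul.1 h
  change a⁻¹ * x * r = r * (a⁻¹ * x)
  rw [mul_assoc, h1]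
  group

/-- Fix `q = y p ≠ p` in `D`. For `g` in the centralizer let `z g` be the rotation with `z g • p =
g⁻¹ • q`. Then `y⁻¹ * g * z g` fixes `p` and conjugates `r` to a member of `conjugates r p`. If `a`
and `x` give the same conjugate, `a⁻¹ x` conjugates one nontrivial rotation to another and so
normalizes the rotation group. -/
theorem card_centralizer_le (c : IsDihedralOrbit D u r p) :
    Nat.card (Subgroup.centralizer {r}) ≤
      Nat.card (Subgroup.centralizer {r} ⊓ Subgroup.normalizer (Subgroup.zpowers u : Set S) :
        Subgroup S) * (conjugates r p).ncard := by
  obtain ⟨q, hq, hqp⟩ := Set.exists_ne_of_one_lt_ncard (s := D) (by have := c.two_lt; omega) p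
  obtain ⟨y, hy, hyq⟩ := c.trans p c.mem q hq
  have hz : ∀ g : S, ∃ z ∈ Subgroup.zpowers u, z • p = g⁻¹ • q := fun g =>
    c.trans p c.mem _ (c.smul_mem _ q hq)
  choose z hzu hzp using hz
  rw [show Nat.card (Subgroup.centralizer {r}) = (Subgroup.centralizer {r} : Set S).ncard from
    Nat.card_coe_set_eq _]
  refine ncard_le_card_mul_ncard _ (fun g => (y⁻¹ * g * z g) * r * (y⁻¹ * g * z g)⁻¹)
    (Set.toFinite _) (fun g _ => ⟨_, ?_, rfl⟩) fun a ha x hx h => ?_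
  · change (y⁻¹ * g * z g) • p = p
    rw [mul_smul, hzp, mul_smul, smul_inv_smul, ← hyq, inv_smul_smul]
  · have ha : Commute a r := mem_centralizer.1 ha
    have hx : Commute x r := mem_centralizer.1 hx
    have hax : Commute (a⁻¹ * x) r := ha.inv_left.mul_left hx
    refine ⟨mem_centralizer.2 hax, ?_⟩
    have h1 : (x * z x) * r * (x * z x)⁻¹ = (a * z a) * r * (a * z a)⁻¹ := by
      have := congrArg (fun t => y * t * y⁻¹) h
      simpa [mul_assoc] using this
    -- The product of `r` with the involution obtained at `q` is a conjugate by `g` of a rotation,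
    -- since `r` inverts `z g`.
    have key : ∀ g : S, Commute g r → r * ((g * z g) * r * (g * z g)⁻¹) = g * (z g)⁻¹ ^ 2 * g⁻¹ := by
      intro g hg
      have h2 := c.conj_zpowers (hzu g)
      have hr : r⁻¹ = r := inv_eq_of_mul_eq_one_left c.mul_self
      have h3 : r * z g * r = (z g)⁻¹ := by rw [← h2, hr]
      calc r * ((g * z g) * r * (g * z g)⁻¹) = (r * g) * z g * r * (z g)⁻¹ * g⁻¹ := by group
        _ = g * (r * z g * r) * (z g)⁻¹ * g⁻¹ := by rw [← hg.eq]; group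
        _ = g * (z g)⁻¹ ^ 2 * g⁻¹ := by rw [h3]; group
    have h4 := (key x hx).symm.trans ((congrArg (r * ·) h1).trans (key a ha))
    have hne : (z a)⁻¹ ^ 2 ≠ 1 := by
      intro h5
      have h6 := c.eq_one_of_sq (inv_mem (hzu a)) h5
      have h7 := hzp a
      rw [inv_eq_one.1 h6, one_smul, eq_inv_smul_iff, c.smul_eq_of_commute ha] at h7
      exact hqp h7.symm
    refine c.mem_normalizer_of_conj_mem (pow_mem (inv_mem (hzu a)) 2) hne ?_
    have h8 : (a⁻¹ * x)⁻¹ * (z a)⁻¹ ^ 2 * (a⁻¹ * x) = x⁻¹ * (a * (z a)⁻¹ ^ 2 * a⁻¹) * x := by group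
    have h9 : x⁻¹ * (x * (z x)⁻¹ ^ 2 * x⁻¹) * x = (z x)⁻¹ ^ 2 := by group
    rw [h8, ← h4, h9]
    exact pow_mem (inv_mem (hzu x)) 2

/-- An element of the normalizer that fixes `p` conjugates `r` to an involution with the same
properties, hence commutes with `r`. -/
theorem card_normalizer_le (c : IsDihedralOrbit D u r p) :
    Nat.card (Subgroup.normalizer (Subgroup.zpowers u : Set S)) ≤
      Nat.card (Subgroup.centralizer {r} ⊓ Subgroup.normalizer (Subgroup.zpowers u : Set S) :
        Subgroup S) * D.ncard := by
  rw [show Nat.card (Subgroup.normalizer (Subgroup.zpowers u : Set S)) =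
    (Subgroup.normalizer (Subgroup.zpowers u : Set S) : Set S).ncard from Nat.card_coe_set_eq _]
  refine ncard_le_card_mul_ncard _ (fun y => y • p) c.finite (fun y _ => c.smul_mem y p c.mem)
    fun a ha x hx h => ?_
  have hn := mul_mem (inv_mem ha) hx
  have hp : (a⁻¹ * x) • p = p := by rw [mul_smul, inv_smul_eq_iff]; exact h
  refine ⟨mem_centralizer.2 ?_, hn⟩
  have := c.eq_of_mem_normalizer (w := (a⁻¹ * x) * r * (a⁻¹ * x)⁻¹)
    (by rw [conj_pow, c.sq_eq_one, mul_one, mul_inv_cancel])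
    (fun h => c.ne_one (conj_eq_one_iff.1 h))
    (by rw [mul_smul, mul_smul, inv_smul_eq_iff.2 hp.symm, c.smul_eq, hp])
    (mul_mem (mul_mem hn c.mem_normalizer) (inv_mem hn))
  exact mul_inv_eq_iff_eq_mul.1 this

end IsDihedralOrbit

/-! ### The count of involutions at a point. -/

namespace IsDihedralOrbit

variable {S Ω : Type*} [Group S] [MulAction S Ω] {D : Set Ω} {u r : S} {p : Ω} [Finite S]

/-- The index of `V` in `P` is a power of two less than 4 and not 1, so it is 2. -/
theorem mul_inv_mem_of_card {P V : Subgroup S} (hP : IsPGroup 2 P) (hVP : V ≤ P)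
    (hlt : Nat.card P < 4 * Nat.card V) {f g : S} (hf : f ∈ P) (hfV : f ∉ V) (hg : g ∈ P)
    (hgV : g ∉ V) : g * f ∈ V := by
  have h2 := Fact.mk Nat.prime_two
  obtain ⟨b, hb⟩ := IsPGroup.iff_card.1 hP
  have hidx : Nat.card (V.subgroupOf P) * (V.subgroupOf P).index = Nat.card P :=
    Subgroup.card_mul_index _
  rw [Nat.card_congr (Subgroup.subgroupOfEquivOfLe hVP).toEquiv] at hidx
  obtain ⟨i, -, hi⟩ := (Nat.dvd_prime_pow Nat.prime_two).1
    (hb ▸ (Subgroup.index_dvd_card (V.subgroupOf P)))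
  have hV : 0 < Nat.card V := Nat.card_pos
  have hi4 : (V.subgroupOf P).index < 4 := by
    rw [← hidx, mul_comm] at hlt
    exact Nat.lt_of_mul_lt_mul_right hlt
  have hi0 : i ≠ 0 := by
    rintro rfl
    rw [pow_zero, Subgroup.index_eq_one, Subgroup.subgroupOf_eq_top] at hi
    exact hfV (hi hf)
  have hi1 : i = 1 := by
    by_contra hne
    have : 2 ^ 2 ≤ 2 ^ i := Nat.pow_le_pow_right (by norm_num) (by omega)
    omega
  rw [hi1, pow_one] at hi
  have := (Subgroup.mul_mem_iff_of_index_two hi (a := ⟨g, hg⟩) (b := ⟨f, hf⟩)).2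
    (iff_of_false hgV hfV)
  exact this

omit [Finite S] in
theorem isPGroup_centralizer (c : IsDihedralOrbit D u r p) :
    IsPGroup 2 (Subgroup.centralizer {r}) := fun g => ⟨2, Subtype.ext
  (c.pow_four r g c.orderOf_eq_two (mem_centralizer.1 g.2))⟩

/-- The involutions have index 2 in the centralizer of `r`. So each `g` in it outside `involutions`
commutes with `f` and has square `r`. A conjugate of `r` fixing `p` is the square of such an
element, so it is `r`. The centralizer then has order at most 4, and `involutions` order at most 2.
-/
theorem card_involutions_le_of_sq (c : IsDihedralOrbit D u r p) {f : S} (hf : Commute f r)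
    (hfr : f ^ 2 = r) (hP : Nat.card (Subgroup.centralizer {r}) ≤ 4 * (conjugates r p).ncard) :
    Nat.card c.involutions ≤ 2 := by
  have hV := c.ncard_conjugates_lt
  have hfV : f ∉ c.involutions := fun h => c.ne_one (by rw [← hfr, h.1])
  have hsq : ∀ g ∈ Subgroup.centralizer {r}, g ∉ c.involutions → g ^ 2 = r := by
    intro g hg hgV
    have h1 : g * f ∈ c.involutions := mul_inv_mem_of_card c.isPGroup_centralizer c.involutions_le
      (by omega) (mem_centralizer.2 hf) hfV hg hgV
    have h2 : Commute f (g * f) := c.commute_of_fix h1.1 h1.2 hf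
    have h3 : Commute f g := by
      have := h2.mul_right (Commute.refl f).inv_right
      rwa [mul_inv_cancel_right] at this
    have h4 := h1.1
    rw [h3.symm.mul_pow, hfr] at h4
    rw [eq_inv_of_mul_eq_one_left h4]
    exact inv_eq_of_mul_eq_one_left c.mul_self
  have hJ : conjugates r p ⊆ {r} := by
    rintro _ ⟨y, hy, rfl⟩
    have hy : y • p = p := hy
    have h1 : Commute (y * f * y⁻¹) (y * r * y⁻¹) := hf.map (MulAut.conj y).toMonoidHom
    have h2 : y * r * y⁻¹ ∈ c.involutions := (c.conjugates_subset ⟨y, hy, rfl⟩).1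
    have h3 : orderOf (y * r * y⁻¹) = 2 := by rw [orderOf_conj_eq, c.orderOf_eq_two]
    have h4 : Commute (y * f * y⁻¹) r :=
      c.commute _ r _ p c.mem h3 c.orderOf_eq_two h2.2 c.smul_eq h1
    have h5 := hsq _ (mem_centralizer.2 h4) (fun h => c.ne_one (by
      have := h.1
      rwa [conj_pow, hfr, conj_eq_one_iff] at this))
    rw [conj_pow, hfr] at h5
    exact h5
  have hJ1 := Set.ncard_le_ncard hJ
  rw [Set.ncard_singleton] at hJ1
  have hidx : Nat.card (c.involutions.subgroupOf (Subgroup.centralizer {r})) *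
    (c.involutions.subgroupOf (Subgroup.centralizer {r})).index = _ := Subgroup.card_mul_index _
  rw [Nat.card_congr (Subgroup.subgroupOfEquivOfLe c.involutions_le).toEquiv] at hidx
  have h1 : (c.involutions.subgroupOf (Subgroup.centralizer {r})).index ≠ 1 := by
    rw [Ne, Subgroup.index_eq_one, Subgroup.subgroupOf_eq_top]
    exact fun h => hfV (h (mem_centralizer.2 hf))
  have h0 : (c.involutions.subgroupOf (Subgroup.centralizer {r})).index ≠ 0 :=
    Subgroup.index_ne_zero_of_finite
  have : 2 ≤ (c.involutions.subgroupOf (Subgroup.centralizer {r})).index := by omega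
  nlinarith

/-- The conjugates of the nontrivial rotations. -/
def rotations (u : S) : Set S :=
  (fun y : S × S => y.1 * y.2 * y.1⁻¹) '' (Set.univ ×ˢ ((Subgroup.zpowers u : Set S) \ {1}))

/-- In `(y, x) ↦ y x y⁻¹`, two pairs with the same image have first entries in one coset of the
normalizer, and the first entry determines the second. -/
theorem card_mul_le (c : IsDihedralOrbit D u r p) :
    Nat.card S * (D.ncard - 1) ≤
      Nat.card (Subgroup.normalizer (Subgroup.zpowers u : Set S)) * (rotations u).ncard := by
  have h1 : ((Set.univ : Set S) ×ˢ ((Subgroup.zpowers u : Set S) \ {1})).ncard =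
      Nat.card S * (D.ncard - 1) := by
    rw [Set.ncard_prod, Set.ncard_univ,
      Set.ncard_sdiff_singleton_of_mem (Subgroup.zpowers u).one_mem, ← c.card_zpowers]
    rfl
  rw [← h1, show Nat.card (Subgroup.normalizer (Subgroup.zpowers u : Set S)) =
    (Subgroup.normalizer (Subgroup.zpowers u : Set S) : Set S).ncard from Nat.card_coe_set_eq _]
  refine ncard_le_mul_ncard (fun y : S × S => y.1 * y.2 * y.1⁻¹) (Set.toFinite _) (Set.toFinite _) _
    (fun y hy => ⟨y, hy, rfl⟩) ?_
  rintro ⟨y, x⟩ ⟨-, hx, hx1⟩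
  refine Set.ncard_le_ncard_of_injOn (fun z => y⁻¹ * z.1) ?_ ?_
  · rintro ⟨z, w⟩ ⟨⟨-, hw, hw1⟩, h⟩
    refine c.mem_normalizer_of_conj_mem (x := x) hx hx1 ?_
    have h : z * w * z⁻¹ = y * x * y⁻¹ := h
    have h2 : (y⁻¹ * z)⁻¹ * x * (y⁻¹ * z) = z⁻¹ * (y * x * y⁻¹) * z := by group
    have h3 : z⁻¹ * (z * w * z⁻¹) * z = w := by group
    change (y⁻¹ * z)⁻¹ * x * (y⁻¹ * z) ∈ _
    rw [h2, ← h, h3]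
    exact hw
  · rintro ⟨z, w⟩ ⟨-, h⟩ ⟨z', w'⟩ ⟨-, h'⟩ hz
    have hz : z = z' := mul_left_cancel hz
    subst hz
    have : z * w * z⁻¹ = z * w' * z⁻¹ := h.trans h'.symm
    rw [mul_left_inj, mul_right_inj] at this
    rw [this]

omit [Finite S] in
theorem orbit_eq (c : IsDihedralOrbit D u r p) {a : Ω} (ha : a ∈ D) : MulAction.orbit S a = D := by
  ext b
  constructor
  · rintro ⟨g, rfl⟩
    exact c.smul_mem g a ha
  · intro hb
    obtain ⟨z, -, h⟩ := c.trans a ha b hb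
    exact ⟨z, h⟩

theorem ncard_mul_card_stabilizer (c : IsDihedralOrbit D u r p) {a : Ω} (ha : a ∈ D) :
    D.ncard * Nat.card (MulAction.stabilizer S a) = Nat.card S := by
  classical
  have := Fintype.ofFinite S
  have hO : (MulAction.orbit S a).Finite := by rw [c.orbit_eq ha]; exact c.finite
  have := hO.fintype
  have := Fintype.ofFinite (MulAction.stabilizer S a)
  have h := MulAction.card_orbit_mul_card_stabilizer_eq_card_group S a
  rw [← Nat.card_eq_fintype_card, ← Nat.card_eq_fintype_card, ← Nat.card_eq_fintype_card,
    c.orbit_eq ha, Nat.card_coe_set_eq] at h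
  exact h

/-- All points of `D` carry as many involutions as `p`, and none is counted twice since an
involution fixes only one point. -/
theorem ncard_involutions_ge (c : IsDihedralOrbit D u r p) :
    D.ncard * (Nat.card c.involutions - 1) ≤ {s : S | orderOf s = 2}.ncard := by
  have h1 : (D ×ˢ ((c.involutions : Set S) \ {1})).ncard =
      D.ncard * (Nat.card c.involutions - 1) := by
    rw [Set.ncard_prod, Set.ncard_sdiff_singleton_of_mem c.involutions.one_mem]
    rfl
  rw [← h1]
  choose! z hz hzp using c.trans p c.mem
  refine Set.ncard_le_ncard_of_injOn (fun y => z y.1 * y.2 * (z y.1)⁻¹) ?_ ?_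
  · rintro ⟨a, v⟩ ⟨-, hv, hv1⟩
    change orderOf _ = 2
    rw [orderOf_conj_eq]
    exact orderOf_eq_prime hv.1 hv1
  · rintro ⟨a, v⟩ ⟨ha, hv, hv1⟩ ⟨b, w⟩ ⟨hb, hw, hw1⟩ h
    have h : z a * v * (z a)⁻¹ = z b * w * (z b)⁻¹ := h
    have ha : a ∈ D := ha
    have hb : b ∈ D := hb
    have hfix : ∀ a ∈ D, ∀ v ∈ c.involutions, (z a * v * (z a)⁻¹) • a = a := by
      intro a ha v hv
      rw [mul_smul, mul_smul, inv_smul_eq_iff.2 (hzp a ha).symm, hv.2, hzp a ha]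
    have hab : a = b := c.eq_of_fix (z a * v * (z a)⁻¹)
      (by rw [orderOf_conj_eq]; exact orderOf_eq_prime hv.1 hv1) a ha b hb (hfix a ha v hv)
      (by rw [h]; exact hfix b hb w hw)
    subst hab
    rw [mul_left_inj, mul_right_inj] at h
    rw [h]

omit [Finite S] in
theorem smul_ne_of_mem_rotations (c : IsDihedralOrbit D u r p) {g : S} (hg : g ∈ rotations u)
    {a : Ω} (ha : a ∈ D) : g • a ≠ a := by
  obtain ⟨⟨y, x⟩, ⟨-, hx, hx1⟩, rfl⟩ := hg
  intro h
  refine hx1 (c.eq_one_of_mem hx (c.smul_mem y⁻¹ a ha) ?_)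
  rw [eq_inv_smul_iff, ← mul_smul, ← mul_smul]
  exact h

omit [Finite S] in
theorem orderOf_ne_two_of_mem_rotations (c : IsDihedralOrbit D u r p) {g : S}
    (hg : g ∈ rotations u) : orderOf g ≠ 2 := by
  obtain ⟨⟨y, x⟩, ⟨-, hx, hx1⟩, rfl⟩ := hg
  intro h
  have h : orderOf (y * x * y⁻¹) = 2 := h
  have := c.odd_orderOf hx
  rw [orderOf_conj_eq] at h
  rw [h] at this
  exact absurd this (by decide)

omit [Finite S] in
open Classical in
-- Conjugates of rotations fix no point, involutions at most one, other nontrivial elements at most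
-- two. The weights put this into one inequality that can be summed over the group.
theorem ncard_fixed_le (c : IsDihedralOrbit D u r p) (g : S) :
    {a | a ∈ D ∧ g • a = a}.ncard + 2 * (if g ∈ rotations u then 1 else 0) +
      (if orderOf g = 2 then 1 else 0) ≤ 2 + (D.ncard - 2) * (if g = 1 then 1 else 0) := by
  have h2 := c.two_lt
  by_cases hX : g ∈ rotations u
  · have h0 : {a | a ∈ D ∧ g • a = a} = ∅ :=
      Set.eq_empty_of_forall_notMem fun a ha => c.smul_ne_of_mem_rotations hX ha.1 ha.2
    rw [h0, Set.ncard_empty, if_pos hX, if_neg (c.orderOf_ne_two_of_mem_rotations hX)]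
    omega
  · rw [if_neg hX]
    by_cases hg : orderOf g = 2
    · have h1 : {a | a ∈ D ∧ g • a = a}.ncard ≤ 1 := by
        rw [Set.ncard_le_one (c.finite.subset fun a ha => ha.1)]
        exact fun a ha b hb => c.eq_of_fix g hg a ha.1 b hb.1 ha.2 hb.2
      rw [if_pos hg]
      omega
    · rw [if_neg hg]
      by_cases h1 : g = 1
      · have : {a | a ∈ D ∧ g • a = a} = D := by
          ext a; simp [h1]
        rw [this, if_pos h1]
        omega
      · rw [if_neg h1]
        have : {a | a ∈ D ∧ g • a = a}.ncard ≤ 2 := by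
          by_contra hcon
          obtain ⟨a, ha, b, hb, d, hd, h3, h4, h5⟩ := (Set.two_lt_ncard
            (c.finite.subset fun a ha => ha.1)).1 (not_le.1 hcon)
          exact h1 (c.eq_one_of_fix g a ha.1 b hb.1 d hd.1 h3 h4 h5 ha.2 hb.2 hd.2)
        omega

/-- By transitivity the numbers of fixed points add up to `|S|` (Burnside). -/
theorem two_mul_ncard_rotations_add_le (c : IsDihedralOrbit D u r p) :
    2 * (rotations u).ncard + {s : S | orderOf s = 2}.ncard + 2 ≤ Nat.card S + D.ncard := by
  classical
  have := Fintype.ofFinite S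
  have hD := c.finite
  have h2 := c.two_lt
  have hsum := Finset.sum_le_sum fun g (_ : g ∈ (Finset.univ : Finset S)) => c.ncard_fixed_le g
  rw [Finset.sum_add_distrib, Finset.sum_add_distrib, Finset.sum_add_distrib, ← Finset.mul_sum,
    ← Finset.mul_sum, Finset.sum_const, Finset.card_univ, ← Nat.card_eq_fintype_card,
    Finset.sum_ite_eq' , if_pos (Finset.mem_univ _), Finset.sum_boole, Finset.sum_boole] at hsum
  have hX : (Finset.univ.filter fun g => g ∈ rotations u).card = (rotations u).ncard := by
    rw [← Set.ncard_coe_finset]; congr 1; ext; simp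
  have hI : (Finset.univ.filter fun g : S => orderOf g = 2).card = {s : S | orderOf s = 2}.ncard := by
    rw [← Set.ncard_coe_finset]; congr 1; ext; simp
  have hfix : ∑ g : S, {a | a ∈ D ∧ g • a = a}.ncard = Nat.card S := by
    have h3 : ∀ g : S, {a | a ∈ D ∧ g • a = a}.ncard =
        (Finset.bipartiteAbove (fun (g : S) a => g • a = a) hD.toFinset g).card := by
      intro g
      rw [← Set.ncard_coe_finset]; congr 1; ext; simp [Finset.bipartiteAbove]
    have h4 : ∀ a : Ω, (Finset.bipartiteBelow (fun (g : S) a => g • a = a) Finset.univ a).card =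
        Nat.card (MulAction.stabilizer S a) := by
      intro a
      rw [show Nat.card (MulAction.stabilizer S a) = (MulAction.stabilizer S a : Set S).ncard from
        Nat.card_coe_set_eq _, ← Set.ncard_coe_finset]
      congr 1; ext; simp [Finset.bipartiteBelow]
    have h5 : ∀ a ∈ hD.toFinset, Nat.card (MulAction.stabilizer S a) =
        Nat.card (MulAction.stabilizer S p) := by
      intro a ha
      have h6 := c.ncard_mul_card_stabilizer (hD.mem_toFinset.1 ha)
      rw [← c.ncard_mul_card_stabilizer c.mem] at h6
      exact Nat.eq_of_mul_eq_mul_left (by omega) h6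
    rw [Finset.sum_congr rfl fun g _ => h3 g,
      Finset.sum_card_bipartiteAbove_eq_sum_card_bipartiteBelow,
      Finset.sum_congr rfl fun a _ => h4 a, Finset.sum_congr rfl h5, Finset.sum_const,
      smul_eq_mul, ← Set.ncard_eq_toFinset_card D hD, c.ncard_mul_card_stabilizer c.mem]
  rw [hX, hI, hfix] at hsum
  simp only [smul_eq_mul, Nat.cast_id, mul_one] at hsum
  omega

omit [Finite S] in
-- The group `involutions` acts freely on `D \ {p}`, since its nontrivial elements fix only `p`.
theorem card_involutions_lt (c : IsDihedralOrbit D u r p) : Nat.card c.involutions < D.ncard := by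
  obtain ⟨q, hq, hqp⟩ := Set.exists_ne_of_one_lt_ncard (s := D) (by have := c.two_lt; omega) p
  have h1 : (c.involutions : Set S).ncard ≤ (D \ {p}).ncard := by
    refine Set.ncard_le_ncard_of_injOn (fun v => v • q) ?_ ?_ (c.finite.subset Set.sdiff_subset)
    · intro v hv
      refine ⟨c.smul_mem v q hq, fun h => hqp ?_⟩
      have h : v • q = p := h
      rw [← inv_smul_eq_iff.2 h.symm, inv_smul_eq_iff.2 hv.2.symm]
    · intro v hv w hw h
      have hvw : w⁻¹ * v ∈ c.involutions := mul_mem (inv_mem hw) hv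
      have hfix : (w⁻¹ * v) • q = q := by rw [mul_smul, inv_smul_eq_iff]; exact h
      by_contra hne
      exact hqp (c.eq_of_fix (w⁻¹ * v) (orderOf_eq_prime hvw.1
        (fun h => hne (inv_mul_eq_one.1 h).symm)) q hq p c.mem hfix hvw.2)
  rw [Set.ncard_sdiff_singleton_of_mem c.mem] at h1
  have h2 := c.two_lt
  have : Nat.card c.involutions = (c.involutions : Set S).ncard := Nat.card_coe_set_eq _
  omega

/-- Let `|V| = n + 1` with `n ≥ 2`, `|D| = m + 1`, and let `σ` be the order of the stabilizer of
`p`. The centralizer of `r` equals `V`, so `σ ≤ n (n + 1)`. The normalizer bound gives `σ m ≤ 2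
|rotations|`, and the fixed point count becomes `(m + 1) n + 2 ≤ σ + m + 1`. With `n < m` this
forces `m = n + 1` and `σ = n (n + 1)`. Then `|S|` is a product of three consecutive integers,
against the absence of elements of order 3. -/
theorem card_involutions_le_of_card_le (c : IsDihedralOrbit D u r p)
    (hW : Nat.card (Subgroup.centralizer {r} ⊓ Subgroup.normalizer (Subgroup.zpowers u : Set S) :
      Subgroup S) ≤ 2) : Nat.card c.involutions ≤ 2 := by
  by_contra hcon
  have h1 := c.card_centralizer_le
  have h2 := card_stabilizer_le (r := r) (p := p)
  have h3 := c.ncard_conjugates_lt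
  have h4 := c.card_normalizer_le
  have h5 := c.card_mul_le
  have h6 := c.ncard_mul_card_stabilizer c.mem
  have h7 := c.ncard_involutions_ge
  have h8 := c.two_mul_ncard_rotations_add_le
  have h9 := c.card_involutions_lt
  have h10 := c.two_lt
  have h11 : Nat.card (Subgroup.centralizer {r}) = Nat.card c.involutions := by
    obtain ⟨k, hk⟩ := Subgroup.card_dvd_of_le c.involutions_le
    have hk2 : k < 2 := by nlinarith
    have hk0 : k ≠ 0 := by
      rintro rfl
      have : 0 < Nat.card (Subgroup.centralizer {r}) := Nat.card_pos
      omega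
    obtain rfl : k = 1 := by omega
    rw [hk, mul_one]
  obtain ⟨n, hn⟩ : ∃ n, Nat.card c.involutions = n + 1 := ⟨Nat.card c.involutions - 1, by omega⟩
  obtain ⟨m, hm⟩ : ∃ m, D.ncard = m + 1 := ⟨D.ncard - 1, by omega⟩
  rw [h11] at h2
  rw [← h6] at h5 h8
  generalize Nat.card (MulAction.stabilizer S p) = σ at *
  rw [hn] at h2 h3 h7 h9 hcon
  rw [hm] at h4 h5 h6 h7 h8 h9
  simp only [Nat.add_sub_cancel] at h5 h7
  have hσ : σ ≤ (n + 1) * n := h2.trans (Nat.mul_le_mul_left _ (by omega))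
  have hX : σ * m ≤ 2 * (rotations u).ncard := by
    have : (m + 1) * σ * m ≤ 2 * (m + 1) * (rotations u).ncard :=
      h5.trans (Nat.mul_le_mul_right _ (h4.trans (Nat.mul_le_mul_right _ hW)))
    have h12 : (m + 1) * (σ * m) ≤ (m + 1) * (2 * (rotations u).ncard) := by linarith
    exact Nat.le_of_mul_le_mul_left h12 (by omega)
  have h13 : (m + 1) * n + 2 ≤ σ + (m + 1) := by nlinarith
  have hmn : m = n + 1 := by nlinarith
  subst hmn
  have hσ' : σ = (n + 1) * n := by nlinarith
  have h3 : 3 ∣ Nat.card S := by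
    rw [← h6, hσ']
    have : n % 3 = 0 ∨ n % 3 = 1 ∨ n % 3 = 2 := by omega
    obtain h | h | h := this
    · exact Dvd.dvd.mul_left (Dvd.dvd.mul_left (Nat.dvd_of_mod_eq_zero h) _) _
    · exact Dvd.dvd.mul_right (Nat.dvd_of_mod_eq_zero (by omega)) _
    · exact Dvd.dvd.mul_left (Dvd.dvd.mul_right (Nat.dvd_of_mod_eq_zero (by omega)) _) _
  have := Fact.mk Nat.prime_three
  obtain ⟨x, hx⟩ := exists_prime_orderOf_dvd_card' 3 h3
  exact c.orderOf_ne_three x hx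

/-- Each point of `D` is fixed by only one involution. -/
theorem eq_of_orderOf_eq_two (c : IsDihedralOrbit D u r p) {s : S} (hs : orderOf s = 2)
    (hp : s • p = p) : s = r := by
  have hV : Nat.card c.involutions ≤ 2 := by
    obtain hW | ⟨hW, f, hf, hfr⟩ := c.card_centralizer_inf_normalizer
    · exact c.card_involutions_le_of_card_le hW
    · exact c.card_involutions_le_of_sq hf hfr
        (c.card_centralizer_le.trans (Nat.mul_le_mul_right _ hW))
  by_contra hne
  have h1 : s ^ 2 = 1 := hs ▸ pow_orderOf_eq_one s
  have hs1 : s ≠ 1 := by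
    rintro rfl
    rw [orderOf_one] at hs
    omega
  have h2 : 2 < (c.involutions : Set S).ncard := (Set.two_lt_ncard (Set.toFinite _)).2
    ⟨1, one_mem _, r, ⟨c.sq_eq_one, c.smul_eq⟩, s, ⟨h1, hp⟩, c.ne_one.symm, hs1.symm, Ne.symm hne⟩
  exact absurd hV (not_le.2 (h2.trans_eq (Nat.card_coe_set_eq _).symm))

end IsDihedralOrbit

/-! ### Centralizers of elements inverted by an involution -/

/-- As `q² = -1` modulo the odd prime `l`, the order of `q` modulo `l` is 4. -/
theorem eq_zero_or_eq_four_of_pow_eq_one {l q d : ℕ} (hl : l.Prime) (hl2 : l ≠ 2)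
    (hq : l ∣ q ^ 2 + 1) (hd : d ≤ 4) (h : (q ^ d : ZMod l) = 1) : d = 0 ∨ d = 4 := by
  have := Fact.mk hl
  have h2 : (2 : ZMod l) ≠ 0 := by
    intro h2
    have : ((2 : ℕ) : ZMod l) = 0 := by exact_mod_cast h2
    rw [ZMod.natCast_eq_zero_iff] at this
    exact hl2 ((Nat.prime_dvd_prime_iff_eq hl Nat.prime_two).1 this)
  have ha : (q : ZMod l) ^ 2 + 1 = 0 := by
    have := (ZMod.natCast_eq_zero_iff (q ^ 2 + 1) l).2 hq
    push_cast at this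
    exact this
  generalize (q : ZMod l) = a at *
  interval_cases d
  · exact Or.inl rfl
  · exfalso
    apply h2
    linear_combination ha - (a + 1) * h
  · exfalso
    apply h2
    linear_combination ha - h
  · exfalso
    apply h2
    have h3 : a = -1 := by linear_combination a * ha - h
    rw [h3] at ha
    linear_combination ha
  · exact Or.inr rfl

section Linear
variable {F V : Type*} [Field F] [Finite F] [AddCommGroup V] [Module F V] [FiniteDimensional F V]

/-- An element of prime order `l` in dimension four, where `l` divides `q ^ 2 + 1`, acts
irreducibly. -/
theorem eq_bot_or_eq_top_of_invariant {l : ℕ} (hl : l.Prime) (hl2 : l ≠ 2)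
    (hq : l ∣ Nat.card F ^ 2 + 1) (hV : Module.finrank F V = 4) {M : V ≃ₗ[F] V} (hM : M ^ l = 1)
    (hM1 : M ≠ 1) {W : Submodule F V} (hW : ∀ v ∈ W, M v ∈ W) : W = ⊥ ∨ W = ⊤ := by
  have : Finite V := Module.finite_of_finite F
  have hcard : ∀ U : Submodule F V, (U : Set V).ncard = Nat.card F ^ Module.finrank F U := by
    intro U
    rw [← Nat.card_coe_set_eq]
    exact Module.natCard_eq_pow_finrank
  have hfour : ((Nat.card F : ZMod l) ^ 4) = 1 := by
    have := (ZMod.natCast_eq_zero_iff (Nat.card F ^ 2 + 1) l).2 hq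
    push_cast at this
    linear_combination ((Nat.card F : ZMod l) ^ 2 - 1) * this
  -- Counting an invariant subspace modulo `l` compares its dimension with that of its fixed
  -- vectors. For `V` this shows that `M` has no nonzero fixed vector, and then every invariant
  -- subspace has dimension 0 or 4.
  have hE : ∀ U : Submodule F V, (∀ v ∈ U, M v ∈ U) →
      ((Nat.card F : ZMod l) ^ Module.finrank F U) =
        (Nat.card F : ZMod l) ^ Module.finrank F
          (U ⊓ LinearMap.ker ((M : V →ₗ[F] V) - LinearMap.id) : Submodule F V) := by
    intro U hU
    have h := ncard_modEq_ncard_fixed hl hM (Set.toFinite (U : Set V)) hU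
    have hset : {p | p ∈ (U : Set V) ∧ M • p = p} =
        ((U ⊓ LinearMap.ker ((M : V →ₗ[F] V) - LinearMap.id) : Submodule F V) : Set V) := by
      ext v
      simp [sub_eq_zero]
    rw [hset, hcard, hcard, ← ZMod.natCast_eq_natCast_iff] at h
    exact_mod_cast h
  have htop := hE ⊤ (fun _ _ => Submodule.mem_top)
  rw [finrank_top, hV, hfour, top_inf_eq] at htop
  have hker : LinearMap.ker ((M : V →ₗ[F] V) - LinearMap.id) = ⊥ := by
    obtain h | h := eq_zero_or_eq_four_of_pow_eq_one hl hl2 hq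
      (hV ▸ Submodule.finrank_le _) htop.symm
    · exact Submodule.finrank_eq_zero.1 h
    · exfalso
      apply hM1
      have h1 := Submodule.eq_top_of_finrank_eq (h.trans hV.symm)
      ext v
      have h2 : v ∈ LinearMap.ker ((M : V →ₗ[F] V) - LinearMap.id) := h1 ▸ Submodule.mem_top
      simpa [sub_eq_zero] using h2
  have h := hE W hW
  rw [hker, inf_bot_eq, finrank_bot, pow_zero] at h
  obtain h | h := eq_zero_or_eq_four_of_pow_eq_one hl hl2 hq (hV ▸ Submodule.finrank_le W) h
  · exact Or.inl (Submodule.finrank_eq_zero.1 h)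
  · exact Or.inr (Submodule.eq_top_of_finrank_eq (h.trans hV.symm))

/-- The centralizer of an element acting irreducibly is cyclic. -/
theorem isCyclic_centralizer_of_irreducible [Nontrivial V] {M : V ≃ₗ[F] V}
    (h : ∀ W : Submodule F V, (∀ v ∈ W, M v ∈ W) → W = ⊥ ∨ W = ⊤) :
    IsCyclic (Subgroup.centralizer {M}) := by
  have : Finite V := Module.finite_of_finite F
  have : Finite (Module.End F V) := Finite.of_injective _ DFunLike.coe_injective
  let A := Subalgebra.centralizer F {(M : Module.End F V)}
  -- Schur's lemma: the kernel of `N` is invariant. So `A` is a finite domain, a field by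
  -- Wedderburn, and finite groups of units in a field are cyclic.
  have hker : ∀ N ∈ A, N ≠ 0 → Function.Injective N := by
    intro N hN hN0
    rw [← LinearMap.ker_eq_bot]
    refine (h (LinearMap.ker N) ?_).resolve_right fun h1 => hN0 (LinearMap.ker_eq_top.1 h1)
    intro v hv
    have h2 := LinearMap.congr_fun ((Subalgebra.mem_centralizer_iff F).1 hN _ rfl) v
    rw [LinearMap.mem_ker] at hv ⊢
    change M (N v) = N (M v) at h2
    rw [← h2, hv, map_zero]
  have : NoZeroDivisors A := ⟨by
    rintro ⟨N, hN⟩ ⟨N', hN'⟩ h0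
    rw [or_iff_not_imp_left]
    intro h1
    have h1 : N ≠ 0 := fun h2 => h1 (Subtype.ext h2)
    have h0 : N * N' = 0 := congrArg Subtype.val h0
    refine Subtype.ext (LinearMap.ext fun v => hker N hN h1 ?_)
    have := LinearMap.congr_fun h0 v
    change N (N' v) = 0 at this
    change N (N' v) = N 0
    rw [this, map_zero]⟩
  have : IsDomain A := NoZeroDivisors.to_isDomain A
  have hA : IsField A := Finite.isDomain_to_isField A
  let : Field A := hA.toField
  have : Finite (V ≃ₗ[F] V) := Finite.of_injective _ DFunLike.coe_injective
  let f : Subgroup.centralizer {M} →* A :=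
    { toFun := fun N => ⟨(N : V ≃ₗ[F] V), (Subalgebra.mem_centralizer_iff F).2 (by
        rintro _ rfl
        ext v
        exact (LinearEquiv.congr_fun (Subgroup.mem_centralizer_singleton_iff.1 N.2) v).symm)⟩
      map_one' := rfl
      map_mul' := fun _ _ => rfl }
  refine isCyclic_of_injective_ringHom f fun N N' hN => ?_
  have : ((N : V ≃ₗ[F] V) : V →ₗ[F] V) = (N' : V ≃ₗ[F] V) := congrArg Subtype.val hN
  exact Subtype.ext (LinearEquiv.toLinearMap_injective this)

omit [Finite F] [FiniteDimensional F V] in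
theorem exists_eq_toModuleAut {T : V ≃ₗ[F] V} (hT : ∀ p : ℙ F V, T • p = p) [Nontrivial V] :
    ∃ c : Fˣ, T = DistribMulAction.toModuleAut F V c := by
  obtain ⟨a, ha⟩ := LinearMap.exists_eq_smul_id_of_forall_notLinearIndependent
    (f := (T : V →ₗ[F] V)) (by
      intro v hv
      have hv0 : v ≠ 0 := hv.ne_zero 0
      have h1 := hT (Projectivization.mk F v hv0)
      rw [Projectivization.smul_mk, Projectivization.mk_eq_mk_iff'] at h1
      obtain ⟨a, ha⟩ := h1
      rw [LinearIndependent.pair_iff] at hv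
      have := (hv a (-1) (by rw [ha, neg_one_smul]; exact add_neg_cancel (T v))).2
      exact neg_ne_zero.2 one_ne_zero this)
  have ha0 : a ≠ 0 := by
    rintro rfl
    obtain ⟨v, hv⟩ := exists_ne (0 : V)
    have := LinearMap.congr_fun ha v
    simp at this
    exact hv this
  refine ⟨Units.mk0 a ha0, LinearEquiv.ext fun v => ?_⟩
  exact LinearMap.congr_fun ha v

end Linear

/-! ### Cyclic centralizers in `Sz(q)`. -/

namespace Suzuki

variable {F : Type*} [Field F] [Finite F] {e : ℕ}

omit [Finite F] in
theorem commute_toModuleAut {V : Type*} [AddCommGroup V] [Module F V] (c : Fˣ) (T : V ≃ₗ[F] V) :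
    Commute (DistribMulAction.toModuleAut F V c) T :=
  LinearEquiv.ext fun v => (map_smul T (c : F) v).symm

omit [Finite F] in
theorem toModuleAut_eq_one {V : Type*} [AddCommGroup V] [Module F V] [Nontrivial V] {c : Fˣ}
    (h : DistribMulAction.toModuleAut F V c = 1) : c = 1 := by
  obtain ⟨v, hv⟩ := exists_ne (0 : V)
  have h1 : (c : F) • v = (1 : F) • v := by
    rw [one_smul]; exact LinearEquiv.congr_fun h v
  exact Units.ext (smul_left_injective F hv h1)

theorem coprime_of_dvd {l q : ℕ} (hl : l.Prime) (hl2 : l ≠ 2) (hq : l ∣ q ^ 2 + 1) (hq1 : 1 ≤ q) :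
    (q - 1).Coprime l := by
  rw [Nat.coprime_comm, hl.coprime_iff_not_dvd]
  intro h
  obtain ⟨q, rfl⟩ := Nat.exists_eq_add_of_le' hq1
  rw [Nat.add_sub_cancel] at h
  have h2 : l ∣ 2 := by
    have h3 : (q + 1) ^ 2 + 1 = q * (q + 2) + 2 := by ring
    rw [h3] at hq
    exact (Nat.dvd_add_right (h.mul_right _)).1 hq
  exact hl2 ((Nat.prime_dvd_prime_iff_eq hl Nat.prime_two).1 h2)

theorem isCyclic_centralizer_of_dvd {l : ℕ} (hl : l.Prime) (hl2 : l ≠ 2)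
    (hq : l ∣ Nat.card F ^ 2 + 1) {x : Sz F e} (hx : orderOf x = l) :
    IsCyclic (Subgroup.centralizer {x}) := by
  obtain ⟨L, hL⟩ := exists_linear x
  have hcop : (Nat.card Fˣ).Coprime l := by
    rw [Nat.card_units]
    exact coprime_of_dvd hl hl2 hq Nat.card_pos
  have hpow : ∀ (n : ℕ) (p : ℙ F (Fin 4 → F)), x ^ n • p = L ^ n • p := by
    intro n
    induction n with
    | zero => intro p; simp only [pow_zero, one_smul]
    | succ n ih => intro p; rw [pow_succ, pow_succ, mul_smul, mul_smul, hL, ih]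
  obtain ⟨c, hc⟩ := exists_eq_toModuleAut (T := L ^ l) fun p => by
    rw [← hpow, ← hx, pow_orderOf_eq_one, one_smul]
  -- As `l` is prime to `q - 1`, every scalar is an `l`-th power, and the lift of `x` can be
  -- rescaled to have `l`-th power 1.
  obtain ⟨d, rfl⟩ := (powCoprime hcop).surjective c
  set s := DistribMulAction.toModuleAut F (S := Fˣ) (Fin 4 → F)
  have hM : (s d⁻¹ * L) ^ l = 1 := by
    rw [(commute_toModuleAut _ _).mul_pow, hc, ← map_pow, ← map_mul, powCoprime_apply, inv_pow,
      inv_mul_cancel, map_one]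
  have hs : ∀ (a : Fˣ) (p : ℙ F (Fin 4 → F)), s a • p = p := by
    intro a p
    induction p using Projectivization.ind with
    | h v hv =>
      rw [Projectivization.smul_mk, Projectivization.mk_eq_mk_iff']
      exact ⟨a, rfl⟩
  have hM1 : s d⁻¹ * L ≠ 1 := by
    intro h
    have : x = 1 := Sz.ext fun p => by
      rw [hL, one_smul, ← hs d⁻¹ (L • p), ← mul_smul, h, one_smul]
    rw [this, orderOf_one] at hx
    exact hl.one_lt.ne hx
  have hcyc : IsCyclic (Subgroup.centralizer {s d⁻¹ * L}) :=
    isCyclic_centralizer_of_irreducible fun W hW =>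
      eq_bot_or_eq_top_of_invariant hl hl2 hq (by simp) hM hM1 hW
  let P := MulAction.toPermHom ((Fin 4 → F) ≃ₗ[F] (Fin 4 → F)) (ℙ F (Fin 4 → F))
  have hle : (Subgroup.centralizer {x}).map (Sz F e).subtype ≤
      (Subgroup.centralizer {s d⁻¹ * L}).map P := by
    rintro _ ⟨y, hy, rfl⟩
    obtain ⟨N, hN⟩ := exists_linear y
    refine ⟨N, ?_, (Equiv.ext fun p => (hN p).symm)⟩
    have hyx : y * x = x * y := Subgroup.mem_centralizer_singleton_iff.1 hy
    -- Lifts of commuting elements commute up to a scalar `a`. Here `a ^ l = 1`, so `a = 1` by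
    -- coprimality.
    obtain ⟨a, ha⟩ := exists_eq_toModuleAut (T := N * L * N⁻¹ * L⁻¹) fun p => by
      have h1 : ∀ q : ℙ F (Fin 4 → F), N • L • q = L • N • q := fun q => by
        rw [← hL, ← hN, ← hN, ← hL, ← mul_smul, ← mul_smul, hyx]
      rw [mul_smul, mul_smul, mul_smul, h1, smul_inv_smul, smul_inv_smul]
    have ha1 : N * (s d⁻¹ * L) * N⁻¹ = s a * (s d⁻¹ * L) := by
      have h2 : N * L * N⁻¹ = s a * L := mul_inv_eq_iff_eq_mul.1 ha
      rw [← mul_assoc N, ← (commute_toModuleAut d⁻¹ N).eq, mul_assoc, mul_assoc, ← mul_assoc N, h2,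
        ← mul_assoc, ← mul_assoc, (commute_toModuleAut a _).eq]
    have ha2 := congrArg (· ^ l) ha1
    simp only [conj_pow, hM, mul_one, mul_inv_cancel] at ha2
    rw [(commute_toModuleAut a _).mul_pow, hM, mul_one, ← map_pow] at ha2
    have ha3 : powCoprime hcop a = powCoprime hcop 1 := by
      rw [powCoprime_apply, powCoprime_apply, one_pow]
      exact toModuleAut_eq_one ha2.symm
    rw [(powCoprime hcop).injective ha3, map_one, one_mul] at ha1
    exact Subgroup.mem_centralizer_singleton_iff.2 (mul_inv_eq_iff_eq_mul.1 ha1)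
  have h1 : IsCyclic ((Subgroup.centralizer {s d⁻¹ * L}).map P) :=
    isCyclic_of_surjective (P.subgroupMap _) (P.subgroupMap_surjective _)
  have h2 : IsCyclic ((Subgroup.centralizer {x}).map (Sz F e).subtype) := Subgroup.isCyclic_of_le hle
  exact isCyclic_of_injective ((Sz F e).subtype.subgroupMap (Subgroup.centralizer {x}))
    fun a b h => by
      have := congrArg Subtype.val h
      exact Subtype.ext ((Sz F e).subtype_injective this)

variable [CharP F 2] (hF : Nat.card F = 2 ^ (2 * e + 1))

/-- The homomorphism parametrizing the stabilizer of `pointU` and the origin. -/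
noncomputable def torus : Fˣ →* Sz F e where
  toFun k := borel hF k 0 0
  map_one' := borel_one hF
  map_mul' k l := by rw [borel_mul]; simp

include hF in
theorem isCyclic_stabilizer_inf (he : 1 ≤ e) {p q : ℙ F (Fin 4 → F)} (hp : p ∈ ovoid F e)
    (hq : q ∈ ovoid F e) (hpq : p ≠ q) :
    IsCyclic (MulAction.stabilizer (Sz F e) p ⊓ MulAction.stabilizer (Sz F e) q :
      Subgroup (Sz F e)) := by
  obtain ⟨y, rfl, rfl⟩ := exists_smul_pointU_origin hF hp hq hpq
  let f : Fˣ →* Sz F e := (MulAut.conj y).toMonoidHom.comp (torus hF)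
  have hf : IsCyclic f.range := isCyclic_of_surjective f.rangeRestrict f.rangeRestrict_surjective
  refine Subgroup.isCyclic_of_le (H' := f.range) ?_
  rintro g ⟨hg1, hg2⟩
  have hg1 : g • y • pointU F = y • pointU F := hg1
  have hg2 : g • y • ovoidPoint e (0 : F) 0 = y • ovoidPoint e (0 : F) 0 := hg2
  obtain ⟨k, hk⟩ := exists_borel_of_fix_origin hF he (g := y⁻¹ * g * y)
    (by rw [mul_smul, mul_smul, hg1, inv_smul_smul]) (by rw [mul_smul, mul_smul, hg2, inv_smul_smul])
  refine ⟨k, ?_⟩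
  change y * borel hF k 0 0 * y⁻¹ = g
  rw [← hk]
  group

include hF in
-- If `x` fixes a point `p`, its fixed points are `p` and `s p`, and the centralizer lies in the
-- stabilizer of both, a quotient of `Fˣ`. Otherwise `l` divides `q ^ 2 + 1` and `x` acts
-- irreducibly.
theorem isCyclic_centralizer (he : 1 ≤ e) {l : ℕ} (hl : l.Prime) (hl2 : l ≠ 2) {x s : Sz F e}
    (hx : orderOf x = l) (hs : orderOf s = 2) (hsx : s * x * s⁻¹ = x⁻¹) :
    IsCyclic (Subgroup.centralizer {x}) := by
  have c := isSuzukiAction hF he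
  by_cases hfix : ∃ p ∈ ovoid F e, x • p = p
  · obtain ⟨p, hp, hxp⟩ := hfix
    have hx4 : x ^ 4 ≠ 1 := by
      intro h
      have h1 := orderOf_dvd_of_pow_eq_one h
      rw [hx, show 4 = 2 ^ 2 from rfl] at h1
      exact hl2 ((Nat.prime_dvd_prime_iff_eq hl Nat.prime_two).1 (hl.dvd_of_dvd_pow h1))
    have hx1 : x ≠ 1 := by rintro rfl; exact hx4 (one_pow 4)
    have hs1 : s * s = 1 := by rw [← pow_two, ← hs, pow_orderOf_eq_one]
    have hss : s⁻¹ = s := inv_eq_of_mul_eq_one_left hs1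
    -- If `s` fixed `p`, then `s` and `x s x⁻¹` would be commuting involutions with product `x⁻²`,
    -- whence `x ^ 4 = 1`.
    have hsp : s • p ≠ p := by
      intro h
      have h1 : Commute s (x * s * x⁻¹) := c.commute s (x * s * x⁻¹) s p hp hs
        (by rw [orderOf_conj_eq, hs]) h
        (by rw [mul_smul, mul_smul, inv_smul_eq_iff.2 hxp.symm, h, hxp]) (Commute.refl s)
      have h2 : s * (x * s * x⁻¹) = x⁻¹ ^ 2 := by
        have : s * (x * s * x⁻¹) = (s * x * s⁻¹) * x⁻¹ := by rw [hss]; group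
        rw [this, hsx, pow_two]
      have h3 : (x * s * x⁻¹) ^ 2 = 1 := by
        rw [conj_pow, pow_two, hs1, mul_one, mul_inv_cancel]
      have h4 := h1.mul_pow 2
      rw [h2, h3, pow_two s, hs1, mul_one, ← pow_mul, inv_pow, inv_eq_one] at h4
      exact hx4 h4
    have hsmem := smul_mem_ovoid s hp
    have hxsp : x • s • p = s • p := by
      have h1 : x * s = s * x⁻¹ := by
        rw [← hsx, hss, ← mul_assoc, ← mul_assoc, hs1, one_mul]
      rw [← mul_smul, h1, mul_smul, inv_smul_eq_iff.2 hxp.symm]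
    have hmem : ∀ q ∈ ovoid F e, x • q = q → q = p ∨ q = s • p := by
      intro q hq hxq
      by_contra hcon
      push Not at hcon
      exact hx1 (c.eq_one_of_fix x p hp _ hsmem q hq (Ne.symm hsp) hcon.1.symm hcon.2.symm hxp hxsp hxq)
    have hodd : ∀ g, Commute g x → Odd (orderOf g) := by
      intro g hg
      by_contra hcon
      obtain ⟨k, hk⟩ := even_iff_two_dvd.1 (Nat.not_odd_iff_even.1 hcon)
      have h0 : orderOf g ≠ 0 := (orderOf_pos g).ne'
      have h1 : orderOf (g ^ k) = 2 := by
        have hk0 : k ≠ 0 := by rintro rfl; exact h0 hk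
        rw [orderOf_pow_of_dvd hk0 ⟨2, by rw [hk, mul_comm]⟩, hk, Nat.mul_div_cancel _ (by omega)]
      exact hx4 (c.pow_four (g ^ k) x h1 (hg.pow_left k).symm)
    have hfixes : ∀ g, Commute g x → g • p = p ∧ g • s • p = s • p := by
      intro g hg
      have hgx : ∀ q : ℙ F (Fin 4 → F), x • q = q → x • g • q = g • q := fun q hq => by
        rw [← mul_smul, ← hg.eq, mul_smul, hq]
      have h1 := hmem _ (smul_mem_ovoid g hp) (hgx p hxp)
      have h2 := hmem _ (smul_mem_ovoid g hsmem) (hgx _ hxsp)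
      have hne : g • p ≠ g • s • p := fun h => hsp (MulAction.injective g h).symm
      -- An element `g` of the centralizer permutes `{p, s p}`, so `g²` fixes both points. As `g`
      -- has odd order, it is a power of `g²`.
      have hsq : g ^ 2 • p = p ∧ g ^ 2 • s • p = s • p := by
        rw [pow_two, mul_smul, mul_smul]
        obtain h1 | h1 := h1 <;> obtain h2 | h2 := h2
        · exact absurd (h1.trans h2.symm) hne
        · exact ⟨by rw [h1, h1], by rw [h2, h2]⟩
        · exact ⟨by rw [h1, h2], by rw [h2, h1]⟩
        · exact absurd (h1.trans h2.symm) hne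
      obtain ⟨j, hj⟩ := hodd g hg
      have hgj : (g ^ 2) ^ (j + 1) = g := by
        rw [← pow_mul, show 2 * (j + 1) = orderOf g + 1 by omega, pow_succ, pow_orderOf_eq_one,
          one_mul]
      have hstab : ∀ q : ℙ F (Fin 4 → F), g ^ 2 • q = q → g • q = q := fun q hq => by
        have h3 : g ^ 2 ∈ MulAction.stabilizer (Sz F e) q := hq
        have h4 := pow_mem h3 (j + 1)
        rw [hgj] at h4
        exact h4
      exact ⟨hstab _ hsq.1, hstab _ hsq.2⟩
    have := isCyclic_stabilizer_inf hF he hp hsmem (Ne.symm hsp)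
    refine Subgroup.isCyclic_of_le (H' := MulAction.stabilizer (Sz F e) p ⊓
      MulAction.stabilizer (Sz F e) (s • p)) fun g hg => ?_
    have hg : Commute g x := Subgroup.mem_centralizer_singleton_iff.1 hg
    exact hfixes g hg
  · push Not at hfix
    refine isCyclic_centralizer_of_dvd hl hl2 ?_ hx
    have h := ncard_modEq_ncard_fixed hl (hx ▸ pow_orderOf_eq_one x)
      (finite_ovoid (F := F) (e := e)) fun p => smul_mem_ovoid x
    rw [show {p | p ∈ ovoid F e ∧ x • p = p} = ∅ from
      Set.eq_empty_of_forall_notMem fun p hp => hfix p hp.1 hp.2, Set.ncard_empty, ncard_ovoid,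
      Nat.modEq_zero_iff_dvd] at h
    exact h

end Suzuki

/-! ### Subgroups generated by two involutions -/

section Dihedral
variable {G : Type*} [Group G] {a b : G}

theorem mul_self_of_orderOf_eq_two (ha : orderOf a = 2) : a * a = 1 := by
  rw [← pow_two, ← ha, pow_orderOf_eq_one]

theorem inv_of_orderOf_eq_two (ha : orderOf a = 2) : a⁻¹ = a :=
  inv_eq_of_mul_eq_one_left (mul_self_of_orderOf_eq_two ha)

theorem conj_mul_eq_inv (ha : orderOf a = 2) (hb : orderOf b = 2) :
    a * (a * b) * a⁻¹ = (a * b)⁻¹ := by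
  rw [mul_inv_rev, inv_of_orderOf_eq_two hb, inv_of_orderOf_eq_two ha, ← mul_assoc,
    mul_self_of_orderOf_eq_two ha, one_mul]

theorem conj_zpowers_eq_inv (ha : orderOf a = 2) (hb : orderOf b = 2) {y : G}
    (hy : y ∈ Subgroup.zpowers (a * b)) : a * y * a⁻¹ = y⁻¹ := by
  obtain ⟨i, rfl⟩ := hy
  have := map_zpow (MulAut.conj a) (a * b) i
  simp only [MulAut.conj_apply] at this
  simp only [this, conj_mul_eq_inv ha hb, inv_zpow]

theorem zpowers_le_closure : Subgroup.zpowers (a * b) ≤ Subgroup.closure {a, b} :=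
  (Subgroup.zpowers_le).2 (mul_mem (Subgroup.subset_closure (by simp))
    (Subgroup.subset_closure (by simp)))

/-- The homomorphism from the dihedral group to a group generated by two involutions. -/
def dihedralHom (ha : orderOf a = 2) (hb : orderOf b = 2) {m : ℕ} [NeZero m]
    (hm : orderOf (a * b) = m) : DihedralGroup m →* G :=
  have hadd : ∀ i j : ZMod m, (a * b) ^ (i + j).val = (a * b) ^ i.val * (a * b) ^ j.val := by
    intro i j
    rw [← pow_add, ZMod.val_add]
    have := pow_mod_orderOf (a * b) (i.val + j.val)
    rwa [hm] at this
  have hsub : ∀ i j : ZMod m, (a * b) ^ (j - i).val = ((a * b) ^ i.val)⁻¹ * (a * b) ^ j.val := by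
    intro i j
    rw [eq_inv_mul_iff_mul_eq, ← hadd, add_sub_cancel]
  have hconj : ∀ n : ℕ, (a * b) ^ n * a = a * ((a * b) ^ n)⁻¹ := by
    intro n
    rw [← conj_zpowers_eq_inv ha hb (Subgroup.npow_mem_zpowers (a * b) n),
      inv_of_orderOf_eq_two ha, ← mul_assoc, ← mul_assoc, mul_self_of_orderOf_eq_two ha, one_mul]
  { toFun := fun
      | .r i => (a * b) ^ i.val
      | .sr i => a * (a * b) ^ i.val
    map_one' := by
      change (a * b) ^ (0 : ZMod m).val = 1
      rw [ZMod.val_zero, pow_zero]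
    map_mul' := by
      rintro (i | i) (j | j)
      · exact hadd i j
      · change a * (a * b) ^ (j - i).val = (a * b) ^ i.val * (a * (a * b) ^ j.val)
        rw [hsub, ← mul_assoc, ← mul_assoc, hconj]
      · change a * (a * b) ^ (i + j).val = a * (a * b) ^ i.val * (a * b) ^ j.val
        rw [hadd, mul_assoc]
      · change (a * b) ^ (j - i).val = a * (a * b) ^ i.val * (a * (a * b) ^ j.val)
        rw [hsub, ← mul_assoc, mul_assoc a, hconj, ← mul_assoc, mul_self_of_orderOf_eq_two ha,
          one_mul] }

theorem range_dihedralHom (ha : orderOf a = 2) (hb : orderOf b = 2) {m : ℕ} [NeZero m]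
    (hm : orderOf (a * b) = m) : (dihedralHom ha hb hm).range = Subgroup.closure {a, b} := by
  apply le_antisymm
  · rintro _ ⟨i | i, rfl⟩
    · exact zpowers_le_closure (Subgroup.npow_mem_zpowers _ _)
    · exact mul_mem (Subgroup.subset_closure (by simp))
        (zpowers_le_closure (Subgroup.npow_mem_zpowers _ _))
  · rw [Subgroup.closure_le]
    have h1 : a ∈ (dihedralHom ha hb hm).range := ⟨.sr 0, by
      change a * (a * b) ^ (0 : ZMod m).val = a
      rw [ZMod.val_zero, pow_zero, mul_one]⟩
    have h2 : a * b ∈ (dihedralHom ha hb hm).range := ⟨.r 1, by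
      change (a * b) ^ (1 : ZMod m).val = a * b
      rw [ZMod.val_one_eq_one_mod, ← hm, pow_mod_orderOf, pow_one]⟩
    rintro _ (rfl | rfl)
    · exact h1
    · have := mul_mem (inv_mem h1) h2
      rwa [inv_mul_cancel_left] at this

theorem mem_closure_pair [Finite G] (ha : orderOf a = 2) (hb : orderOf b = 2) {h : G}
    (hh : h ∈ Subgroup.closure {a, b}) :
    h ∈ Subgroup.zpowers (a * b) ∨ ∃ y ∈ Subgroup.zpowers (a * b), h = a * y := by
  have : NeZero (orderOf (a * b)) := ⟨(orderOf_pos _).ne'⟩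
  rw [← range_dihedralHom ha hb rfl] at hh
  obtain ⟨i | i, rfl⟩ := hh
  · exact Or.inl (Subgroup.npow_mem_zpowers _ _)
  · exact Or.inr ⟨_, Subgroup.npow_mem_zpowers _ _, rfl⟩

theorem orderOf_ne_two_of_mem_zpowers {x y : G} (hx : Odd (orderOf x))
    (hy : y ∈ Subgroup.zpowers x) : orderOf y ≠ 2 := by
  intro h
  have := hx.of_dvd_nat (orderOf_dvd_of_mem_zpowers hy)
  rw [h] at this
  exact absurd this (by decide)

theorem exists_eq_mul_of_orderOf_eq_two [Finite G] (ha : orderOf a = 2) (hb : orderOf b = 2)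
    (hodd : Odd (orderOf (a * b))) {h : G} (hh : h ∈ Subgroup.closure {a, b}) (h2 : orderOf h = 2) :
    ∃ y ∈ Subgroup.zpowers (a * b), h = a * y :=
  (mem_closure_pair ha hb hh).resolve_left fun h1 => orderOf_ne_two_of_mem_zpowers hodd h1 h2

theorem orderOf_mul_zpowers (ha : orderOf a = 2) (hb : orderOf b = 2)
    (hodd : Odd (orderOf (a * b))) {y : G} (hy : y ∈ Subgroup.zpowers (a * b)) :
    orderOf (a * y) = 2 := by
  refine orderOf_eq_prime ?_ ?_
  · have := conj_zpowers_eq_inv ha hb hy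
    rw [inv_of_orderOf_eq_two ha] at this
    rw [pow_two, ← mul_assoc, this, inv_mul_cancel]
  · intro h
    refine orderOf_ne_two_of_mem_zpowers hodd (inv_mem hy) ?_
    rwa [← eq_inv_of_mul_eq_one_left h]

theorem nonempty_mulEquiv_dihedralGroup [Finite G] (ha : orderOf a = 2) (hb : orderOf b = 2)
    (hodd : Odd (orderOf (a * b))) :
    Nonempty (Subgroup.closure {a, b} ≃* DihedralGroup (orderOf (a * b))) := by
  have : NeZero (orderOf (a * b)) := ⟨(orderOf_pos _).ne'⟩
  have hinj : Function.Injective (dihedralHom ha hb rfl) := by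
    rw [injective_iff_map_eq_one]
    rintro (i | i) h
    · have h : (a * b) ^ i.val = 1 := h
      have h1 := Nat.eq_zero_of_dvd_of_lt (orderOf_dvd_of_pow_eq_one h) (ZMod.val_lt i)
      rw [(ZMod.val_eq_zero i).1 h1]
      rfl
    · have h : a * (a * b) ^ i.val = 1 := h
      have h1 := orderOf_mul_zpowers ha hb hodd (Subgroup.npow_mem_zpowers (a * b) i.val)
      rw [h, orderOf_one] at h1
      omega
  exact ⟨((MonoidHom.ofInjective hinj).trans
    (MulEquiv.subgroupCongr (range_dihedralHom ha hb rfl))).symm⟩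

theorem exists_sq_eq {x y : G} (hx : Odd (orderOf x)) (hy : y ∈ Subgroup.zpowers x) :
    ∃ w ∈ Subgroup.zpowers x, w * w = y := by
  obtain ⟨k, hk⟩ := hx.of_dvd_nat (orderOf_dvd_of_mem_zpowers hy)
  refine ⟨y ^ (k + 1), pow_mem hy _, ?_⟩
  rw [← pow_add, show k + 1 + (k + 1) = orderOf y + 1 by omega, pow_succ, pow_orderOf_eq_one, one_mul]

/-- Both groups fill the set of solutions of `w ^ n = 1`, which in a cyclic group has at most `n`
elements. -/
theorem zpowers_eq_of_isCyclic [Finite G] {C : Subgroup G} [IsCyclic C] {x y : G} (hx : x ∈ C)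
    (hy : y ∈ C) (hxy : orderOf x = orderOf y) : Subgroup.zpowers x = Subgroup.zpowers y := by
  classical
  have := Fintype.ofFinite C
  have key : ∀ z : C, orderOf z = orderOf x → (Subgroup.zpowers z : Set C) =
      (Finset.univ.filter fun a : C => a ^ orderOf x = 1 : Finset C) := by
    intro z hz
    refine Set.eq_of_subset_of_ncard_le ?_ ?_ (Finset.finite_toSet _)
    · intro w hw
      simp only [Finset.coe_filter, Finset.mem_univ, true_and, Set.mem_ofPred_eq]
      rw [← hz]
      exact orderOf_dvd_iff_pow_eq_one.1 (orderOf_dvd_of_mem_zpowers hw)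
    · rw [Set.ncard_coe_finset, ← Nat.card_coe_set_eq]
      refine (IsCyclic.card_pow_eq_one_le (orderOf_pos x)).trans ?_
      rw [← hz]
      exact (Nat.card_zpowers z).ge
  have h1 := (key ⟨x, hx⟩ (Subgroup.orderOf_mk x hx)).trans
    (key ⟨y, hy⟩ ((Subgroup.orderOf_mk y hy).trans hxy.symm)).symm
  have h2 : Subgroup.zpowers (⟨x, hx⟩ : C) = Subgroup.zpowers ⟨y, hy⟩ := SetLike.coe_injective h1
  have h3 := congrArg (Subgroup.map C.subtype) h2
  rwa [MonoidHom.map_zpowers, MonoidHom.map_zpowers] at h3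

end Dihedral

/-! ### Sides of odd order and their stabilizers. -/

namespace Suzuki

variable {F : Type*} [Field F] [Finite F] [CharP F 2] {e : ℕ}
  (hF : Nat.card F = 2 ^ (2 * e + 1)) (he : 1 ≤ e) {a b : Sz F e}

section Pair
variable (ha : orderOf a = 2) (hb : orderOf b = 2)

include hF he ha hb

/-- The rotation of order two commutes with `a` and `b`, so its only fixed point is theirs. -/
theorem smul_eq_of_not_odd (h : ¬ Odd (orderOf (a * b))) {p : ℙ F (Fin 4 → F)}
    (hp : p ∈ ovoid F e) (hap : a • p = p) : b • p = p := by
  have c := isSuzukiAction hF he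
  obtain ⟨k, hk⟩ := even_iff_two_dvd.1 (Nat.not_odd_iff_even.1 h)
  have h0 := (orderOf_pos (a * b)).ne'
  have hk0 : k ≠ 0 := by rintro rfl; exact h0 hk
  have ht : orderOf ((a * b) ^ k) = 2 := by
    rw [orderOf_pow_of_dvd hk0 ⟨2, by rw [hk, mul_comm]⟩, hk, Nat.mul_div_cancel _ (by omega)]
  have h1 : Commute a ((a * b) ^ k) := by
    have h2 := conj_zpowers_eq_inv ha hb (Subgroup.npow_mem_zpowers (a * b) k)
    rw [inv_of_orderOf_eq_two ht] at h2
    exact mul_inv_eq_iff_eq_mul.1 h2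
  have h3 : Commute b ((a * b) ^ k) := by
    have h4 : Commute (a * b) ((a * b) ^ k) := Commute.self_pow _ _
    have h5 := h1.inv_left.mul_left h4
    rwa [inv_mul_cancel_left] at h5
  have hfix : ∀ s : Sz F e, orderOf s = 2 → Commute s ((a * b) ^ k) → ∀ q ∈ ovoid F e, s • q = q →
      (a * b) ^ k • q = q := fun s hs hc q hq hsq =>
    c.eq_of_fix s hs _ (smul_mem_ovoid _ hq) q hq (by rw [← mul_smul, hc.eq, mul_smul, hsq]) hsq
  obtain ⟨q, hq, hbq⟩ := exists_fixed_of_orderOf_eq_two hF hb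
  have : p = q := c.eq_of_fix _ ht p hp q hq (hfix a ha h1 p hp hap) (hfix b hb h3 q hq hbq)
  rw [this, hbq]

variable (hodd : Odd (orderOf (a * b))) (hab : a ≠ b)

include hodd

/-- A nontrivial rotation does not fix the fixed point of `a`. -/
theorem eq_one_of_zpowers_smul_eq {p : ℙ F (Fin 4 → F)} (hp : p ∈ ovoid F e) (hap : a • p = p)
    {y : Sz F e} (hy : y ∈ Subgroup.zpowers (a * b)) (hyp : y • p = p) : y = 1 := by
  have c := isSuzukiAction hF he
  have h1 := orderOf_mul_zpowers ha hb hodd hy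
  have h2 : Commute a (a * y) := c.commute a (a * y) a p hp ha h1 hap
    (by rw [mul_smul, hyp, hap]) (Commute.refl a)
  have h3 : a * y = y * a := by
    have := h2.eq
    rw [← mul_assoc, mul_self_of_orderOf_eq_two ha, one_mul, mul_assoc] at this
    calc a * y = a * y * (a * a) := by rw [mul_self_of_orderOf_eq_two ha, mul_one]
      _ = y * a := by rw [← mul_assoc, mul_assoc a, ← this]
  have h4 := conj_zpowers_eq_inv ha hb hy
  rw [h3, mul_inv_cancel_right] at h4
  by_contra hy1
  exact orderOf_ne_two_of_mem_zpowers hodd hy (orderOf_eq_prime (by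
    rw [pow_two, mul_eq_one_iff_eq_inv]; exact h4) hy1)

/-- In odd order every rotation is a square `w²`, so each involution `a w²` equals `w⁻¹ a w` and
fixes `w⁻¹ p`. -/
theorem mem_fixedPoints_iff {p q : ℙ F (Fin 4 → F)} (hp : p ∈ ovoid F e) (hap : a • p = p) :
    q ∈ fixedPoints (Subgroup.closure {a, b}) ↔
      ∃ z ∈ Subgroup.zpowers (a * b), q = z • p := by
  have c := isSuzukiAction hF he
  constructor
  · rintro ⟨hq, h, hh, h2, hhq⟩
    obtain ⟨y, hy, rfl⟩ := exists_eq_mul_of_orderOf_eq_two ha hb hodd hh h2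
    obtain ⟨w, hw, rfl⟩ := exists_sq_eq hodd hy
    refine ⟨w⁻¹, inv_mem hw, ?_⟩
    have h3 : a * (w * w) = w⁻¹ * a * w := by
      rw [← conj_zpowers_eq_inv ha hb hw, inv_of_orderOf_eq_two ha, mul_assoc (a * w),
        mul_self_of_orderOf_eq_two ha, mul_one, mul_assoc]
    refine c.eq_of_fix _ h2 q hq _ (smul_mem_ovoid _ hp) hhq ?_
    rw [h3, mul_smul, smul_inv_smul, mul_smul, hap]
  · rintro ⟨z, hz, rfl⟩
    refine ⟨smul_mem_ovoid z hp, z * a * z⁻¹, mul_mem (mul_mem (zpowers_le_closure hz)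
      (Subgroup.subset_closure (by simp))) (inv_mem (zpowers_le_closure hz)), ?_, ?_⟩
    · rw [orderOf_conj_eq, ha]
    · rw [mul_smul, inv_smul_smul, mul_smul, hap]

omit [Finite F] [CharP F 2] hF he ha hb hodd in
theorem smul_fixedPoints_subset {H : Subgroup (Sz F e)} {h : Sz F e} (hh : h ∈ H) :
    ∀ p ∈ fixedPoints H, h • p ∈ fixedPoints H := by
  rintro p ⟨hp, s, hs, hs2, hsp⟩
  refine ⟨smul_mem_ovoid h hp, h * s * h⁻¹, mul_mem (mul_mem hh hs) (inv_mem hh), ?_, ?_⟩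
  · rw [orderOf_conj_eq, hs2]
  · rw [mul_smul, inv_smul_smul, mul_smul, hsp]

omit [CharP F 2] hF he ha hb hodd in
theorem le_stabilizer_fixedPoints (H : Subgroup (Sz F e)) :
    H ≤ MulAction.stabilizer (Sz F e) (fixedPoints H) := fun _ hh =>
  (MulAction.mem_stabilizer_set' (Set.toFinite _)).2 (smul_fixedPoints_subset hh)

include hab

theorem isDihedralOrbit {p : ℙ F (Fin 4 → F)} (hp : p ∈ ovoid F e) (hap : a • p = p) :
    IsDihedralOrbit (S := MulAction.stabilizer (Sz F e) (fixedPoints (Subgroup.closure {a, b})))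
      (fixedPoints (Subgroup.closure {a, b}))
      ⟨a * b, le_stabilizer_fixedPoints _ (zpowers_le_closure (Subgroup.mem_zpowers _))⟩
      ⟨a, le_stabilizer_fixedPoints _ (Subgroup.subset_closure (by simp))⟩ p where
  toIsSuzukiAction := (isSuzukiAction hF he).subgroup _ (fun q hq => hq.1)
    (fun g hg q hq => (MulAction.mem_stabilizer_set' (Set.toFinite _)).1 hg hq)
  orderOf_eq_two := (Subgroup.orderOf_mk _ _).trans ha
  conj_eq_inv := Subtype.ext (conj_mul_eq_inv ha hb)
  odd := by rwa [Subgroup.orderOf_mk]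
  trans := by
    intro q hq q' hq'
    obtain ⟨_, ⟨i, rfl⟩, rfl⟩ := (mem_fixedPoints_iff hF he ha hb hodd hp hap).1 hq
    obtain ⟨_, ⟨j, rfl⟩, rfl⟩ := (mem_fixedPoints_iff hF he ha hb hodd hp hap).1 hq'
    refine ⟨_, ⟨j - i, rfl⟩, ?_⟩
    change ((a * b) ^ (j - i)) • ((a * b) ^ i) • p = ((a * b) ^ j) • p
    rw [← mul_smul, ← zpow_add, sub_add_cancel]
  mem := (mem_fixedPoints_iff hF he ha hb hodd hp hap).2 ⟨1, one_mem _, (one_smul _ p).symm⟩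
  smul_eq := hap
  two_lt := by
    have hx1 : a * b ≠ 1 := fun h => hab (by
      rw [eq_inv_of_mul_eq_one_left h, inv_of_orderOf_eq_two hb])
    have hx := Subgroup.mem_zpowers (a * b)
    have hx2 : (a * b) ^ 2 ≠ 1 := fun h =>
      orderOf_ne_two_of_mem_zpowers hodd hx (orderOf_eq_prime h hx1)
    have hmem : ∀ z ∈ Subgroup.zpowers (a * b), z • p ∈ fixedPoints (Subgroup.closure {a, b}) :=
      fun z hz => (mem_fixedPoints_iff hF he ha hb hodd hp hap).2 ⟨z, hz, rfl⟩
    have h1 : (a * b) • p ≠ p := fun h =>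
      hx1 (eq_one_of_zpowers_smul_eq hF he ha hb hodd hp hap hx h)
    have h2 : (a * b) ^ 2 • p ≠ p := fun h =>
      hx2 (eq_one_of_zpowers_smul_eq hF he ha hb hodd hp hap (pow_mem hx 2) h)
    refine (Set.two_lt_ncard (Set.toFinite _)).2 ⟨p, ?_, _, hmem _ hx, _, hmem _ (pow_mem hx 2),
      h1.symm, h2.symm, ?_⟩
    · exact (mem_fixedPoints_iff hF he ha hb hodd hp hap).2 ⟨1, one_mem _, (one_smul _ p).symm⟩
    · rw [pow_two, mul_smul]
      exact fun h => h1 (MulAction.injective (a * b) h).symm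

theorem odd_ncard_fixedPoints : Odd (fixedPoints (Subgroup.closure {a, b})).ncard := by
  obtain ⟨p, hp, hap⟩ := exists_fixed_of_orderOf_eq_two hF ha
  have c := isDihedralOrbit hF he ha hb hodd hab hp hap
  rw [← c.card_zpowers, Nat.card_zpowers]
  exact c.odd

/-- Two involutions that preserve `fixedPoints ⟨a, b⟩` and fix one of its points are equal. -/
theorem eq_of_smul_eq {s t : Sz F e} (hs : orderOf s = 2) (ht : orderOf t = 2)
    (hsS : s ∈ MulAction.stabilizer (Sz F e) (fixedPoints (Subgroup.closure {a, b})))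
    (htS : t ∈ MulAction.stabilizer (Sz F e) (fixedPoints (Subgroup.closure {a, b})))
    {q : ℙ F (Fin 4 → F)} (hq : q ∈ fixedPoints (Subgroup.closure {a, b})) (hsq : s • q = q)
    (htq : t • q = q) : s = t := by
  obtain ⟨p, hp, hap⟩ := exists_fixed_of_orderOf_eq_two hF ha
  have c := isDihedralOrbit hF he ha hb hodd hab hp hap
  obtain ⟨z, hz, rfl⟩ := (mem_fixedPoints_iff hF he ha hb hodd hp hap).1 hq
  have hzS := le_stabilizer_fixedPoints _ (zpowers_le_closure hz)
  have key : ∀ s : Sz F e, orderOf s = 2 →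
      s ∈ MulAction.stabilizer (Sz F e) (fixedPoints (Subgroup.closure {a, b})) →
      s • z • p = z • p → z⁻¹ * s * z⁻¹⁻¹ = a := by
    intro s hs hsS hsq
    have := c.eq_of_orderOf_eq_two (s := ⟨z⁻¹ * s * z⁻¹⁻¹, mul_mem (mul_mem (inv_mem hzS) hsS)
      (inv_mem (inv_mem hzS))⟩) (by rw [Subgroup.orderOf_mk, orderOf_conj_eq, hs])
      (by change (z⁻¹ * s * z⁻¹⁻¹) • p = p
          rw [inv_inv, mul_smul, mul_smul, hsq, inv_smul_smul])
    exact congrArg Subtype.val this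
  have h := (key s hs hsS hsq).trans (key t ht htS htq).symm
  rwa [mul_left_inj, mul_right_inj] at h

theorem exists_smul_eq_of_mem_stabilizer {s : Sz F e} (hs : orderOf s = 2)
    (hsS : s ∈ MulAction.stabilizer (Sz F e) (fixedPoints (Subgroup.closure {a, b}))) :
    ∃ q ∈ fixedPoints (Subgroup.closure {a, b}), s • q = q := by
  have h := ncard_modEq_ncard_fixed Nat.prime_two (hs ▸ pow_orderOf_eq_one s)
    (Set.toFinite (fixedPoints (Subgroup.closure {a, b})))
    fun p hp => (MulAction.mem_stabilizer_set' (Set.toFinite _)).1 hsS hp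
  by_contra hcon
  push Not at hcon
  rw [show {p | p ∈ fixedPoints (Subgroup.closure {a, b}) ∧ s • p = p} = ∅ from
    Set.eq_empty_of_forall_notMem fun p hp => hcon p hp.1 hp.2, Set.ncard_empty,
    Nat.modEq_zero_iff_dvd, ← even_iff_two_dvd] at h
  exact Nat.not_even_iff_odd.2 (odd_ncard_fixedPoints hF he ha hb hodd hab) h

/-- An involution of `H` fixes a point of the side, where some involution of `⟨a, b⟩` is the only
one available. As a dihedral group is generated by its reflections, `H ≤ ⟨a, b⟩`, and the orders
agree. -/
theorem isDihedralInStabilizer_iff {H : Subgroup (Sz F e)} :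
    IsDihedralInStabilizer (orderOf (a * b)) (fixedPoints (Subgroup.closure {a, b})) H ↔
      H = Subgroup.closure {a, b} := by
  constructor
  · rintro ⟨hH, ⟨f⟩⟩
    have hinv : ∀ h ∈ H, orderOf h = 2 → h ∈ Subgroup.closure {a, b} := by
      intro h hh h2
      obtain ⟨q, hq, hhq⟩ := exists_smul_eq_of_mem_stabilizer hF he ha hb hodd hab h2 (hH hh)
      have hq' := hq
      obtain ⟨-, t, ht, ht2, htq⟩ := hq'
      rw [eq_of_smul_eq hF he ha hb hodd hab h2 ht2 (hH hh) (le_stabilizer_fixedPoints _ ht) hq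
        hhq htq]
      exact ht
    have hsr : ∀ i, ((f.symm (.sr i) : H) : Sz F e) ∈ Subgroup.closure {a, b} := fun i =>
      hinv _ (f.symm (.sr i)).2 (by
        rw [Subgroup.orderOf_coe, MulEquiv.orderOf_eq, DihedralGroup.orderOf_sr])
    have hle : H ≤ Subgroup.closure {a, b} := by
      intro h hh
      obtain ⟨d, hd⟩ := f.symm.surjective ⟨h, hh⟩
      have hd' : h = ((f.symm d : H) : Sz F e) := by rw [hd]
      rw [hd']
      cases d with
      | r i =>
        have : DihedralGroup.r i = DihedralGroup.sr 0 * DihedralGroup.sr i := by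
          rw [DihedralGroup.sr_mul_sr, sub_zero]
        rw [this, map_mul]
        exact mul_mem (hsr 0) (hsr i)
      | sr i => exact hsr i
    obtain ⟨f'⟩ := nonempty_mulEquiv_dihedralGroup ha hb hodd
    exact Subgroup.eq_of_le_of_card_ge hle (Nat.card_congr (f'.trans f.symm).toEquiv).le
  · rintro rfl
    exact ⟨le_stabilizer_fixedPoints _, nonempty_mulEquiv_dihedralGroup ha hb hodd⟩

end Pair

include hF he in
/-- Two dihedral groups on involutions `a, b` and `b, c` with a common involution other than `b`
coincide. -/
theorem closure_eq_closure {a b c s : Sz F e} (ha : orderOf a = 2) (hb : orderOf b = 2)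
    (hc : orderOf c = 2) (hodd : Odd (orderOf (a * b))) (habc : orderOf (a * b) = orderOf (b * c))
    (hs : orderOf s = 2) (hsab : s ∈ Subgroup.closure {a, b}) (hsbc : s ∈ Subgroup.closure {b, c})
    (hsb : s ≠ b) : Subgroup.closure {a, b} = Subgroup.closure {b, c} := by
  have hbs : b * s ≠ 1 := fun h => hsb (by
    rw [eq_inv_of_mul_eq_one_right h, inv_of_orderOf_eq_two hb])
  have h1 : b * s ∈ Subgroup.zpowers (a * b) := by
    obtain ⟨y, hy, h⟩ := exists_eq_mul_of_orderOf_eq_two ha hb hodd hsab hs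
    have h2 := conj_zpowers_eq_inv ha hb (mul_mem (Subgroup.mem_zpowers (a * b)) (inv_mem hy))
    have h3 : b * s = (a * b)⁻¹ * y := by
      rw [h, mul_inv_rev, inv_of_orderOf_eq_two hb, inv_of_orderOf_eq_two ha, mul_assoc]
    rw [h3]
    exact mul_mem (inv_mem (Subgroup.mem_zpowers _)) hy
  have h2 : b * s ∈ Subgroup.zpowers (b * c) := by
    obtain ⟨y, hy, rfl⟩ := exists_eq_mul_of_orderOf_eq_two hb hc (habc ▸ hodd) hsbc hs
    rwa [← mul_assoc, mul_self_of_orderOf_eq_two hb, one_mul]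
  -- A power of prime order of the common rotation `b s` is inverted by `b`. Its cyclic centralizer
  -- contains `a b` and `b c`, which have the same order and so generate the same group.
  obtain ⟨l, hl, k, hk⟩ := Nat.exists_prime_and_dvd (mt orderOf_eq_one_iff.1 hbs)
  have h0 := (orderOf_pos (b * s)).ne'
  have hk0 : k ≠ 0 := by rintro rfl; exact h0 hk
  have hy : orderOf ((b * s) ^ k) = l := by
    rw [orderOf_pow_of_dvd hk0 ⟨l, by rw [hk, mul_comm]⟩, hk, Nat.mul_div_cancel _ (by omega)]
  have hl2 : l ≠ 2 := by
    rintro rfl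
    exact orderOf_ne_two_of_mem_zpowers hodd (pow_mem h1 k) hy
  have hcyc := isCyclic_centralizer hF he hl hl2 hy hb
    (conj_zpowers_eq_inv hb hs (Subgroup.npow_mem_zpowers _ _))
  have hmem : ∀ x : Sz F e, b * s ∈ Subgroup.zpowers x →
      x ∈ Subgroup.centralizer {(b * s) ^ k} := by
    intro x hx
    obtain ⟨i, hi⟩ := hx
    have hi : x ^ i = b * s := hi
    rw [Subgroup.mem_centralizer_singleton_iff, ← hi]
    exact ((Commute.self_zpow x i).pow_right k).eq
  have hz := zpowers_eq_of_isCyclic (hmem _ h1) (hmem _ h2) habc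
  apply le_antisymm
  · rw [Subgroup.closure_le]
    have hb' : b ∈ Subgroup.closure {b, c} := Subgroup.subset_closure (by simp)
    have hab : a * b ∈ Subgroup.closure {b, c} :=
      zpowers_le_closure (hz ▸ Subgroup.mem_zpowers (a * b))
    rintro _ (rfl | rfl)
    · have := mul_mem hab (inv_mem hb')
      rwa [mul_inv_cancel_right] at this
    · exact hb'
  · rw [Subgroup.closure_le]
    have hb' : b ∈ Subgroup.closure {a, b} := Subgroup.subset_closure (by simp)
    have hbc : b * c ∈ Subgroup.closure {a, b} :=
      zpowers_le_closure (hz ▸ Subgroup.mem_zpowers (b * c))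
    rintro _ (rfl | rfl)
    · exact hb'
    · have := mul_mem (inv_mem hb') hbc
      rwa [inv_mul_cancel_left] at this

end Suzuki

namespace Suzuki

variable {F : Type*} [Field F] {e : ℕ}

/-! ### The triangle of an involution and a triality -/

section Rho
variable {ρ₀ : Sz F e} {τ : MulAut (Sz F e)}

theorem orderOf_rho (hρ : orderOf ρ₀ = 2) (i : Fin 3) : orderOf (rho ρ₀ τ i) = 2 := by
  rw [rho, MulEquiv.orderOf_eq, hρ]

theorem map_rho (hτ : τ ^ 3 = 1) (i : Fin 3) : τ (rho ρ₀ τ i) = rho ρ₀ τ (i + 1) := by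
  have h : ∀ n : ℕ, τ ((τ ^ n) ρ₀) = (τ ^ (n + 1)) ρ₀ := fun n => by
    rw [pow_succ', MulAut.mul_apply]
  fin_cases i
  · exact h 0
  · exact h 1
  · refine (h 2).trans ?_
    change (τ ^ 3) ρ₀ = (τ ^ 0) ρ₀
    rw [hτ, pow_zero]

theorem orderOf_rho_mul_rho (hτ : τ ^ 3 = 1) (i : Fin 3) :
    orderOf (rho ρ₀ τ i * rho ρ₀ τ (i + 1)) = orderOf (ρ₀ * τ ρ₀) := by
  have h : ∀ i : Fin 3, orderOf (rho ρ₀ τ (i + 1) * rho ρ₀ τ (i + 1 + 1)) =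
      orderOf (rho ρ₀ τ i * rho ρ₀ τ (i + 1)) := fun i => by
    rw [← map_rho hτ, ← map_rho hτ, ← map_mul, MulEquiv.orderOf_eq, map_rho hτ]
  have h0 : orderOf (rho ρ₀ τ 0 * rho ρ₀ τ (0 + 1)) = orderOf (ρ₀ * τ ρ₀) := by
    rw [← map_rho hτ]
    rfl
  fin_cases i
  · exact h0
  · exact (h 0).trans h0
  · exact (h 1).trans ((h 0).trans h0)

end Rho

variable [Finite F] [CharP F 2] (hF : Nat.card F = 2 ^ (2 * e + 1)) (he : 1 ≤ e)

include hF he in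
/-- If the involutions `a` and `b` do not generate a dihedral group of odd order greater than `2`,
then they fix the same points of the ovoid. -/
theorem smul_eq_of_not {a b : Sz F e} (ha : orderOf a = 2) (hb : orderOf b = 2)
    (h : ¬ (Odd (orderOf (a * b)) ∧ a ≠ b)) {p : ℙ F (Fin 4 → F)} (hp : p ∈ ovoid F e)
    (hap : a • p = p) : b • p = p := by
  by_cases hab : a = b
  · rwa [← hab]
  · exact smul_eq_of_not_odd hF he ha hb (fun h' => h ⟨h', hab⟩) hp hap

/-- The data of a triality triangle: three involutions whose pairwise products have the same odd
order, any two of which generate different dihedral groups. -/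
structure IsTriangle (ρ : Fin 3 → Sz F e) (m : ℕ) : Prop where
  orderOf_eq : ∀ i, orderOf (ρ i) = 2
  orderOf_mul : ∀ i, orderOf (ρ (i + 1) * ρ (i + 2)) = m
  odd : Odd m
  ne : ∀ i, ρ (i + 1) ≠ ρ (i + 2)

/-- The groups generated by two of three involutions. -/
def side (ρ : Fin 3 → Sz F e) (i : Fin 3) : Subgroup (Sz F e) :=
  Subgroup.closure {ρ (i + 1), ρ (i + 2)}

theorem fin_three_add (i : Fin 3) : i + 1 + 1 = i + 2 ∧ i + 1 + 2 = i ∧ i + 2 + 1 = i ∧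
    i + 2 + 2 = i + 1 ∧ i + 1 ≠ i + 2 ∧ i + 1 ≠ i ∧ i + 2 ≠ i := by
  revert i
  decide

include hF he in
-- By the symmetry under `τ`, a failure for one pair is a failure for all pairs. Then the three
-- involutions share their fixed point `p` and all sides equal `{p}`.
theorem isTriangle {ρ₀ : Sz F e} {τ : MulAut (Sz F e)} (hρ : orderOf ρ₀ = 2) (hτ : τ ^ 3 = 1)
    (hnd : NonDegenerate (triangle ρ₀ τ)) :
    IsTriangle (rho ρ₀ τ) (orderOf (ρ₀ * τ ρ₀)) := by
  have h2 := orderOf_rho (τ := τ) hρ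
  have hmul : ∀ i, orderOf (rho ρ₀ τ (i + 1) * rho ρ₀ τ (i + 2)) = orderOf (ρ₀ * τ ρ₀) := by
    intro i
    rw [← (fin_three_add i).1]
    exact orderOf_rho_mul_rho hτ (i + 1)
  have key : Odd (orderOf (ρ₀ * τ ρ₀)) ∧ ∀ i, rho ρ₀ τ (i + 1) ≠ rho ρ₀ τ (i + 2) := by
    by_contra hcon
    have hsome : ∀ i, rho ρ₀ τ (i + 1) = rho ρ₀ τ (i + 2) → rho ρ₀ τ (i + 2) = rho ρ₀ τ i := by
      intro i h
      have := congrArg τ h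
      rwa [map_rho hτ, map_rho hτ, (fin_three_add i).1, (fin_three_add i).2.2.1] at this
    have hnot : ∀ i, ¬ (Odd (orderOf (rho ρ₀ τ (i + 1) * rho ρ₀ τ (i + 2))) ∧
        rho ρ₀ τ (i + 1) ≠ rho ρ₀ τ (i + 2)) := by
      rintro i ⟨h3, h4⟩
      rw [hmul] at h3
      refine hcon ⟨h3, fun j hj => h4 ?_⟩
      have h5 := hsome j hj
      have hall : ∀ k, rho ρ₀ τ k = rho ρ₀ τ j := by
        intro k
        have hk : ∀ k j : Fin 3, k = j ∨ k = j + 1 ∨ k = j + 2 := by decide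
        obtain rfl | rfl | rfl := hk k j
        · rfl
        · rw [hj, h5]
        · rw [h5]
      rw [hall, hall (i + 2)]
    have hstep : ∀ i, ∀ p ∈ ovoid F e, rho ρ₀ τ (i + 1) • p = p → rho ρ₀ τ (i + 2) • p = p :=
      fun i p hp h => smul_eq_of_not hF he (h2 _) (h2 _) (hnot i) hp h
    obtain ⟨p, hp, h0⟩ := exists_fixed_of_orderOf_eq_two hF (h2 0)
    have h1 : rho ρ₀ τ 1 • p = p := hstep 2 p hp h0
    have h2' : rho ρ₀ τ 2 • p = p := hstep 0 p hp h1
    have hall : ∀ i, rho ρ₀ τ i • p = p := by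
      intro i
      fin_cases i
      · exact h0
      · exact h1
      · exact h2'
    have htri : ∀ i, triangle ρ₀ τ i = {p} := by
      intro i
      have hle : sideGroup ρ₀ τ i ≤ MulAction.stabilizer (Sz F e) p := by
        rw [sideGroup, Subgroup.closure_le]
        rintro _ (rfl | rfl) <;> exact hall _
      ext q
      constructor
      · rintro ⟨hq, h, hh, hh2, hhq⟩
        exact (isSuzukiAction hF he).eq_of_fix h hh2 q hq p hp hhq (hle hh)
      · rintro rfl
        exact ⟨hp, rho ρ₀ τ (i + 1), Subgroup.subset_closure (by simp), h2 _, hall _⟩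
    exact hnd 0 1 (by decide) (by rw [htri, htri])
  exact ⟨h2, hmul, key.1, key.2⟩

namespace IsTriangle

variable {ρ : Fin 3 → Sz F e} {m : ℕ} (c : IsTriangle ρ m)

omit [Finite F] [CharP F 2] in
theorem rho_mem_side_add_one (ρ : Fin 3 → Sz F e) (i : Fin 3) : ρ i ∈ side ρ (i + 1) := by
  rw [side, (fin_three_add i).2.1]
  exact Subgroup.subset_closure (by simp)

omit [Finite F] [CharP F 2] in
theorem rho_mem_side_add_two (ρ : Fin 3 → Sz F e) (i : Fin 3) : ρ i ∈ side ρ (i + 2) := by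
  rw [side, (fin_three_add i).2.2.1]
  exact Subgroup.subset_closure (by simp)

omit [Finite F] [CharP F 2] in
theorem rho_mem_side (ρ : Fin 3 → Sz F e) {i j : Fin 3} (h : j ≠ i) : ρ i ∈ side ρ j := by
  have : j = i + 1 ∨ j = i + 2 := by revert i j; decide
  obtain rfl | rfl := this
  · exact rho_mem_side_add_one ρ i
  · exact rho_mem_side_add_two ρ i

include hF he c

theorem isDihedralInStabilizer_iff {i : Fin 3} {H : Subgroup (Sz F e)} :
    IsDihedralInStabilizer m (fixedPoints (side ρ i)) H ↔ H = side ρ i := by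
  have := Suzuki.isDihedralInStabilizer_iff hF he (c.orderOf_eq (i + 1)) (c.orderOf_eq (i + 2))
    (by rw [c.orderOf_mul]; exact c.odd) (c.ne i) (H := H)
  rwa [c.orderOf_mul] at this

theorem eq_rho (hnd : NonDegenerate fun i => fixedPoints (side ρ i)) {i : Fin 3} {s : Sz F e}
    (hs : orderOf s = 2) (h1 : s ∈ side ρ (i + 1)) (h2 : s ∈ side ρ (i + 2)) : s = ρ i := by
  by_contra hne
  obtain ⟨e1, e2, e3, e4, e5, -⟩ := fin_three_add i
  have hm1 := c.orderOf_mul (i + 1)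
  have hm2 := c.orderOf_mul (i + 2)
  rw [e1, e2] at hm1
  rw [e3, e4] at hm2
  have hside1 : side ρ (i + 1) = Subgroup.closure {ρ (i + 2), ρ i} := by rw [side, e1, e2]
  have hside2 : side ρ (i + 2) = Subgroup.closure {ρ i, ρ (i + 1)} := by rw [side, e3, e4]
  have := closure_eq_closure hF he (c.orderOf_eq (i + 2)) (c.orderOf_eq i) (c.orderOf_eq (i + 1))
    (by rw [hm1]; exact c.odd) (hm1.trans hm2.symm) hs (hside1 ▸ h1) (hside2 ▸ h2) hne
  rw [← hside1, ← hside2] at this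
  exact hnd (i + 1) (i + 2) e5 (by simp only [this])

theorem eq_rho_of_ne (hnd : NonDegenerate fun i => fixedPoints (side ρ i)) {i j k : Fin 3}
    (hj : j ≠ i) (hk : k ≠ i) (hjk : j ≠ k) {s : Sz F e}
    (hs : orderOf s = 2) (h1 : s ∈ side ρ j) (h2 : s ∈ side ρ k) : s = ρ i := by
  have key : ∀ i j k : Fin 3, j ≠ i → k ≠ i → j ≠ k →
      (j = i + 1 ∧ k = i + 2) ∨ (j = i + 2 ∧ k = i + 1) := by decide
  obtain ⟨rfl, rfl⟩ | ⟨rfl, rfl⟩ := key i j k hj hk hjk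
  · exact c.eq_rho hF he hnd hs h1 h2
  · exact c.eq_rho hF he hnd hs h2 h1

/-- The involutions of a triangle fix different points. -/
theorem eq_one_of_commute {γ : Sz F e} (h : ∀ i, Commute γ (ρ i)) : γ = 1 := by
  have a := isSuzukiAction hF he
  choose p hp hρp using fun i => exists_fixed_of_orderOf_eq_two hF (c.orderOf_eq i)
  have hγ : ∀ i, γ • p i = p i := fun i => a.eq_of_fix (ρ i) (c.orderOf_eq i) _
    (smul_mem_ovoid _ (hp i)) _ (hp i) (by rw [← mul_smul, ← (h i).eq, mul_smul, hρp]) (hρp i)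
  have hne : ∀ i, p (i + 1) ≠ p (i + 2) := by
    intro i hpp
    have hodd : Odd (orderOf (ρ (i + 1) * ρ (i + 2))) := by rw [c.orderOf_mul]; exact c.odd
    have h1 := eq_one_of_zpowers_smul_eq hF he (c.orderOf_eq _) (c.orderOf_eq _) hodd (hp _)
      (hρp (i + 1)) (Subgroup.mem_zpowers _) (by rw [mul_smul, hpp, hρp, ← hpp, hρp])
    exact c.ne i (by rw [eq_inv_of_mul_eq_one_left h1, inv_of_orderOf_eq_two (c.orderOf_eq _)])
  exact a.eq_one_of_fix γ (p 0) (hp 0) (p 1) (hp 1) (p 2) (hp 2) (hne 2) (hne 1).symm (hne 0)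
    (hγ 0) (hγ 1) (hγ 2)

end IsTriangle

/-! ### Conjugation -/

/-- Conjugation of subgroups. -/
abbrev conjMap (γ : Sz F e) (H : Subgroup (Sz F e)) : Subgroup (Sz F e) :=
  H.map (MulAut.conj γ).toMonoidHom

omit [Finite F] [CharP F 2] in
theorem mem_conjMap {γ x : Sz F e} {H : Subgroup (Sz F e)} :
    x ∈ conjMap γ H ↔ γ⁻¹ * x * γ ∈ H := by
  constructor
  · rintro ⟨y, hy, rfl⟩
    have : γ⁻¹ * (MulAut.conj γ).toMonoidHom y * γ = y := by
      simp [mul_assoc]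
    rw [this]
    exact hy
  · intro h
    exact ⟨_, h, by simp [mul_assoc]⟩

omit [Finite F] [CharP F 2] in
theorem IsDihedralInStabilizer.conj {m : ℕ} {X : Set (ℙ F (Fin 4 → F))} {H : Subgroup (Sz F e)}
    (h : IsDihedralInStabilizer m X H) (γ : Sz F e) :
    IsDihedralInStabilizer m (γ • X) (conjMap γ H) := by
  refine ⟨?_, ?_⟩
  · rw [MulAction.stabilizer_smul_eq_stabilizer_map_conj]
    exact Subgroup.map_mono h.1
  · obtain ⟨f⟩ := h.2
    exact ⟨(H.equivMapOfInjective _ (MulAut.conj γ).injective).symm.trans f⟩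

omit [Finite F] [CharP F 2] in
theorem conjMap_conjMap (γ δ : Sz F e) (H : Subgroup (Sz F e)) :
    conjMap γ (conjMap δ H) = conjMap (γ * δ) H := by
  ext x
  simp only [mem_conjMap, mul_inv_rev, mul_assoc]

omit [Finite F] [CharP F 2] in
theorem conjMap_one (H : Subgroup (Sz F e)) : conjMap 1 H = H := by
  ext x
  simp

omit [Finite F] [CharP F 2] in
theorem isDihedralInStabilizer_smul_iff {m : ℕ} {X : Set (ℙ F (Fin 4 → F))}
    {K : Subgroup (Sz F e)} (h : ∀ H, IsDihedralInStabilizer m X H ↔ H = K) (γ : Sz F e)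
    {H : Subgroup (Sz F e)} : IsDihedralInStabilizer m (γ • X) H ↔ H = conjMap γ K := by
  constructor
  · intro hH
    have h1 := hH.conj γ⁻¹
    rw [inv_smul_smul, h] at h1
    rw [← h1, conjMap_conjMap, mul_inv_cancel, conjMap_one]
  · rintro rfl
    exact ((h K).2 rfl).conj γ

/-! ### The orbit of a triangle under `Sz(q)`. -/

namespace IsTriangle

variable {ρ : Fin 3 → Sz F e} {m : ℕ} (c : IsTriangle ρ m) {T : Triple F}
  (hT : T = fun i => fixedPoints (side ρ i))

include hF he c hT

theorem isDihedral_iff (γ : Sz F e) (i : Fin 3) {H : Subgroup (Sz F e)} :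
    IsDihedralInStabilizer m ((γ • T) i) H ↔ H = conjMap γ (side ρ i) := by
  rw [Pi.smul_apply, hT]
  exact isDihedralInStabilizer_smul_iff (fun H => c.isDihedralInStabilizer_iff hF he) γ

theorem chamberGroup_smul (γ : Sz F e) (i : Fin 3) :
    chamberGroup e m (γ • T) i = conjMap γ (side ρ i) :=
  (c.isDihedral_iff hF he hT γ i).1 (Classical.epsilon_spec
    (p := fun H => IsDihedralInStabilizer m ((γ • T) i) H)
    ⟨_, (c.isDihedral_iff hF he hT γ i).2 rfl⟩)

variable (hnd : NonDegenerate T)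

include hnd

theorem isChamberInvolution_iff (γ : Sz F e) (i : Fin 3) {r : Sz F e} :
    IsChamberInvolution m (γ • T) i r ↔ r = γ * ρ i * γ⁻¹ := by
  rw [IsChamberInvolution, c.chamberGroup_smul hF he hT, c.chamberGroup_smul hF he hT,
    Subgroup.mem_inf, mem_conjMap, mem_conjMap]
  constructor
  · rintro ⟨h2, h3, h4⟩
    have h5 : orderOf (γ⁻¹ * r * γ) = 2 := by
      have := orderOf_conj_eq γ⁻¹ r
      rw [inv_inv] at this
      rw [this, h2]
    rw [← c.eq_rho hF he (hT ▸ hnd) h5 h3 h4]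
    group
  · rintro rfl
    have : γ⁻¹ * (γ * ρ i * γ⁻¹) * γ = ρ i := by group
    rw [this, orderOf_conj_eq]
    exact ⟨c.orderOf_eq i, rho_mem_side_add_one ρ i, rho_mem_side_add_two ρ i⟩

theorem chamberInvolution_smul (γ : Sz F e) (i : Fin 3) :
    chamberInvolution e m (γ • T) i = γ * ρ i * γ⁻¹ :=
  (c.isChamberInvolution_iff hF he hT hnd γ i).1 (Classical.epsilon_spec
    (p := fun r => IsChamberInvolution m (γ • T) i r)
    ⟨_, (c.isChamberInvolution_iff hF he hT hnd γ i).2 rfl⟩)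

/-- An element permuting the members of the triangle permutes the involutions accordingly. -/
theorem conj_rho {δ : Sz F e} {π : Fin 3 → Fin 3} (hπ : Function.Injective π)
    (h : ∀ i, δ • T i = T (π i)) (i : Fin 3) : δ * ρ i * δ⁻¹ = ρ (π i) := by
  have hside : ∀ j, conjMap δ (side ρ j) = side ρ (π j) := by
    intro j
    have h1 := (c.isDihedral_iff hF he hT δ j).2 rfl
    rw [Pi.smul_apply, h, hT] at h1
    exact (c.isDihedralInStabilizer_iff hF he).1 h1
  have hmem : ∀ j, j ≠ i → δ * ρ i * δ⁻¹ ∈ side ρ (π j) := by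
    intro j hj
    rw [← hside, mem_conjMap]
    have : δ⁻¹ * (δ * ρ i * δ⁻¹) * δ = ρ i := by group
    rw [this]
    exact rho_mem_side ρ hj
  obtain ⟨-, -, -, -, h5, h6, h7⟩ := fin_three_add i
  exact c.eq_rho_of_ne hF he (hT ▸ hnd) (fun h => h6 (hπ h)) (fun h => h7 (hπ h))
    (fun h => h5 (hπ h)) (by rw [orderOf_conj_eq, c.orderOf_eq]) (hmem _ h6) (hmem _ h7)

theorem eq_one_of_smul_eq {γ : Sz F e} (h : γ • T = T) : γ = 1 := by
  refine c.eq_one_of_commute hF he fun i => ?_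
  have := c.conj_rho hF he hT hnd (π := id) Function.injective_id (fun j => congrFun h j) i
  exact mul_inv_eq_iff_eq_mul.1 this

theorem smul_injective {γ δ : Sz F e} (h : γ • T = δ • T) : γ = δ := by
  have : δ⁻¹ * γ = 1 := c.eq_one_of_smul_eq hF he hT hnd (by rw [mul_smul, h, inv_smul_smul])
  exact (inv_mul_eq_one.1 this).symm

omit [Finite F] [CharP F 2] hF he c hT in
theorem exists_perm {δ : Sz F e} (h : ({(δ • T) 0, (δ • T) 1, (δ • T) 2} : Set _) =
    {T 0, T 1, T 2}) : ∃ π : Fin 3 → Fin 3, Function.Injective π ∧ ∀ i, δ • T i = T (π i) := by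
  have h1 : ∀ i, ∃ j, δ • T i = T j := by
    intro i
    have h2 : (δ • T) i ∈ ({T 0, T 1, T 2} : Set _) := by
      rw [← h]
      fin_cases i <;> simp
    obtain h2 | h2 | h2 := h2
    · exact ⟨0, h2⟩
    · exact ⟨1, h2⟩
    · exact ⟨2, h2⟩
  choose π hπ using h1
  refine ⟨π, fun i j hij => ?_, hπ⟩
  by_contra hne
  refine hnd i j hne (MulAction.injective δ ?_)
  change δ • T i = δ • T j
  rw [hπ, hπ, hij]

variable (hpr : Proper T)

include hpr

/-- A permutation of three indices has trivial cube, or it has trivial square and a fixed index. -/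
theorem eq_one_of_permutes {δ : Sz F e} {π : Fin 3 → Fin 3} (hπ : Function.Injective π)
    (h : ∀ i, δ • T i = T (π i)) : δ = 1 := by
  have hcases : ∀ π : Fin 3 → Fin 3, Function.Injective π →
      (∀ i, π (π (π i)) = i) ∨ ((∀ i, π (π i) = i) ∧ ∃ i, π i = i) := by decide
  obtain h3 | ⟨h2, i, hi⟩ := hcases π hπ
  · have hδ : δ ^ 3 = 1 := c.eq_one_of_smul_eq hF he hT hnd (by
      funext i
      rw [pow_three, Pi.smul_apply, mul_smul, mul_smul, h, h, h, h3])
    obtain h4 | h4 := (Nat.dvd_prime Nat.prime_three).1 (orderOf_dvd_of_pow_eq_one hδ)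
    · exact orderOf_eq_one_iff.1 h4
    · exact absurd h4 ((isSuzukiAction hF he).orderOf_ne_three δ)
  · have hδ : δ ^ 2 = 1 := c.eq_one_of_smul_eq hF he hT hnd (by
      funext i
      rw [pow_two, Pi.smul_apply, mul_smul, h, h, h2])
    by_contra hne
    have hδ2 := orderOf_eq_prime hδ hne
    have hcomm := c.conj_rho hF he hT hnd hπ h i
    rw [hi] at hcomm
    have hcomm : Commute δ (ρ i) := mul_inv_eq_iff_eq_mul.1 hcomm
    have a := isSuzukiAction hF he
    obtain ⟨p, hp, hρp⟩ := exists_fixed_of_orderOf_eq_two hF (c.orderOf_eq i)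
    have hδp : δ • p = p := a.eq_of_fix (ρ i) (c.orderOf_eq i) _ (smul_mem_ovoid _ hp) _ hp
      (by rw [← mul_smul, ← hcomm.eq, mul_smul, hρp]) hρp
    have hδi : δ ∈ MulAction.stabilizer (Sz F e) (fixedPoints (side ρ i)) := by
      have := h i
      rw [hi, hT] at this
      exact this
    obtain ⟨q, hq, hδq⟩ := exists_smul_eq_of_mem_stabilizer hF he (c.orderOf_eq (i + 1))
      (c.orderOf_eq (i + 2)) (by rw [c.orderOf_mul]; exact c.odd) (c.ne i) hδ2 hδi
    have hpq : q = p := a.eq_of_fix δ hδ2 q hq.1 p hp hδq hδp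
    rw [hpq] at hq
    have hall : ∀ j, p ∈ T j := by
      intro j
      rw [hT]
      by_cases hj : j = i
      · rw [hj]; exact hq
      · exact ⟨hp, ρ i, rho_mem_side ρ hj, c.orderOf_eq i, hρp⟩
    have : p ∈ T 0 ∩ T 1 ∩ T 2 := ⟨⟨hall 0, hall 1⟩, hall 2⟩
    rw [hpr] at this
    exact this

theorem unordered_injective : Function.Injective
    fun γ : Sz F e => ({(γ • T) 0, (γ • T) 1, (γ • T) 2} : Set (Set (ℙ F (Fin 4 → F)))) := by
  intro γ δ h
  have h : ({(γ • T) 0, (γ • T) 1, (γ • T) 2} : Set (Set (ℙ F (Fin 4 → F)))) =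
    {(δ • T) 0, (δ • T) 1, (δ • T) 2} := h
  have h1 : ({((δ⁻¹ * γ) • T) 0, ((δ⁻¹ * γ) • T) 1, ((δ⁻¹ * γ) • T) 2} :
      Set (Set (ℙ F (Fin 4 → F)))) = {T 0, T 1, T 2} := by
    have := congrArg (fun s => (fun x => δ⁻¹ • x) '' s) h
    simpa [Set.image_insert_eq, mul_smul] using this
  obtain ⟨π, hπ, h2⟩ := exists_perm hnd h1
  exact (inv_mul_eq_one.1 (c.eq_one_of_permutes hF he hT hnd hpr hπ h2)).symm

end IsTriangle

end Suzuki

/-! ### The chamber system on the orbit. -/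

theorem theorem3p9 {F : Type*} [Field F] [Finite F] (e : ℕ) (he : 1 ≤ e)
    (he3 : 3 ∣ 2 * e + 1) (hF : Nat.card F = 2 ^ (2 * e + 1))
    (ρ₀ : Suzuki.Sz F e) (hρ : orderOf ρ₀ = 2)
    (τ : MulAut (Suzuki.Sz F e)) (hτ : Suzuki.IsTriality τ)
    (T : Suzuki.Triple F) (hT : T = Suzuki.triangle ρ₀ τ)
    (hproper : Suzuki.Proper T) (hnondeg : Suzuki.NonDegenerate T)
    (m : ℕ) (hm : m = orderOf (ρ₀ * τ ρ₀)) :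
    -- the numbers of ordered and of unordered triples
    Nat.card (Suzuki.chambers e T) = Nat.card (Suzuki.Sz F e) ∧
    Nat.card (Suzuki.unorderedChambers e T) = Nat.card (Suzuki.Sz F e) ∧
    -- the groups `H_i(d)` and the involutions `ρ_i(d)` are well defined
    (∀ d ∈ Suzuki.chambers e T, ∀ i : Fin 3,
      ∃! H : Subgroup (Suzuki.Sz F e), Suzuki.IsDihedralInStabilizer m (d i) H) ∧
    (∀ d ∈ Suzuki.chambers e T, ∀ i : Fin 3,
      ∃! r : Suzuki.Sz F e, Suzuki.IsChamberInvolution m d i r) ∧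
    -- the relations `∼_i` on the orbit form a chamber system, on which the group acts by
    -- automorphisms, regularly on the chambers
    ∃ S : ChamberSystem (Fin 3) (Suzuki.chambers e T),
      (∀ (i : Fin 3) (c₁ c₂ : Suzuki.chambers e T),
        S.adj i c₁ c₂ ↔ Suzuki.Adj e m i (c₁ : Suzuki.Triple F) c₂) ∧
      ∃ ψ : Suzuki.Sz F e →* S.autGroup,
        (∀ (γ : Suzuki.Sz F e) (c : Suzuki.chambers e T),
          (((ψ γ : Equiv.Perm (Suzuki.chambers e T)) c : Suzuki.chambers e T) : Suzuki.Triple F)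
            = γ • (c : Suzuki.Triple F)) ∧
        ∀ c d : Suzuki.chambers e T,
          ∃! γ : Suzuki.Sz F e, (ψ γ : Equiv.Perm (Suzuki.chambers e T)) c = d := by
  have hchar : CharP F 2 := by
    have := Fintype.ofFinite F
    have := Fact.mk Nat.prime_two
    exact charP_of_card_eq_prime_pow (Nat.card_eq_fintype_card.symm.trans hF)
  have c : Suzuki.IsTriangle (Suzuki.rho ρ₀ τ) m := by
    rw [hm]
    exact Suzuki.isTriangle hF he hρ (hτ.1 ▸ pow_orderOf_eq_one τ) (hT ▸ hnondeg)
  have hT' : T = fun i => Suzuki.fixedPoints (Suzuki.side (Suzuki.rho ρ₀ τ) i) := hT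
  have hinj : ∀ {γ δ : Suzuki.Sz F e}, γ • T = δ • T → γ = δ :=
    fun h => c.smul_injective hF he hT' hnondeg h
  -- In terms of group elements the adjacency says that `γ` and `δ` lie in the same left coset of
  -- `⟨ρ_i⟩`.
  have hadj : ∀ (i : Fin 3) (γ δ : Suzuki.Sz F e), Suzuki.Adj e m i (γ • T) (δ • T) ↔
      δ = γ * Suzuki.rho ρ₀ τ i ∨ γ = δ := by
    intro i γ δ
    rw [Suzuki.Adj, c.chamberInvolution_smul hF he hT' hnondeg, ← mul_smul]
    refine or_congr ⟨fun h => ?_, fun h => ?_⟩ ⟨hinj, fun h => by rw [h]⟩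
    · have h1 := hinj h
      have h2 := congrArg (fun x => (γ * Suzuki.rho ρ₀ τ i * γ⁻¹)⁻¹ * x) h1
      simp only [inv_mul_cancel_left] at h2
      rw [← h2, mul_inv_rev, mul_inv_rev, inv_inv, inv_of_orderOf_eq_two (c.orderOf_eq i)]
      group
    · rw [h, mul_assoc, inv_mul_cancel_left, mul_assoc,
        mul_self_of_orderOf_eq_two (c.orderOf_eq i), mul_one]
  have hself := fun i => mul_self_of_orderOf_eq_two (c.orderOf_eq i)
  refine ⟨?_, ?_, ?_, ?_, ?_⟩
  · exact (Nat.card_congr (Equiv.ofBijective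
      (fun γ : Suzuki.Sz F e => (⟨γ • T, γ, rfl⟩ : Suzuki.chambers e T))
      ⟨fun γ δ h => hinj (congrArg Subtype.val h), by rintro ⟨_, γ, rfl⟩; exact ⟨γ, rfl⟩⟩)).symm
  · exact (Nat.card_congr (Equiv.ofInjective _
      (c.unordered_injective hF he hT' hnondeg hproper))).symm
  · rintro _ ⟨γ, rfl⟩ i
    exact ⟨_, (c.isDihedral_iff hF he hT' γ i).2 rfl,
      fun H hH => (c.isDihedral_iff hF he hT' γ i).1 hH⟩
  · rintro _ ⟨γ, rfl⟩ i
    exact ⟨_, (c.isChamberInvolution_iff hF he hT' hnondeg γ i).2 rfl,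
      fun r hr => (c.isChamberInvolution_iff hF he hT' hnondeg γ i).1 hr⟩
  · let S : ChamberSystem (Fin 3) (Suzuki.chambers e T) := ⟨fun i =>
      { r := fun c₁ c₂ => Suzuki.Adj e m i (c₁ : Suzuki.Triple F) c₂
        iseqv := by
          refine ⟨fun _ => Or.inr rfl, ?_, ?_⟩
          · rintro ⟨_, γ, rfl⟩ ⟨_, δ, rfl⟩ h
            refine (hadj i δ γ).2 (((hadj i γ δ).1 h).imp (fun h => ?_) Eq.symm)
            rw [h, mul_assoc, hself, mul_one]
          · rintro ⟨_, γ, rfl⟩ ⟨_, δ, rfl⟩ ⟨_, ε, rfl⟩ h h'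
            refine (hadj i γ ε).2 ?_
            obtain h | rfl := (hadj i γ δ).1 h
            · obtain h' | rfl := (hadj i δ ε).1 h'
              · right
                rw [h', h, mul_assoc, hself, mul_one]
              · exact Or.inl h
            · exact (hadj i γ ε).1 h' }⟩
    have hhom : ∀ g : Suzuki.Sz F e, S.IsHom (fun x => g • x) := by
      rintro g i ⟨_, γ, rfl⟩ ⟨_, δ, rfl⟩ h
      have h : Suzuki.Adj e m i (γ • T) (δ • T) := h
      have h1 : Suzuki.Adj e m i ((g * γ) • T) ((g * δ) • T) :=
        (hadj i _ _).2 (((hadj i γ δ).1 h).imp (fun h => by rw [h, mul_assoc])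
          (fun h => by rw [h]))
      rw [mul_smul, mul_smul] at h1
      exact h1
    refine ⟨S, fun _ _ _ => Iff.rfl, (MulAction.toPermHom (Suzuki.Sz F e)
      (Suzuki.chambers e T)).codRestrict _ fun g => ⟨hhom g, hhom g⁻¹⟩, fun _ _ => rfl, ?_⟩
    rintro ⟨_, γ, rfl⟩ ⟨_, δ, rfl⟩
    refine ⟨δ * γ⁻¹, Subtype.ext ?_, fun g hg => ?_⟩
    · change (δ * γ⁻¹) • γ • T = δ • T
      rw [mul_smul, inv_smul_smul]
    · have hg : g • γ • T = δ • T := congrArg Subtype.val hg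
      rw [← mul_smul] at hg
      exact eq_mul_inv_of_mul_eq (hinj hg)
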